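/- **Setting.** Consider an open network of queues with nodes $1,\dots,J$ ($J<\infty$), unlimited capacity at every node and one class of customers. - Exogenous customers arrive at node $j$ in a Poisson process of rate $\nu_j\ge 0$, where $\sum_j\nu_j>0$. - While $n$ customers are at node $j$, services there are completed at exponential rate $\mu_j(n)$, where $\mu_j(0)=0$ and $\mu_j(n)>0$ for $n>0$. That is, each service requires an amount of work that is exponentially distributed with mean $1$, and node $j$ works at speed $\mu_j(n)$ while $n$ customers are present. - A customer who completes a service at node $j$ moves to node $k$ with probability $p(j,k)$ and leaves the network with probability $p(j)=1-\sum_{k=1}^J p(j,k)\ge 0$. Here $p(j,j)=0$, every node can be reached from every other node through the $p(j,k)$, and from every node a customer can eventually leave the network. - The arrival processes, the service requirements, the routing decisions and the initial state are mutually independent. Let $\mathcal N(t)=(N_1(t),\dots,N_J(t))$, $t\ge 0$, be the vector of queue lengths, a process with right-continuous step paths in $\mathbb N_0^J$, and suppose that $\mathcal N$ is stationary. Let $\alpha=(\alpha_1,\dots,\alpha_J)$, with $\alpha_j\ge 0$, solve the traffic equations $$\alpha_j=\nu_j+\sum_{k=1}^J\alpha_k\,p(k,j),\qquad j=1,\dots,J.$$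 Let $D_k(t)$ be the number of customers who leave the network from node $k$ during $[0,t]$. **Theorem 2.3.** The processes $D_1,\dots,D_J$ are mutually independent, and $D_k$ is a Poisson process of rate $\alpha_k\,p(k)$ for $k=1,\dots,J$. Moreover, for every fixed $t_0\ge 0$, the departure processes up to $t_0$, that is the family $(D_k(s))_{1\le k\le J,\ 0\le s\le t_0}$, are jointly independent of the state $\mathcal N(t_0)$. -/

import Mathlib

open MeasureTheory ProbabilityTheory Topology Filter
open scoped NNReal ENNReal

/-- Parameters of an open network of queues with one class of customers and nodes `ι`. -/
structure OpenNetworkData (ι : Type*) [Fintype ι] where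
  /-- `ν j` is the rate of the exogenous arrivals at node `j`. -/
  ν : ι → ℝ≥0
  /-- `μ j n` is the service rate at node `j` while `n` customers are present there. -/
  μ : ι → ℕ → ℝ≥0
  /-- `p j k` is the probability that a customer leaving node `j` goes to node `k`. -/
  p : ι → ι → ℝ≥0
  μ_zero : ∀ j, μ j 0 = 0
  μ_pos : ∀ j n, 0 < n → 0 < μ j n
  p_sum_le : ∀ j, ∑ k, p j k ≤ 1
  p_self : ∀ j, p j j = 0
  /-- There are exogenous arrivals. -/
  exists_ν_pos : ∃ j, 0 < ν j
  /-- Every node may be visited after any other node. -/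
  irreducible : ∀ j k, Relation.ReflTransGen (fun a b => 0 < p a b) j k
  /-- From every node a customer may eventually leave the network. -/
  can_leave : ∀ j, ∃ k, Relation.ReflTransGen (fun a b => 0 < p a b) j k ∧ ∑ i, p k i < 1

namespace OpenNetworkData

variable {ι : Type*} [Fintype ι]

/-- The probability that a customer leaving node `k` leaves the network
(the subtraction is not truncated, by `p_sum_le`). -/
noncomputable def exitProb (𝒥 : OpenNetworkData ι) (k : ι) : ℝ≥0 := 1 - ∑ j, 𝒥.p k j

/-- The traffic equations `α j = ν j + ∑ k, α k * p k j`. -/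
def TrafficEquations (𝒥 : OpenNetworkData ι) (α : ι → ℝ≥0) : Prop :=
  ∀ j, α j = 𝒥.ν j + ∑ k, α k * 𝒥.p k j

end OpenNetworkData

/-- The number of points in `(-∞, x]` of the sequence `g 0, g 0 + g 1, g 0 + g 1 + g 2, …`.
If the gaps `g m` are independent exponential variables of mean one, then `x ↦ renewalCount g x`
is a Poisson process of unit rate and `t ↦ renewalCount g (ν * t)` one of rate `ν`. -/
noncomputable def renewalCount (g : ℕ → ℝ) (x : ℝ) : ℕ :=
  {m : ℕ | ∑ i ∈ Finset.range (m + 1), g i ≤ x}.ncard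

/-- Labels of the independent sources of randomness of an open network: the initial state, the
gaps in the exogenous arrival streams, the service requirements, and the routing decisions. -/
inductive RandomSource (ι : Type*)
  | init : RandomSource ι
  | arrival (j : ι) (m : ℕ) : RandomSource ι
  | service (j : ι) (m : ℕ) : RandomSource ι
  | routing (j : ι) (m : ℕ) : RandomSource ι

/-- An open Jackson network with parameters `𝒥`, on a probability space `(Ω, P)`, started at
time `0`, built from its arrivals, its services and its routing decisions.

The exogenous arrivals at node `j` form a Poisson process of rate `ν j` (exponential gaps of
mean one, run through at speed `ν j`). The service requirements at node `j` are exponential of mean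
one and are worked off at speed `μ j n` while `n` customers are at node `j`; so, while `n` customers
are there, the time to the next service completion is exponential with parameter `μ j n`.
After the `m`-th service completion at node `j`, the customer goes to node `k` with
probability `p j k` (`route j m = some k`) and leaves the network with the remaining probability
(`route j m = none`). The initial state, the gaps, the requirements and the routing decisions
are mutually independent. -/
structure OpenJacksonNetwork {ι : Type*} [Fintype ι] (𝒥 : OpenNetworkData ι)
    {Ω : Type*} [MeasurableSpace Ω] (P : Measure Ω) where
  /-- `N t ω j` is the number of customers at node `j` at time `t`. -/
  N : ℝ≥0 → Ω → ι → ℕ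
  /-- Unscaled gaps between the exogenous arrivals at node `j`. -/
  arrivalGap : ι → ℕ → Ω → ℝ
  /-- Service requirements at node `j`. -/
  requirement : ι → ℕ → Ω → ℝ
  /-- Routing decisions at node `j`; `none` is the exterior of the network. -/
  route : ι → ℕ → Ω → Option ι
  measurable_N : ∀ t, Measurable (N t)
  measurable_arrivalGap : ∀ j m, Measurable (arrivalGap j m)
  measurable_requirement : ∀ j m, Measurable (requirement j m)
  measurable_route : ∀ j m x, MeasurableSet {ω | route j m ω = x}
  law_arrivalGap : ∀ j m, HasLaw (arrivalGap j m) (expMeasure 1) P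
  law_requirement : ∀ j m, HasLaw (requirement j m) (expMeasure 1) P
  law_route_some : ∀ j m k, P {ω | route j m ω = some k} = (𝒥.p j k : ℝ≥0∞)
  law_route_none : ∀ j m, P {ω | route j m ω = none} = (𝒥.exitProb j : ℝ≥0∞)
  /-- The σ-algebras generated by all the sources of randomness are mutually independent. -/
  indep : iIndep (fun s : RandomSource ι => match s with
    | .init => MeasurableSpace.comap (N 0) inferInstance
    | .arrival j m => MeasurableSpace.comap (arrivalGap j m) inferInstance
    | .service j m => MeasurableSpace.comap (requirement j m) inferInstance
    | .routing j m => MeasurableSpace.comap (route j m) ⊤) P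
  /-- The paths are right-continuous step functions, with limits from the left. -/
  path_regular : ∀ᵐ ω ∂P, ∀ t, (∀ᶠ s in 𝓝[>] t, N s ω = N t ω) ∧
    ∃ n, ∀ᶠ s in 𝓝[<] t, N s ω = n
  /-- Conservation of customers at node `j`: present at time `t` plus services completed by time `t`
  equals present initially, plus exogenous arrivals, plus arrivals from the nodes of the network. -/
  balance : ∀ᵐ ω ∂P, ∀ (t : ℝ≥0) (j : ι),
    N t ω j + renewalCount (fun m => requirement j m ω)
        (∫ s in (0 : ℝ)..t, (𝒥.μ j (N s.toNNReal ω j) : ℝ)) =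
      N 0 ω j + renewalCount (fun m => arrivalGap j m ω) (𝒥.ν j * t) +
        ∑ k, {m : ℕ | m < renewalCount (fun m => requirement k m ω)
          (∫ s in (0 : ℝ)..t, (𝒥.μ k (N s.toNNReal ω k) : ℝ)) ∧ route k m ω = some j}.ncard

namespace OpenJacksonNetwork

variable {ι : Type*} [Fintype ι] {𝒥 : OpenNetworkData ι}
  {Ω : Type*} [MeasurableSpace Ω] {P : Measure Ω}

/-- The number of services completed at node `k` during `[0, t]`. -/
noncomputable def completed (X : OpenJacksonNetwork 𝒥 P) (k : ι) (t : ℝ≥0) (ω : Ω) : ℕ :=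
  renewalCount (fun m => X.requirement k m ω)
    (∫ s in (0 : ℝ)..t, (𝒥.μ k (X.N s.toNNReal ω k) : ℝ))

/-- The departure process from node `k` to the exterior: the number of customers who, during
`[0, t]`, complete a service at node `k` and then leave the network. -/
noncomputable def departures (X : OpenJacksonNetwork 𝒥 P) (k : ι) (t : ℝ≥0) (ω : Ω) : ℕ :=
  {m : ℕ | m < X.completed k t ω ∧ X.route k m ω = none}.ncard

/-- The process of queue lengths is stationary: for every `h ≥ 0`, the processes
`(N (h + t))` and `(N t)`, `t ≥ 0`, have the same law. -/
def IsStationary (X : OpenJacksonNetwork 𝒥 P) : Prop :=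
  ∀ h : ℝ≥0, IdentDistrib (fun ω (t : ℝ≥0) => X.N (h + t) ω) (fun ω (t : ℝ≥0) => X.N t ω) P P

end OpenJacksonNetwork

/-- `X` is a (homogeneous) Poisson process of rate `r`: almost surely it starts at `0` and has
nondecreasing right-continuous paths, its increments over disjoint intervals are independent, and
`X t - X s` has the Poisson law of mean `r * (t - s)` for `s ≤ t`. -/
structure IsPoissonProcess {Ω : Type*} [MeasurableSpace Ω] (X : ℝ≥0 → Ω → ℕ) (r : ℝ≥0)
    (P : Measure Ω) : Prop where
  zero : ∀ᵐ ω ∂P, X 0 ω = 0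
  path : ∀ᵐ ω ∂P, Monotone (fun t => X t ω) ∧ ∀ t, ∀ᶠ s in 𝓝[>] t, X s ω = X t ω
  indep_increments : HasIndepIncrements X P
  law_increment : ∀ s t, s ≤ t → HasLaw (fun ω => X t ω - X s ω) (poissonMeasure (r * (t - s))) P

/-! The proof does not reverse time. It enlarges the state by counters of the departures from each
node in finitely many disjoint time windows, and computes the joint law of queue lengths and
counters at a fixed time by comparing two solutions of a forward equation.

Because exponential variables are memoryless, the network starts afresh after each event
(`map_step_eq_prod`). Hence the probabilities `occupation` of being in a given configuration after
exactly `r` events obey an integral equation obtained by conditioning on the last event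
(`occupation_succ`). Their partial sums over `r` stay below the product solution described next, by
induction on the number of terms (`sum_occupation_le`).

That solution is a product form `h` for the queues times independent Poisson probabilities for the
counters. Its source is partial balance (`inflow_productForm`): the flow into state `x` by exits
from node `k` is `h (x + e_k) * μ k (x k + 1) * p(k) = h x * α k * p(k)`. So, relative to `h x`,
exits occur at the constant rate `α k * p(k)`, whatever `x` is, and the counters evolve like Poisson
processes that ignore the queues. Arrivals and transfers into a node balance the services there by
the traffic equations, and summing these equations shows that customers enter and leave the network
at equal total rates (`TrafficEquations.sum_exit`). Together this gives `forward_equation_product`.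

Two further facts are needed. The stationary law is itself a multiple of the product form: without
windows, the same comparison and the accessibility of the empty state force it
(`stationary_eq_productForm`). And a path that obeys the balance equations agrees almost surely with
the construction event by event (`IsPath.exists_iterate_occupied`); only finitely many events occur
by time `t`, since each channel has done a finite amount of work and its partial sums of
requirements are unbounded.

The law of the state and counters is then bounded, point by point, by the product of the stationary
law and Poisson laws. Both are probability measures, so they coincide (`IsStationary.map_config`).
Taking the cells of a time grid as windows gives all the independence claims at finitely many times,
which determines them for the processes. -/

/-- The discrete σ-algebra on the routing decisions. -/
instance Option.discreteMeasurableSpace {α : Type*} : MeasurableSpace (Option α) := ⊤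

instance {α : Type*} : DiscreteMeasurableSpace (Option α) := ⟨fun _ => trivial⟩

/-! ### Splitting the first term off an i.i.d. sequence -/

section Streams

variable {α : Type*}

/-- The sequence with first term `p.1` and remaining terms `p.2`. -/
def consStream (p : α × (ℕ → α)) : ℕ → α
  | 0 => p.1
  | m + 1 => p.2 m

@[simp] lemma consStream_zero (p : α × (ℕ → α)) : consStream p 0 = p.1 := rfl

@[simp] lemma consStream_succ (p : α × (ℕ → α)) (m : ℕ) : consStream p (m + 1) = p.2 m := rfl

variable [MeasurableSpace α]

lemma measurable_consStream : Measurable (consStream (α := α)) := by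
  refine measurable_pi_lambda _ fun m => ?_
  cases m with
  | zero => exact measurable_fst
  | succ m => exact (measurable_pi_apply m).comp measurable_snd

lemma infinitePi_eq_map_consStream (ξ : Measure α) [IsProbabilityMeasure ξ] :
    Measure.infinitePi (fun _ : ℕ => ξ) =
      (ξ.prod (Measure.infinitePi (fun _ : ℕ => ξ))).map consStream := by
  symm
  refine Measure.eq_infinitePi _ fun s t ht => ?_
  rw [Measure.map_apply measurable_consStream
    (MeasurableSet.pi s.countable_toSet fun i _ => ht i)]
  -- A box over `s` is a condition on the head, void if `0 ∉ s`, times a box on the tail over the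
  -- predecessors of the positive indices.
  let s' : Finset ℕ := s.preimage Nat.succ (Nat.succ_injective.injOn)
  have hpre : consStream ⁻¹' (Set.pi s t) =
      (if 0 ∈ s then t 0 else Set.univ) ×ˢ (Set.pi s' (fun m => t (m + 1))) := by
    ext p
    simp only [Set.mem_preimage, Set.mem_pi, Finset.mem_coe, Set.mem_prod, s',
      Finset.mem_preimage]
    constructor
    · intro h
      refine ⟨?_, fun m hm => h (m + 1) hm⟩
      split_ifs with h0
      · exact h 0 h0
      · trivial
    · rintro ⟨h0, h1⟩ m hm
      cases m with
      | zero => simpa [hm] using h0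
      | succ m => exact h1 m hm
  rw [hpre, Measure.prod_prod, Measure.infinitePi_pi _ (fun i _ => ht _)]
  by_cases h0 : 0 ∈ s
  · have : s = insert 0 (s'.map ⟨Nat.succ, Nat.succ_injective⟩) := by
      ext m
      cases m <;> simp [s', h0]
    rw [if_pos h0]
    conv_rhs => rw [this]
    rw [Finset.prod_insert (by simp), Finset.prod_map]
    rfl
  · have : s = s'.map ⟨Nat.succ, Nat.succ_injective⟩ := by
      ext m
      cases m <;> simp [s', h0]
    rw [if_neg h0, measure_univ, one_mul]
    conv_rhs => rw [this]
    rw [Finset.prod_map]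
    rfl

end Streams

/-! ### The exponential law of mean one -/

section Exponential

instance : IsProbabilityMeasure (expMeasure 1) := isProbabilityMeasure_expMeasure one_pos

lemma lintegral_expMeasure_one {F : ℝ → ℝ≥0∞} (hF : Measurable F) :
    ∫⁻ g, F g ∂expMeasure 1 = ∫⁻ g in Set.Ioi 0, ENNReal.ofReal (Real.exp (-g)) * F g := by
  have h1 : expMeasure 1 = volume.withDensity (exponentialPDF 1) := rfl
  have h2 : Measurable (exponentialPDF 1) := (measurable_exponentialPDFReal 1).ennreal_ofReal
  rw [h1, lintegral_withDensity_eq_lintegral_mul _ h2 hF, ← lintegral_indicator measurableSet_Ioi]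
  refine lintegral_congr_ae ?_
  -- The density at the single point `0` is irrelevant, which allows the open half-line.
  have : ∀ᵐ g : ℝ, g ≠ 0 := by simp [ae_iff]
  filter_upwards [this] with g hg
  rw [Set.indicator_apply]
  split_ifs with h
  · simp [exponentialPDF_eq, (Set.mem_Ioi.1 h).le]
  · have : g < 0 := lt_of_le_of_ne (not_lt.1 h) hg
    simp [exponentialPDF_of_neg this]

lemma ae_pos_expMeasure_one : ∀ᵐ g ∂expMeasure 1, (0 : ℝ) < g := by
  rw [ae_iff, ← lintegral_indicator_one (by measurability),
    lintegral_expMeasure_one (measurable_one.indicator (by measurability)),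
    setLIntegral_congr_fun (g := 0) measurableSet_Ioi]
  · simp
  · intro g hg
    simp [Set.mem_Ioi.1 hg]

/-- The exponential distribution is memoryless. -/
lemma lintegral_expMeasure_one_sub {a : ℝ} (ha : 0 ≤ a) {F : ℝ → ℝ≥0∞} (hF : Measurable F) :
    ∫⁻ g, (Set.Ioi a).indicator (fun g => F (g - a)) g ∂expMeasure 1 =
      ENNReal.ofReal (Real.exp (-a)) * ∫⁻ g, F g ∂expMeasure 1 := by
  have hm : Measurable ((Set.Ioi a).indicator (fun g => F (g - a))) :=
    (hF.comp (measurable_id.sub_const a)).indicator measurableSet_Ioi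
  rw [lintegral_expMeasure_one hm, lintegral_expMeasure_one hF,
    ← lintegral_const_mul _ (by fun_prop), ← lintegral_indicator measurableSet_Ioi,
    ← lintegral_indicator measurableSet_Ioi, ← lintegral_add_right_eq_self _ a]
  refine lintegral_congr fun g => ?_
  by_cases hg : 0 < g
  · have h1 : 0 < g + a := by linarith
    have h2 : a < g + a := by linarith
    simp only [Set.indicator_of_mem (Set.mem_Ioi.2 h1), Set.indicator_of_mem (Set.mem_Ioi.2 h2),
      Set.indicator_of_mem (Set.mem_Ioi.2 hg), add_sub_cancel_right, ← mul_assoc]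
    rw [← ENNReal.ofReal_mul (Real.exp_pos _).le, ← Real.exp_add]
    congr 3
    ring
  · have h2 : ¬ a < g + a := by linarith
    simp [Set.indicator_apply, hg, h2]

/-- Work of mean one done at speed `a` takes a time with density `a * exp (-a s)`. This turns
requirements into waiting times. -/
lemma lintegral_expMeasure_one_scale {a : ℝ} (ha : 0 < a) {F : ℝ → ℝ≥0∞} (hF : Measurable F) :
    ∫⁻ g, F (g / a) ∂expMeasure 1 =
      ∫⁻ s in Set.Ioi 0, ENNReal.ofReal (a * Real.exp (-(a * s))) * F s := by
  rw [lintegral_expMeasure_one (by fun_prop)]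
  have h := Real.smul_map_volume_mul_left ha.ne'
  rw [← lintegral_indicator measurableSet_Ioi, ← lintegral_indicator measurableSet_Ioi]
  nth_rw 1 [← h]
  rw [lintegral_smul_measure, lintegral_map (Measurable.indicator (by fun_prop) measurableSet_Ioi)
    (by fun_prop), smul_eq_mul, ← lintegral_const_mul' _ _ ENNReal.ofReal_ne_top]
  refine lintegral_congr fun s => ?_
  by_cases hs : 0 < s
  · rw [Set.indicator_of_mem (Set.mem_Ioi.2 (by positivity)),
      Set.indicator_of_mem (Set.mem_Ioi.2 hs),
      ENNReal.ofReal_mul ha.le, abs_of_pos ha, mul_assoc, mul_div_cancel_left₀ _ ha.ne']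
  · have : ¬ 0 < a * s := by
      rw [mul_pos_iff_of_pos_left ha]; exact hs
    simp [hs, this]

end Exponential

/-! ### Event channels and the law of their sources of randomness -/

namespace OpenNetworkData

variable {ι : Type*} [Fintype ι] (𝒥 : OpenNetworkData ι)

/-- The speed at which channel `c` runs in state `x`: `Sum.inl j` are the exogenous arrivals at
node `j`, and `Sum.inr j` are the services at node `j`. -/
def rate (c : ι ⊕ ι) (x : ι → ℕ) : ℝ≥0 :=
  match c with
  | .inl j => 𝒥.ν j
  | .inr j => 𝒥.μ j (x j)

/-- The total event rate in state `x`. -/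
def totalRate (x : ι → ℕ) : ℝ≥0 := ∑ c, 𝒥.rate c x

/-- The probability of the mark `m` at an event of channel `c`. -/
noncomputable def weight (c : ι ⊕ ι) (m : Option ι) : ℝ≥0 :=
  match c, m with
  | .inl _, none => 1
  | .inl _, some _ => 0
  | .inr j, none => 𝒥.exitProb j
  | .inr j, some k => 𝒥.p j k

lemma sum_weight (c : ι ⊕ ι) : ∑ m, 𝒥.weight c m = 1 := by
  rw [Fintype.sum_option]
  cases c with
  | inl j => simp [weight]
  | inr j => simp only [weight, exitProb]; exact tsub_add_cancel_of_le (𝒥.p_sum_le j)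

lemma totalRate_pos (x : ι → ℕ) : 0 < 𝒥.totalRate x := by
  obtain ⟨j, hj⟩ := 𝒥.exists_ν_pos
  exact Finset.sum_pos' (fun _ _ => zero_le) ⟨.inl j, Finset.mem_univ _, hj⟩

/-- The law of the marks of channel `c`. -/
noncomputable def markLaw (c : ι ⊕ ι) : Measure (Option ι) :=
  ∑ m, (𝒥.weight c m : ℝ≥0∞) • Measure.dirac m

lemma lintegral_markLaw (c : ι ⊕ ι) (F : Option ι → ℝ≥0∞) :
    ∫⁻ m, F m ∂𝒥.markLaw c = ∑ m, (𝒥.weight c m : ℝ≥0∞) * F m := by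
  simp only [markLaw, lintegral_finsetSum_measure, lintegral_smul_measure, lintegral_dirac,
    smul_eq_mul]

instance (c : ι ⊕ ι) : IsProbabilityMeasure (𝒥.markLaw c) := by
  constructor
  rw [← lintegral_one, lintegral_markLaw]
  simp only [mul_one]
  exact_mod_cast 𝒥.sum_weight c

/-- The law of one pair of an exponential requirement and a mark of channel `c`. -/
noncomputable def unitLaw (c : ι ⊕ ι) : Measure (ℝ × Option ι) :=
  (expMeasure 1).prod (𝒥.markLaw c)

instance (c : ι ⊕ ι) : IsProbabilityMeasure (𝒥.unitLaw c) := by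
  unfold unitLaw; infer_instance

/-- The law of the source of randomness of channel `c`. -/
noncomputable def streamLaw (c : ι ⊕ ι) : Measure (ℕ → ℝ × Option ι) :=
  Measure.infinitePi (fun _ : ℕ => 𝒥.unitLaw c)

instance (c : ι ⊕ ι) : IsProbabilityMeasure (𝒥.streamLaw c) := by
  unfold streamLaw; infer_instance

/-- The joint law of all sources of randomness but the initial state. -/
noncomputable def sourceLaw : Measure (ι ⊕ ι → ℕ → ℝ × Option ι) := Measure.pi 𝒥.streamLaw

instance : IsProbabilityMeasure 𝒥.sourceLaw := by
  unfold sourceLaw; infer_instance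

/-- An i.i.d. stream is its head followed by a fresh copy of itself, so integration can start with
the head. -/
lemma lintegral_streamLaw (c : ι ⊕ ι) {F : (ℕ → ℝ × Option ι) → ℝ≥0∞} (hF : Measurable F) :
    ∫⁻ f, F f ∂𝒥.streamLaw c = ∫⁻ g, ∑ m, (𝒥.weight c m : ℝ≥0∞) *
      ∫⁻ f, F (consStream ((g, m), f)) ∂𝒥.streamLaw c ∂expMeasure 1 := by
  conv_lhs => rw [streamLaw, infinitePi_eq_map_consStream]
  have hc := measurable_consStream (α := ℝ × Option ι)
  rw [lintegral_map hF hc, lintegral_prod (fun p => F (consStream p)) (hF.comp hc).aemeasurable,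
    unitLaw, lintegral_prod]
  · simp only [lintegral_markLaw]
    rfl
  · exact (Measurable.lintegral_prod_right' (f := fun p => F (consStream p))
      (hF.comp hc)).aemeasurable

end OpenNetworkData

/-- Reduce the first requirement of a stream by `a`. -/
def reduceHead {β : Type*} (a : ℝ) (f : ℕ → ℝ × β) : ℕ → ℝ × β :=
  fun m => ((f m).1 - if m = 0 then a else 0, (f m).2)

lemma measurable_reduceHead {β γ : Type*} [MeasurableSpace β] [MeasurableSpace γ] {a : γ → ℝ}
    {f : γ → ℕ → ℝ × β} (ha : Measurable a) (hf : Measurable f) :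
    Measurable (fun x => reduceHead (a x) (f x)) := by
  refine measurable_pi_lambda _ fun m => ?_
  have := measurable_pi_iff.1 hf m
  refine Measurable.prodMk (this.fst.sub ?_) this.snd
  split_ifs
  exacts [ha, measurable_const]

namespace OpenNetworkData

variable {ι : Type*} [Fintype ι] (𝒥 : OpenNetworkData ι)

/-- Only the head is altered by the reduction. Given that it exceeds `a`, its excess is again
exponential and independent of the rest, so a channel that is still waiting has a fresh stream. -/
lemma streamLaw_memoryless (c : ι ⊕ ι) {a : ℝ} (ha : 0 ≤ a) {B : Set (ℕ → ℝ × Option ι)}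
    (hB : MeasurableSet B) :
    𝒥.streamLaw c {f | a < (f 0).1 ∧ reduceHead a f ∈ B} =
      ENNReal.ofReal (Real.exp (-a)) * 𝒥.streamLaw c B := by
  classical
  have h1 : Measurable (fun f : ℕ → ℝ × Option ι => (f 0).1) := (measurable_pi_apply 0).fst
  have h2 : Measurable (reduceHead (β := Option ι) a) :=
    measurable_reduceHead measurable_const measurable_id
  have hm : MeasurableSet {f : ℕ → ℝ × Option ι | a < (f 0).1 ∧ reduceHead a f ∈ B} :=
    (measurableSet_lt measurable_const h1).inter (h2 hB)
  have hF : Measurable (B.indicator (1 : (ℕ → ℝ × Option ι) → ℝ≥0∞)) :=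
    measurable_one.indicator hB
  rw [← lintegral_indicator_one hm, ← lintegral_indicator_one hB,
    lintegral_streamLaw _ _ (measurable_one.indicator hm), lintegral_streamLaw _ _ hF,
    ← lintegral_expMeasure_one_sub ha]
  · refine lintegral_congr fun g => ?_
    have hred : ∀ m f, reduceHead a (consStream ((g, m), f)) =
        consStream (((g - a, m), f) : (ℝ × Option ι) × (ℕ → ℝ × Option ι)) := by
      intro m f
      funext n
      cases n <;> simp [reduceHead]
    by_cases hg : a < g
    · rw [Set.indicator_of_mem (Set.mem_Ioi.2 hg)]
      refine Finset.sum_congr rfl fun m _ => congrArg _ (lintegral_congr fun f => ?_)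
      simp only [Set.indicator_apply, Set.mem_ofPred_eq, consStream_zero, hred, hg, true_and,
        Pi.one_apply]
    · rw [Set.indicator_of_notMem (by simpa using hg)]
      refine Finset.sum_eq_zero fun m _ => ?_
      simp only [Set.indicator_apply, Set.mem_ofPred_eq, consStream_zero, hg, false_and, if_false,
        lintegral_zero, mul_zero]
  · refine Finset.measurable_sum _ fun m _ => Measurable.const_mul ?_ _
    refine Measurable.lintegral_prod_right'
      (f := fun p : ℝ × (ℕ → ℝ × Option ι) => B.indicator 1 (consStream ((p.1, m), p.2))) ?_
    exact hF.comp (measurable_consStream.comp (by fun_prop))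

lemma streamLaw_head_gt (c : ι ⊕ ι) {a : ℝ} (ha : 0 ≤ a) :
    𝒥.streamLaw c {f | a < (f 0).1} = ENNReal.ofReal (Real.exp (-a)) := by
  simpa using 𝒥.streamLaw_memoryless c ha MeasurableSet.univ

open Classical in
-- Resampling one factor of a product law does not change it. The stream of the winning channel can
-- thus be held fixed while the others are integrated out.
lemma sourceLaw_eq_map_update (c : ι ⊕ ι) :
    𝒥.sourceLaw = ((𝒥.streamLaw c).prod 𝒥.sourceLaw).map
      (fun p => Function.update p.2 c p.1) := by
  have hm : Measurable (fun p : (ℕ → ℝ × Option ι) × (ι ⊕ ι → ℕ → ℝ × Option ι) =>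
      Function.update p.2 c p.1) := by
    refine measurable_pi_lambda _ fun c' => ?_
    by_cases h : c' = c
    · subst h; simpa using measurable_fst
    · simp only [Function.update_of_ne h]; fun_prop
  refine Measure.pi_eq fun B hB => ?_
  rw [Measure.map_apply hm (MeasurableSet.univ_pi hB)]
  have : (fun p : (ℕ → ℝ × Option ι) × (ι ⊕ ι → ℕ → ℝ × Option ι) =>
      Function.update p.2 c p.1) ⁻¹' (Set.univ.pi B) =
      B c ×ˢ Set.univ.pi (Function.update B c Set.univ) := by
    ext p
    simp only [Set.mem_preimage, Set.mem_univ_pi, Set.mem_prod]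
    constructor
    · intro h
      refine ⟨by simpa using h c, fun c' => ?_⟩
      by_cases hc : c' = c
      · subst hc; simp
      · simpa [hc] using h c'
    · rintro ⟨h0, h⟩ c'
      by_cases hc : c' = c
      · subst hc; simpa using h0
      · simpa [hc] using h c'
  rw [this, Measure.prod_prod, sourceLaw, Measure.pi_pi,
    ← Finset.mul_prod_erase Finset.univ _ (Finset.mem_univ c),
    ← Finset.mul_prod_erase Finset.univ (fun i => 𝒥.streamLaw i (B i)) (Finset.mem_univ c)]
  simp only [Function.update_self, measure_univ, one_mul]
  congr 1
  refine Finset.prod_congr rfl fun i hi => ?_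
  rw [Function.update_of_ne (Finset.ne_of_mem_erase hi)]

end OpenNetworkData

/-! ### The construction of the network event by event -/

/-- The queue lengths, with counters of the departures from each node in each time window. -/
abbrev Config (ι I : Type*) := (ι → ℕ) × (ι → I → ℕ)

/-- For each channel, the requirements and marks of its events. -/
abbrev Sources (ι : Type*) := ι ⊕ ι → ℕ → ℝ × Option ι

open Classical in
/-- The queue lengths after an event of channel `c` with mark `m`. -/
noncomputable def moveCustomer {ι : Type*} (c : ι ⊕ ι) (m : Option ι) (x : ι → ℕ) : ι → ℕ :=
  fun j => x j + (if c = .inl j ∨ (∃ k, c = .inr k) ∧ m = some j then 1 else 0) -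
    (if c = .inr j then 1 else 0)

open Classical in
/-- The effect of an event of channel `c` with mark `m` that falls into the time window `o`. -/
noncomputable def jump {ι I : Type*} (c : ι ⊕ ι) (m : Option ι) (o : Option I)
    (y : Config ι I) : Config ι I :=
  (moveCustomer c m y.1,
    fun k i => y.2 k i + if c = .inr k ∧ m = none ∧ o = some i then 1 else 0)

namespace OpenNetworkData

variable {ι : Type*} [Fintype ι] (𝒥 : OpenNetworkData ι)

/-- The time that channel `c` needs for its first event in state `x`. -/
noncomputable def waiting (x : ι → ℕ) (e : Sources ι) (c : ι ⊕ ι) : ℝ :=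
  (e c 0).1 / 𝒥.rate c x

/-- In state `x`, the first event is one of channel `c`. -/
def Wins (x : ι → ℕ) (e : Sources ι) (c : ι ⊕ ι) : Prop :=
  0 < 𝒥.rate c x ∧ 0 < (e c 0).1 ∧
    ∀ c', c' ≠ c → 𝒥.rate c' x * 𝒥.waiting x e c < (e c' 0).1

open Classical in
/-- The remaining sources after channel `c` had its first event, at time `s`. -/
noncomputable def shiftSources (x : ι → ℕ) (c : ι ⊕ ι) (s : ℝ) (e : Sources ι) : Sources ι :=
  fun c' => if c' = c then fun m => e c (m + 1) else reduceHead (𝒥.rate c' x * s) (e c')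

variable {I : Type*} (cls : ℝ → Option I)

/-- The configuration, time and remaining sources after the first event of channel `c`. -/
noncomputable def eventState (c : ι ⊕ ι) (z : (Config ι I × ℝ) × Sources ι) :
    (Config ι I × ℝ) × Sources ι :=
  ((jump c (z.2 c 0).2 (cls (z.1.2 + 𝒥.waiting z.1.1.1 z.2 c)) z.1.1,
      z.1.2 + 𝒥.waiting z.1.1.1 z.2 c),
    𝒥.shiftSources z.1.1.1 c (𝒥.waiting z.1.1.1 z.2 c) z.2)

open Classical in
/-- The configuration, time and remaining sources after the first event. -/
noncomputable def step (z : (Config ι I × ℝ) × Sources ι) : (Config ι I × ℝ) × Sources ι :=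
  if h : ∃ c, 𝒥.Wins z.1.1.1 z.2 c then 𝒥.eventState cls h.choose z
  else (z.1, fun _ _ => (0, none))

variable {𝒥} in
-- The strict inequalities exclude ties. The comparison is stated without dividing by the rate of
-- the competitor, so idle channels do no harm; here both rates are positive and the division is
-- legitimate.
lemma Wins.unique {x : ι → ℕ} {e : Sources ι} {c c' : ι ⊕ ι} (h : 𝒥.Wins x e c)
    (h' : 𝒥.Wins x e c') : c = c' := by
  by_contra hne
  have h1 := h.2.2 c' (Ne.symm hne)
  have h2 := h'.2.2 c hne
  have p1 : (0 : ℝ) < 𝒥.rate c x := h.1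
  have p2 : (0 : ℝ) < 𝒥.rate c' x := h'.1
  have h3 : 𝒥.waiting x e c < 𝒥.waiting x e c' := by
    rw [waiting, waiting, lt_div_iff₀ p2, mul_comm]; exact h1
  have h4 : 𝒥.waiting x e c' < 𝒥.waiting x e c := by
    rw [waiting, waiting, lt_div_iff₀ p1, mul_comm]; exact h2
  exact lt_asymm h3 h4

variable {𝒥} in
lemma Wins.waiting_pos {x : ι → ℕ} {e : Sources ι} {c : ι ⊕ ι} (h : 𝒥.Wins x e c) :
    0 < 𝒥.waiting x e c := div_pos h.2.1 h.1

variable {cls} {𝒥} in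
lemma step_of_wins {z : (Config ι I × ℝ) × Sources ι} {c : ι ⊕ ι}
    (h : 𝒥.Wins z.1.1.1 z.2 c) : 𝒥.step cls z = 𝒥.eventState cls c z := by
  have hex : ∃ c, 𝒥.Wins z.1.1.1 z.2 c := ⟨c, h⟩
  rw [step, dif_pos hex, hex.choose_spec.unique h]

variable {cls} {𝒥} in
-- The null sources make this default absorbing: a channel with head `0` cannot win, and such
-- sources never satisfy `NoEvent` for a nonnegative duration. Nothing is recorded after it.
lemma step_of_not_wins {z : (Config ι I × ℝ) × Sources ι}
    (h : ¬ ∃ c, 𝒥.Wins z.1.1.1 z.2 c) : 𝒥.step cls z = (z.1, fun _ _ => (0, none)) := by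
  rw [step, dif_neg h]

lemma measurable_waiting (c : ι ⊕ ι) :
    Measurable (fun p : (ι → ℕ) × Sources ι => 𝒥.waiting p.1 p.2 c) := by
  unfold waiting
  have h1 : Measurable (fun x : ι → ℕ => (𝒥.rate c x : ℝ)) := measurable_of_countable _
  exact Measurable.div (by fun_prop) (h1.comp measurable_fst)

lemma measurableSet_wins (c : ι ⊕ ι) :
    MeasurableSet {p : (ι → ℕ) × Sources ι | 𝒥.Wins p.1 p.2 c} := by
  have h1 : ∀ c, Measurable (fun p : (ι → ℕ) × Sources ι => (𝒥.rate c p.1 : ℝ)) := fun c =>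
    (measurable_of_countable (fun x : ι → ℕ => (𝒥.rate c x : ℝ))).comp measurable_fst
  have h2 : ∀ c, Measurable (fun p : (ι → ℕ) × Sources ι => (p.2 c 0).1) := fun c => by fun_prop
  have h3 := 𝒥.measurable_waiting c
  have : {p : (ι → ℕ) × Sources ι | 𝒥.Wins p.1 p.2 c} =
      {p | (0 : ℝ) < 𝒥.rate c p.1} ∩ ({p | 0 < (p.2 c 0).1} ∩
        ⋂ (c') (_ : c' ≠ c), {p | 𝒥.rate c' p.1 * 𝒥.waiting p.1 p.2 c < (p.2 c' 0).1}) := by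
    ext p
    simp [Wins]
  rw [this]
  exact (measurableSet_lt measurable_const (h1 c)).inter
    ((measurableSet_lt measurable_const (h2 c)).inter
      (MeasurableSet.iInter fun c' => MeasurableSet.iInter fun _ =>
        measurableSet_lt ((h1 c').mul h3) (h2 c')))

lemma measurable_shiftSources (c : ι ⊕ ι) :
    Measurable (fun p : ((ι → ℕ) × ℝ) × Sources ι => 𝒥.shiftSources p.1.1 c p.1.2 p.2) := by
  refine measurable_pi_lambda _ fun c' => ?_
  unfold shiftSources
  by_cases h : c' = c
  · simp only [h, if_true]; fun_prop
  · simp only [h, if_false]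
    refine measurable_reduceHead (Measurable.mul ?_ (by fun_prop)) (by fun_prop)
    exact (measurable_of_countable (fun x : ι → ℕ => (𝒥.rate c' x : ℝ))).comp
      (measurable_fst.comp measurable_fst)

variable {cls} [Finite I]

lemma measurable_jump (hcls : Measurable cls) (c : ι ⊕ ι) :
    Measurable (fun p : (Option ι × ℝ) × Config ι I => jump c p.1.1 (cls p.1.2) p.2) :=
  (measurable_of_countable
    (fun p : (Option ι × Option I) × Config ι I => jump c p.1.1 p.1.2 p.2)).comp
    (((measurable_fst.comp measurable_fst).prodMk
      (hcls.comp (measurable_snd.comp measurable_fst))).prodMk measurable_snd)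

lemma measurable_eventState (hcls : Measurable cls) (c : ι ⊕ ι) :
    Measurable (𝒥.eventState cls c) := by
  have h1 : Measurable (fun z : (Config ι I × ℝ) × Sources ι => 𝒥.waiting z.1.1.1 z.2 c) :=
    (𝒥.measurable_waiting c).comp (by fun_prop : Measurable
      (fun z : (Config ι I × ℝ) × Sources ι => (z.1.1.1, z.2)))
  have h2 : Measurable (fun z : (Config ι I × ℝ) × Sources ι =>
      z.1.2 + 𝒥.waiting z.1.1.1 z.2 c) := Measurable.add (by fun_prop) h1
  refine Measurable.prodMk (Measurable.prodMk ?_ h2) ?_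
  · exact (measurable_jump hcls c).comp
      ((Measurable.prodMk (by fun_prop) h2).prodMk (by fun_prop : Measurable
        (fun z : (Config ι I × ℝ) × Sources ι => z.1.1)))
  · exact (𝒥.measurable_shiftSources c).comp
      ((Measurable.prodMk (by fun_prop) h1).prodMk measurable_snd)

lemma measurable_step (hcls : Measurable cls) : Measurable (𝒥.step cls) := by
  classical
  have hW : ∀ c, MeasurableSet {z : (Config ι I × ℝ) × Sources ι | 𝒥.Wins z.1.1.1 z.2 c} :=
    fun c => (𝒥.measurableSet_wins c).preimage (by fun_prop : Measurable
      (fun z : (Config ι I × ℝ) × Sources ι => (z.1.1.1, z.2)))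
  intro S hS
  have : 𝒥.step cls ⁻¹' S =
      (⋃ c, {z | 𝒥.Wins z.1.1.1 z.2 c} ∩ 𝒥.eventState cls c ⁻¹' S) ∪
      ((⋂ c, {z | 𝒥.Wins z.1.1.1 z.2 c}ᶜ) ∩
        (fun z : (Config ι I × ℝ) × Sources ι => (z.1, fun _ _ => (0, none))) ⁻¹' S) := by
    ext z
    simp only [Set.mem_preimage, Set.mem_union, Set.mem_iUnion, Set.mem_inter_iff,
      Set.mem_iInter, Set.mem_compl_iff, Set.mem_ofPred_eq]
    by_cases h : ∃ c, 𝒥.Wins z.1.1.1 z.2 c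
    · obtain ⟨c, hc⟩ := h
      rw [step_of_wins hc]
      constructor
      · exact fun hz => Or.inl ⟨c, hc, hz⟩
      · rintro (⟨c', hc', hz⟩ | ⟨hn, _⟩)
        · rwa [hc.unique hc']
        · exact absurd hc (hn c)
    · rw [step_of_not_wins h]
      push Not at h
      constructor
      · exact fun hz => Or.inr ⟨h, hz⟩
      · rintro (⟨c', hc', hz⟩ | ⟨_, hz⟩)
        · exact absurd hc' (h c')
        · exact hz
  rw [this]
  refine MeasurableSet.union (MeasurableSet.iUnion fun c =>
    (hW c).inter (𝒥.measurable_eventState hcls c hS)) ?_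
  exact (MeasurableSet.iInter fun c => (hW c).compl).inter
    (hS.preimage (by fun_prop))

end OpenNetworkData

lemma measurable_jump_time {ι I : Type*} [Finite I] {cls : ℝ → Option I} (hcls : Measurable cls)
    (c : ι ⊕ ι) (m : Option ι) (y : Config ι I)
    (T : ℝ) : Measurable (fun s => (jump c m (cls (T + s)) y, T + s)) := by
  refine Measurable.prodMk ?_ (by fun_prop)
  exact (measurable_of_countable (fun o => jump c m o y)).comp (hcls.comp (by fun_prop))

/-! ### The law of the first event, and regeneration after it -/

namespace OpenNetworkData

variable {ι : Type*} [Fintype ι] (𝒥 : OpenNetworkData ι) {I : Type*} [Finite I]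
  {cls : ℝ → Option I}

/-- The expectation of `F` at the configuration and time of the next event, for a network which is
in configuration `a.1` at time `a.2`. -/
noncomputable def nextEvent (cls : ℝ → Option I) (F : Config ι I × ℝ → ℝ≥0∞)
    (a : Config ι I × ℝ) : ℝ≥0∞ :=
  ∑ c, ∑ m, ∫⁻ s in Set.Ioi 0, (𝒥.rate c a.1.1 : ℝ≥0∞) * 𝒥.weight c m *
    ENNReal.ofReal (Real.exp (-(𝒥.totalRate a.1.1 * s))) *
      F (jump c m (cls (a.2 + s)) a.1, a.2 + s)

open Classical in
-- With the stream of the winner fixed, its waiting time `s` is a constant, and the event becomes a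
-- box in the other streams. Each of these must outlast `s`, at the cost of a factor `exp (-rate *
-- s)`, and then is fresh by `streamLaw_memoryless`.
lemma lintegral_wins_update {c : ι ⊕ ι} {x : ι → ℕ} (hc : 0 < 𝒥.rate c x)
    (f : ℕ → ℝ × Option ι) {B : ι ⊕ ι → Set (ℕ → ℝ × Option ι)}
    (hB : ∀ c, MeasurableSet (B c)) :
    𝒥.sourceLaw {e | 𝒥.Wins x (Function.update e c f) c ∧
      𝒥.shiftSources x c ((f 0).1 / 𝒥.rate c x) (Function.update e c f) ∈ Set.univ.pi B} =
    (Set.Ioi 0).indicator (fun s : ℝ => ∏ c' ∈ Finset.univ.erase c,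
        ENNReal.ofReal (Real.exp (-(𝒥.rate c' x * s)))) ((f 0).1 / 𝒥.rate c x) *
      (B c).indicator 1 (fun m => f (m + 1)) *
      ∏ c' ∈ Finset.univ.erase c, 𝒥.streamLaw c' (B c') := by
  have hc' : (0 : ℝ) < 𝒥.rate c x := hc
  set s := (f 0).1 / 𝒥.rate c x with hs
  have hw : ∀ e, 𝒥.waiting x (Function.update e c f) c = s := by
    intro e; simp [waiting, hs]
  by_cases h0 : 0 < (f 0).1
  · by_cases ht : (fun m => f (m + 1)) ∈ B c
    · have hs0 : 0 < s := div_pos h0 hc'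
      have hset : {e | 𝒥.Wins x (Function.update e c f) c ∧
          𝒥.shiftSources x c s (Function.update e c f) ∈ Set.univ.pi B} =
          Set.univ.pi (fun c' => if c' = c then Set.univ else
            {h | 𝒥.rate c' x * s < (h 0).1 ∧ reduceHead (𝒥.rate c' x * s) h ∈ B c'}) := by
        ext e
        simp only [Set.mem_ofPred_eq, Set.mem_univ_pi, Wins, hw, Function.update_self]
        constructor
        · rintro ⟨⟨-, -, h1⟩, h2⟩ c'
          by_cases h : c' = c
          · simp [h]
          · have h3 := h1 c' h
            have h4 := h2 c'
            simp only [shiftSources, h, if_false, Function.update_of_ne h] at h3 h4 ⊢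
            exact ⟨h3, h4⟩
        · intro h1
          refine ⟨⟨hc, h0, fun c' h => ?_⟩, fun c' => ?_⟩
          · have h2 := h1 c'
            simp only [h, if_false] at h2
            rw [Function.update_of_ne h]
            exact h2.1
          · have h2 := h1 c'
            by_cases h : c' = c
            · subst h
              simpa [shiftSources] using ht
            · simp only [shiftSources, h, if_false, Function.update_of_ne h] at h2 ⊢
              exact h2.2
      rw [hset, sourceLaw, Measure.pi_pi,
        ← Finset.mul_prod_erase Finset.univ _ (Finset.mem_univ c), if_pos rfl, measure_univ,
        one_mul, Set.indicator_of_mem (Set.mem_Ioi.2 hs0), Set.indicator_of_mem ht, Pi.one_apply,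
        mul_one, ← Finset.prod_mul_distrib]
      refine Finset.prod_congr rfl fun c' h => ?_
      rw [if_neg (Finset.ne_of_mem_erase h),
        𝒥.streamLaw_memoryless c' (by positivity) (hB c')]
    · rw [Set.indicator_of_notMem ht, mul_zero, zero_mul]
      refine measure_mono_null ?_ measure_empty
      rintro e ⟨-, h⟩
      have := h c (Set.mem_univ c)
      exact (ht (by simpa [shiftSources] using this)).elim
  · have hs0 : ¬ 0 < s := fun h => h0 (by
      have := mul_pos h hc'
      rwa [hs, div_mul_cancel₀ _ hc'.ne'] at this)
    rw [Set.indicator_of_notMem (by simpa using hs0), zero_mul, zero_mul]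
    refine measure_mono_null ?_ measure_empty
    rintro e ⟨h, -⟩
    exact (h0 (by simpa using h.2.1)).elim

open Classical in
-- The competition of exponential clocks: the winner, its mark and its time are decoupled from the
-- remaining sources. The box `B` tests the latter, so that the factor `𝒥.sourceLaw (Set.univ.pi B)`
-- expresses their freshness.
lemma lintegral_wins (hcls : Measurable cls) (c : ι ⊕ ι) (y : Config ι I) (T : ℝ)
    {F : Config ι I × ℝ → ℝ≥0∞} (hF : Measurable F) {B : ι ⊕ ι → Set (ℕ → ℝ × Option ι)}
    (hB : ∀ c, MeasurableSet (B c)) :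
    ∫⁻ e, {e | 𝒥.Wins y.1 e c}.indicator (fun e => F (𝒥.eventState cls c ((y, T), e)).1 *
        (Set.univ.pi B).indicator 1 (𝒥.eventState cls c ((y, T), e)).2) e ∂𝒥.sourceLaw =
      (∑ m, ∫⁻ s in Set.Ioi 0, (𝒥.rate c y.1 : ℝ≥0∞) * 𝒥.weight c m *
        ENNReal.ofReal (Real.exp (-(𝒥.totalRate y.1 * s))) *
          F (jump c m (cls (T + s)) y, T + s)) * 𝒥.sourceLaw (Set.univ.pi B) := by
  rcases eq_or_ne (𝒥.rate c y.1) 0 with h0 | h0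
  · have : {e | 𝒥.Wins y.1 e c} = ∅ := by
      ext e
      simp [Wins, h0]
    simp [this, h0]
  have hc : 0 < 𝒥.rate c y.1 := pos_iff_ne_zero.2 h0
  have hc' : (0 : ℝ) < 𝒥.rate c y.1 := hc
  have hW : MeasurableSet {e | 𝒥.Wins y.1 e c} := (𝒥.measurableSet_wins c).preimage
    (by fun_prop : Measurable (fun e : Sources ι => (y.1, e)))
  have hev : Measurable (fun e : Sources ι => 𝒥.eventState cls c ((y, T), e)) :=
    (𝒥.measurable_eventState hcls c).comp (by fun_prop)
  have hpi : MeasurableSet (Set.univ.pi B) := MeasurableSet.univ_pi hB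
  have hone : Measurable ((Set.univ.pi B).indicator (1 : Sources ι → ℝ≥0∞)) :=
    measurable_one.indicator hpi
  have hG : Measurable ({e | 𝒥.Wins y.1 e c}.indicator
      (fun e => F (𝒥.eventState cls c ((y, T), e)).1 *
        (Set.univ.pi B).indicator 1 (𝒥.eventState cls c ((y, T), e)).2)) :=
    ((hF.comp (measurable_fst.comp hev)).mul (hone.comp (measurable_snd.comp hev))).indicator hW
  have hupd : Measurable (fun p : (ℕ → ℝ × Option ι) × Sources ι =>
      Function.update p.2 c p.1) := by
    refine measurable_pi_lambda _ fun c' => ?_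
    by_cases h : c' = c
    · subst h; simpa using measurable_fst
    · simp only [Function.update_of_ne h]; fun_prop
  conv_lhs => rw [𝒥.sourceLaw_eq_map_update c]
  have hcomp := hG.comp hupd
  rw [Function.comp_def] at hcomp
  rw [lintegral_map hG hupd, lintegral_prod _ hcomp.aemeasurable]
  -- The value of `F` after an event at time `s`, weighted by the probability that all other
  -- channels are still waiting at `s`.
  let Φ : Option ι → ℝ → ℝ≥0∞ := fun m s => F (jump c m (cls (T + s)) y, T + s) *
    (Set.Ioi 0).indicator (fun s : ℝ => ∏ c' ∈ Finset.univ.erase c,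
        ENNReal.ofReal (Real.exp (-(𝒥.rate c' y.1 * s)))) s
  have hΦ : ∀ m, Measurable (Φ m) := fun m =>
    (hF.comp (measurable_jump_time hcls c m y T)).mul
      (Measurable.indicator (by fun_prop) measurableSet_Ioi)
  have htail : Measurable (fun (f : ℕ → ℝ × Option ι) (m : ℕ) => f (m + 1)) := by fun_prop
  have hinner : ∀ f : ℕ → ℝ × Option ι,
      ∫⁻ e, ({e | 𝒥.Wins y.1 e c}.indicator
        (fun e => F (𝒥.eventState cls c ((y, T), e)).1 *
          (Set.univ.pi B).indicator 1 (𝒥.eventState cls c ((y, T), e)).2))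
            (Function.update e c f) ∂𝒥.sourceLaw =
      Φ (f 0).2 ((f 0).1 / 𝒥.rate c y.1) * (B c).indicator 1 (fun m => f (m + 1)) *
        ∏ c' ∈ Finset.univ.erase c, 𝒥.streamLaw c' (B c') := by
    intro f
    set s := (f 0).1 / 𝒥.rate c y.1 with hs
    have hset : MeasurableSet {e | 𝒥.Wins y.1 (Function.update e c f) c ∧
        𝒥.shiftSources y.1 c s (Function.update e c f) ∈ Set.univ.pi B} := by
      have h1 : Measurable (fun e : Sources ι => Function.update e c f) :=
        hupd.comp (by fun_prop : Measurable (fun e : Sources ι => (f, e)))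
      exact (hW.preimage h1).inter (hpi.preimage ((𝒥.measurable_shiftSources c).comp
        (by fun_prop : Measurable (fun e : Sources ι => ((y.1, s), e)) ) |>.comp h1))
    have heq : ∀ e : Sources ι, ({e | 𝒥.Wins y.1 e c}.indicator
        (fun e => F (𝒥.eventState cls c ((y, T), e)).1 *
          (Set.univ.pi B).indicator 1 (𝒥.eventState cls c ((y, T), e)).2))
            (Function.update e c f) = F (jump c (f 0).2 (cls (T + s)) y, T + s) *
        {e | 𝒥.Wins y.1 (Function.update e c f) c ∧
          𝒥.shiftSources y.1 c s (Function.update e c f) ∈ Set.univ.pi B}.indicator 1 e := by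
      intro e
      have hw : 𝒥.waiting y.1 (Function.update e c f) c = s := by simp [waiting, hs]
      simp only [Set.indicator_apply, eventState, hw, Function.update_self, Set.mem_ofPred_eq,
        Pi.one_apply, ite_and]
      split_ifs <;> simp
    simp only [heq]
    rw [lintegral_const_mul _ (measurable_one.indicator hset), lintegral_indicator_one hset,
      𝒥.lintegral_wins_update hc f hB]
    simp only [Φ, hs]
    ring
  simp only [hinner]
  rw [lintegral_streamLaw]
  · simp only [consStream_zero, consStream_succ]
    have hin : ∀ g m, ∫⁻ f : ℕ → ℝ × Option ι, Φ m (g / 𝒥.rate c y.1) *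
        (B c).indicator 1 (fun m => f m) *
        ∏ c' ∈ Finset.univ.erase c, 𝒥.streamLaw c' (B c') ∂𝒥.streamLaw c =
        Φ m (g / 𝒥.rate c y.1) * 𝒥.sourceLaw (Set.univ.pi B) := by
      intro g m
      have hmB : Measurable ((B c).indicator (1 : (ℕ → ℝ × Option ι) → ℝ≥0∞)) :=
        measurable_one.indicator (hB c)
      rw [lintegral_mul_const _ (hmB.const_mul _), lintegral_const_mul _ hmB,
        lintegral_indicator_one (hB c), sourceLaw, Measure.pi_pi, mul_assoc,
        Finset.mul_prod_erase Finset.univ (fun c' => 𝒥.streamLaw c' (B c')) (Finset.mem_univ c)]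
    simp only [hin, ← mul_assoc, ← Finset.sum_mul]
    rw [lintegral_mul_const _ (by
      refine Finset.measurable_sum _ fun m _ => ?_
      exact ((hΦ m).comp (measurable_id.div_const _)).const_mul _)]
    congr 1
    rw [lintegral_expMeasure_one_scale hc' (F := fun s => ∑ m, (𝒥.weight c m : ℝ≥0∞) * Φ m s)
      (Finset.measurable_sum _ fun m _ => (hΦ m).const_mul _), ← lintegral_finsetSum]
    · refine setLIntegral_congr_fun measurableSet_Ioi fun s hs => ?_
      simp only [Finset.mul_sum]
      refine Finset.sum_congr rfl fun m _ => ?_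
      -- The winner contributes the exponential of its own density and the others their survival
      -- probabilities; the exponents add up to the total rate.
      have hexp : ENNReal.ofReal (Real.exp (-(𝒥.rate c y.1 * s))) *
          ∏ c' ∈ Finset.univ.erase c, ENNReal.ofReal (Real.exp (-(𝒥.rate c' y.1 * s))) =
          ENNReal.ofReal (Real.exp (-(𝒥.totalRate y.1 * s))) := by
        rw [Finset.mul_prod_erase Finset.univ
          (fun c' => ENNReal.ofReal (Real.exp (-(𝒥.rate c' y.1 * s)))) (Finset.mem_univ c),
          ← ENNReal.ofReal_prod_of_nonneg (fun _ _ => (Real.exp_pos _).le), ← Real.exp_sum]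
        simp only [totalRate, NNReal.coe_sum, Finset.sum_mul, Finset.sum_neg_distrib]
      simp only [Φ]
      rw [Set.indicator_of_mem hs, ← hexp, ENNReal.ofReal_mul hc'.le, ENNReal.ofReal_coe_nnreal]
      ring
    · intro m _
      exact Measurable.mul (by fun_prop) (hF.comp (measurable_jump_time hcls c m y T))
  · have h1 : Measurable (fun f : ℕ → ℝ × Option ι =>
        Φ (f 0).2 ((f 0).1 / 𝒥.rate c y.1)) := by
      have : Measurable (fun p : Option ι × ℝ => Φ p.1 p.2) :=
        measurable_from_prod_countable_right fun m => hΦ m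
      exact this.comp (by fun_prop : Measurable (fun f : ℕ → ℝ × Option ι =>
        ((f 0).2, (f 0).1 / (𝒥.rate c y.1 : ℝ))))
    have hmB : Measurable ((B c).indicator (1 : (ℕ → ℝ × Option ι) → ℝ≥0∞)) :=
      measurable_one.indicator (hB c)
    exact (h1.mul (hmB.comp htail)).mul_const _

end OpenNetworkData

namespace OpenNetworkData

variable {ι : Type*} [Fintype ι] (𝒥 : OpenNetworkData ι) {I : Type*} [Finite I]
  {cls : ℝ → Option I}

omit [Finite I] in
-- The marks have total weight one and the total rate is positive, so the waiting time for the next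
-- event is a proper exponential variable.
lemma nextEvent_one (a : Config ι I × ℝ) : 𝒥.nextEvent cls (fun _ => 1) a = 1 := by
  set q := 𝒥.totalRate a.1.1 with hq
  have hq0 : (0 : ℝ) < q := 𝒥.totalRate_pos _
  have h1 : ∫⁻ s in Set.Ioi (0 : ℝ), ENNReal.ofReal (Real.exp (-(q * s))) = (q : ℝ≥0∞)⁻¹ := by
    have h := lintegral_expMeasure_one_scale hq0 (F := fun _ => 1) measurable_const
    simp only [lintegral_one, measure_univ, mul_one, ENNReal.ofReal_mul hq0.le,
      ENNReal.ofReal_coe_nnreal] at h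
    rw [lintegral_const_mul _ (by fun_prop)] at h
    exact ENNReal.eq_inv_of_mul_eq_one_left (by rw [mul_comm]; exact h.symm)
  have hq1 : (q : ℝ≥0∞) ≠ 0 := by
    have : q ≠ 0 := (𝒥.totalRate_pos _).ne'
    exact_mod_cast this
  simp only [nextEvent, mul_one]
  have h2 : ∀ c m, ∫⁻ s in Set.Ioi (0 : ℝ), (𝒥.rate c a.1.1 : ℝ≥0∞) * 𝒥.weight c m *
      ENNReal.ofReal (Real.exp (-(q * s))) =
      (𝒥.rate c a.1.1 : ℝ≥0∞) * 𝒥.weight c m * (q : ℝ≥0∞)⁻¹ := by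
    intro c m
    rw [lintegral_const_mul _ (by fun_prop), h1]
  simp only [← hq, h2, ← Finset.sum_mul, ← Finset.mul_sum]
  have h3 : ∀ c, (∑ m, (𝒥.weight c m : ℝ≥0∞)) = 1 := fun c => by
    exact_mod_cast 𝒥.sum_weight c
  simp only [h3, mul_one]
  have h4 : (∑ c, (𝒥.rate c a.1.1 : ℝ≥0∞)) = q := by
    rw [hq, totalRate]; push_cast; rfl
  rw [h4, ENNReal.mul_inv_cancel hq1 ENNReal.coe_ne_top]

lemma measurableSet_wins_config (x : ι → ℕ) (c : ι ⊕ ι) : MeasurableSet {e | 𝒥.Wins x e c} :=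
  (𝒥.measurableSet_wins c).preimage (by fun_prop : Measurable (fun e : Sources ι => (x, e)))

/-- At most one channel wins, so the winning probabilities add up; their sum is the total mass
computed in `nextEvent_one`. Ties and nonpositive heads are null events. -/
lemma ae_exists_wins (x : ι → ℕ) : ∀ᵐ e ∂𝒥.sourceLaw, ∃ c, 𝒥.Wins x e c := by
  classical
  let cls : ℝ → Option Empty := fun _ => none
  let y : Config ι Empty := (x, fun _ _ => 0)
  have h1 : ∀ c, 𝒥.sourceLaw {e | 𝒥.Wins x e c} =
      ∑ m, ∫⁻ s in Set.Ioi 0, (𝒥.rate c x : ℝ≥0∞) * 𝒥.weight c m *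
        ENNReal.ofReal (Real.exp (-(𝒥.totalRate x * s))) := by
    intro c
    have h := 𝒥.lintegral_wins (cls := cls) measurable_const c y 0 (F := fun _ => 1)
      measurable_const (B := fun _ => Set.univ) (fun _ => MeasurableSet.univ)
    simp only [Set.pi_univ, Set.indicator_univ, Pi.one_apply, mul_one, measure_univ] at h
    rw [← h]
    exact (lintegral_indicator_one (𝒥.measurableSet_wins_config x c)).symm
  have h2 : 𝒥.sourceLaw (⋃ c, {e | 𝒥.Wins x e c}) = 1 := by
    rw [measure_iUnion (fun c c' hne => Set.disjoint_left.2 fun e h h' => hne (h.unique h'))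
      (fun c => 𝒥.measurableSet_wins_config x c), tsum_fintype]
    simp only [h1]
    have := 𝒥.nextEvent_one (cls := cls) (y, 0)
    simpa only [nextEvent, mul_one] using this
  have h3 := (prob_compl_eq_zero_iff (MeasurableSet.iUnion
    fun c => 𝒥.measurableSet_wins_config x c)).2 h2
  rw [ae_iff]
  convert h3 using 2
  ext e
  simp

lemma lintegral_step_pi (hcls : Measurable cls) (y : Config ι I) (T : ℝ)
    {F : Config ι I × ℝ → ℝ≥0∞} (hF : Measurable F) {B : ι ⊕ ι → Set (ℕ → ℝ × Option ι)}
    (hB : ∀ c, MeasurableSet (B c)) :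
    ∫⁻ e, F (𝒥.step cls ((y, T), e)).1 *
        (Set.univ.pi B).indicator 1 (𝒥.step cls ((y, T), e)).2 ∂𝒥.sourceLaw =
      𝒥.nextEvent cls F (y, T) * 𝒥.sourceLaw (Set.univ.pi B) := by
  classical
  simp only [nextEvent, Finset.sum_mul (s := (Finset.univ : Finset (ι ⊕ ι))),
    ← 𝒥.lintegral_wins hcls _ y T hF hB]
  rw [← lintegral_finsetSum]
  · refine lintegral_congr_ae ?_
    filter_upwards [𝒥.ae_exists_wins y.1] with e he
    obtain ⟨c, hc⟩ := he
    have hs : 𝒥.step cls ((y, T), e) = 𝒥.eventState cls c ((y, T), e) := step_of_wins hc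
    rw [Finset.sum_eq_single c]
    · rw [Set.indicator_of_mem (show e ∈ {e | 𝒥.Wins y.1 e c} from hc), hs]
    · intro c' _ hne
      rw [Set.indicator_of_notMem]
      intro h
      exact hne (Wins.unique h hc)
    · simp
  · intro c _
    have hev : Measurable (fun e : Sources ι => 𝒥.eventState cls c ((y, T), e)) :=
      (𝒥.measurable_eventState hcls c).comp (by fun_prop)
    have hone : Measurable ((Set.univ.pi B).indicator (1 : Sources ι → ℝ≥0∞)) :=
      measurable_one.indicator (MeasurableSet.univ_pi hB)
    exact ((hF.comp (measurable_fst.comp hev)).mul (hone.comp (measurable_snd.comp hev))).indicator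
      (𝒥.measurableSet_wins_config y.1 c)

lemma lintegral_step_fst (hcls : Measurable cls) (a : Config ι I × ℝ)
    {F : Config ι I × ℝ → ℝ≥0∞} (hF : Measurable F) :
    ∫⁻ e, F (𝒥.step cls (a, e)).1 ∂𝒥.sourceLaw = 𝒥.nextEvent cls F a := by
  have := 𝒥.lintegral_step_pi hcls a.1 a.2 hF (B := fun _ => Set.univ)
    (fun _ => MeasurableSet.univ)
  simpa using this

lemma measurable_step_sources (hcls : Measurable cls) (a : Config ι I × ℝ) :
    Measurable (fun e => 𝒥.step cls (a, e)) :=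
  (𝒥.measurable_step hcls).comp (by fun_prop)

/-- After the first event, the remaining sources are distributed as at the beginning, independently
of the configuration and the time. -/
lemma map_step_eq_prod (hcls : Measurable cls) (a : Config ι I × ℝ) :
    𝒥.sourceLaw.map (fun e => 𝒥.step cls (a, e)) =
      (𝒥.sourceLaw.map (fun e => (𝒥.step cls (a, e)).1)).prod 𝒥.sourceLaw := by
  have hm := 𝒥.measurable_step_sources hcls a
  have hm1 : Measurable (fun e => (𝒥.step cls (a, e)).1) := measurable_fst.comp hm
  refine (Measure.prod_eq fun A t hA ht => ?_).symm
  set ν := 𝒥.sourceLaw.map (fun e => 𝒥.step cls (a, e)) with hν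
  have : IsProbabilityMeasure ν := Measure.isProbabilityMeasure_map hm.aemeasurable
  set κA := 𝒥.sourceLaw.map (fun e => (𝒥.step cls (a, e)).1) A with hκ
  have hκ' : κA = 𝒥.nextEvent cls (A.indicator 1) a := by
    rw [hκ, Measure.map_apply hm1 hA, ← 𝒥.lintegral_step_fst hcls a (measurable_one.indicator hA),
      ← lintegral_indicator_one (hm1 hA)]
    rfl
  have hle : κA ≤ 1 := by
    have : IsProbabilityMeasure (𝒥.sourceLaw.map (fun e => (𝒥.step cls (a, e)).1)) :=
      Measure.isProbabilityMeasure_map hm1.aemeasurable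
    exact prob_le_one
  -- For fixed `A`, both sides are finite measures in the remaining sources, so it is enough to
  -- compare them on boxes, which form a generating π-system.
  have hbox : ∀ B : ι ⊕ ι → Set (ℕ → ℝ × Option ι), (∀ c, MeasurableSet (B c)) →
      (ν.restrict (A ×ˢ Set.univ)).map Prod.snd (Set.univ.pi B) =
        (κA • 𝒥.sourceLaw) (Set.univ.pi B) := by
    intro B hB
    have hpi : MeasurableSet (Set.univ.pi B) := MeasurableSet.univ_pi hB
    have hset : Prod.snd ⁻¹' (Set.univ.pi B) ∩ A ×ˢ (Set.univ : Set (Sources ι)) =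
        A ×ˢ (Set.univ.pi B) := by
      ext p; simp [and_comm]
    rw [Measure.map_apply measurable_snd hpi, Measure.restrict_apply (measurable_snd hpi), hset,
      Measure.smul_apply, smul_eq_mul, hκ', ← 𝒥.lintegral_step_pi hcls a.1 a.2
        (measurable_one.indicator hA) hB, hν, Measure.map_apply hm (hA.prod hpi),
      ← lintegral_indicator_one (hm (hA.prod hpi))]
    refine lintegral_congr fun e => ?_
    classical
    simp only [Set.indicator_apply, Set.mem_preimage, Set.mem_prod, Pi.one_apply, ite_and,
      Prod.mk.eta]
    split_ifs <;> simp
  have hfin : IsFiniteMeasure ((ν.restrict (A ×ˢ Set.univ)).map Prod.snd) := inferInstance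
  have hmeas : (ν.restrict (A ×ˢ Set.univ)).map Prod.snd = κA • 𝒥.sourceLaw := by
    refine ext_of_generate_finite _ generateFrom_pi.symm isPiSystem_pi ?_ ?_
    · rintro _ ⟨B, hB, rfl⟩
      exact hbox B fun c => hB c (Set.mem_univ c)
    · have := hbox (fun _ => Set.univ) (fun _ => MeasurableSet.univ)
      simpa only [Set.pi_univ] using this
  have h := congrArg (fun m : Measure (Sources ι) => m t) hmeas
  simp only [Measure.smul_apply, smul_eq_mul] at h
  rw [← h, Measure.map_apply measurable_snd ht, Measure.restrict_apply (measurable_snd ht)]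
  congr 1
  ext p; simp [and_comm]

lemma lintegral_step (hcls : Measurable cls) (a : Config ι I × ℝ)
    {G : (Config ι I × ℝ) × Sources ι → ℝ≥0∞} (hG : Measurable G) :
    ∫⁻ e, G (𝒥.step cls (a, e)) ∂𝒥.sourceLaw =
      𝒥.nextEvent cls (fun b => ∫⁻ e, G (b, e) ∂𝒥.sourceLaw) a := by
  have hm := 𝒥.measurable_step_sources hcls a
  have hm1 : Measurable (fun e => (𝒥.step cls (a, e)).1) := measurable_fst.comp hm
  have hG' : Measurable (fun b => ∫⁻ e, G (b, e) ∂𝒥.sourceLaw) := hG.lintegral_prod_right'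
  rw [← lintegral_map hG hm, 𝒥.map_step_eq_prod hcls a, lintegral_prod _ hG.aemeasurable,
    lintegral_map hG' hm1, 𝒥.lintegral_step_fst hcls a hG']

end OpenNetworkData

/-! ### Occupation probabilities and the forward equation -/

namespace OpenNetworkData

variable {ι : Type*} [Fintype ι] (𝒥 : OpenNetworkData ι) {I : Type*}

/-- No channel has an event during a time span of length `a` in state `x`. -/
def NoEvent (x : ι → ℕ) (a : ℝ) (e : Sources ι) : Prop := ∀ c, 𝒥.rate c x * a < (e c 0).1

lemma sourceLaw_noEvent (x : ι → ℕ) {a : ℝ} (ha : 0 ≤ a) :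
    𝒥.sourceLaw {e | 𝒥.NoEvent x a e} = ENNReal.ofReal (Real.exp (-(𝒥.totalRate x * a))) := by
  have : {e | 𝒥.NoEvent x a e} = Set.univ.pi (fun c => {f | 𝒥.rate c x * a < (f 0).1}) := by
    ext e; simp [NoEvent]
  rw [this, sourceLaw, Measure.pi_pi]
  simp only [𝒥.streamLaw_head_gt _ (mul_nonneg (NNReal.coe_nonneg _) ha)]
  rw [← ENNReal.ofReal_prod_of_nonneg (fun _ _ => (Real.exp_pos _).le), ← Real.exp_sum]
  simp only [totalRate, NNReal.coe_sum, Finset.sum_mul, Finset.sum_neg_distrib]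

/-- The law of the configuration and the time after `r` events, if the law of the initial queue
lengths is `H`. -/
noncomputable def stageLaw (H : Measure (ι → ℕ)) (cls : ℝ → Option I) :
    ℕ → Measure (Config ι I × ℝ)
  | 0 => H.map (fun x => ((x, fun _ _ => 0), 0))
  | r + 1 => ((stageLaw H cls r).prod 𝒥.sourceLaw).map (fun z => (𝒥.step cls z).1)

instance stageLaw.sFinite (H : Measure (ι → ℕ)) [SFinite H] (cls : ℝ → Option I) (r : ℕ) :
    SFinite (𝒥.stageLaw H cls r) := by
  induction r with
  | zero => unfold stageLaw; infer_instance
  | succ r ih => unfold stageLaw; infer_instance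

variable [Finite I] {cls : ℝ → Option I}

lemma measurable_nextEvent (hcls : Measurable cls) {F : Config ι I × ℝ → ℝ≥0∞}
    (hF : Measurable F) : Measurable (𝒥.nextEvent cls F) := by
  have h : Measurable (fun a => ∫⁻ e, F (𝒥.step cls (a, e)).1 ∂𝒥.sourceLaw) :=
    Measurable.lintegral_prod_right' (f := fun z => F (𝒥.step cls z).1)
      (hF.comp (measurable_fst.comp (𝒥.measurable_step hcls)))
  have : 𝒥.nextEvent cls F = fun a => ∫⁻ e, F (𝒥.step cls (a, e)).1 ∂𝒥.sourceLaw :=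
    funext fun a => (𝒥.lintegral_step_fst hcls a hF).symm
  rw [this]
  exact h

lemma map_step_prod (hcls : Measurable cls) (ψ : Measure (Config ι I × ℝ)) [SFinite ψ] :
    (ψ.prod 𝒥.sourceLaw).map (𝒥.step cls) =
      ((ψ.prod 𝒥.sourceLaw).map (fun z => (𝒥.step cls z).1)).prod 𝒥.sourceLaw := by
  have hm := 𝒥.measurable_step hcls
  have hm1 : Measurable (fun z => (𝒥.step cls z).1) := measurable_fst.comp hm
  ext S hS
  have hG : Measurable (S.indicator (1 : (Config ι I × ℝ) × Sources ι → ℝ≥0∞)) :=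
    measurable_one.indicator hS
  have hG' : Measurable (fun b => ∫⁻ e,
      S.indicator (1 : (Config ι I × ℝ) × Sources ι → ℝ≥0∞) (b, e) ∂𝒥.sourceLaw) :=
    hG.lintegral_prod_right'
  have hc := hG.comp hm
  have hc1 := hG'.comp hm1
  rw [Function.comp_def] at hc hc1
  rw [← lintegral_indicator_one hS, ← lintegral_indicator_one hS, lintegral_map hG hm,
    lintegral_prod _ hc.aemeasurable, lintegral_prod _ hG.aemeasurable, lintegral_map hG' hm1,
    lintegral_prod _ hc1.aemeasurable]
  refine lintegral_congr fun a => ?_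
  rw [𝒥.lintegral_step hcls a hG, 𝒥.lintegral_step_fst hcls a hG']

/-- `stageLaw` supplies new sources before every event, whereas the iterates consume a single set of
sources. The two agree because the sources left after each event are again fresh and independent of
the configuration and time reached. -/
lemma map_iterate_step (hcls : Measurable cls) (H : Measure (ι → ℕ)) [SFinite H] (r : ℕ) :
    ((𝒥.stageLaw H cls 0).prod 𝒥.sourceLaw).map (𝒥.step cls)^[r] =
      (𝒥.stageLaw H cls r).prod 𝒥.sourceLaw := by
  have hm := 𝒥.measurable_step hcls
  induction r with
  | zero => simp [Measure.map_id]
  | succ r ih =>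
    rw [Function.iterate_succ', ← Measure.map_map hm (hm.iterate r), ih, 𝒥.map_step_prod hcls]
    rfl

lemma lintegral_stageLaw_succ (hcls : Measurable cls) (H : Measure (ι → ℕ)) [SFinite H] (r : ℕ)
    {F : Config ι I × ℝ → ℝ≥0∞} (hF : Measurable F) :
    ∫⁻ a, F a ∂𝒥.stageLaw H cls (r + 1) = ∫⁻ a, 𝒥.nextEvent cls F a ∂𝒥.stageLaw H cls r := by
  have hm1 : Measurable (fun z => (𝒥.step cls z).1) := measurable_fst.comp (𝒥.measurable_step hcls)
  have hc := hF.comp hm1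
  rw [Function.comp_def] at hc
  rw [stageLaw, lintegral_map hF hm1, lintegral_prod _ hc.aemeasurable]
  exact lintegral_congr fun a => 𝒥.lintegral_step_fst hcls a hF

omit [Finite I] in
lemma lintegral_stageLaw_zero (H : Measure (ι → ℕ)) {F : Config ι I × ℝ → ℝ≥0∞}
    (hF : Measurable F) :
    ∫⁻ a, F a ∂𝒥.stageLaw H cls 0 = ∫⁻ x, F ((x, fun _ _ => 0), 0) ∂H := by
  rw [stageLaw, lintegral_map hF (by fun_prop)]

lemma ae_stageLaw_nonneg (hcls : Measurable cls) (H : Measure (ι → ℕ)) [SFinite H] (r : ℕ) :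
    ∀ᵐ a ∂𝒥.stageLaw H cls r, 0 ≤ a.2 := by
  have hS : MeasurableSet {a : Config ι I × ℝ | ¬ 0 ≤ a.2} :=
    (measurableSet_le measurable_const measurable_snd).compl
  have hF : Measurable ({a : Config ι I × ℝ | ¬ 0 ≤ a.2}.indicator (1 : Config ι I × ℝ → ℝ≥0∞)) :=
    measurable_one.indicator hS
  induction r with
  | zero =>
    rw [ae_iff, ← lintegral_indicator_one hS, 𝒥.lintegral_stageLaw_zero H hF]
    simp
  | succ r ih =>
    rw [ae_iff, ← lintegral_indicator_one hS, 𝒥.lintegral_stageLaw_succ hcls H r hF,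
      lintegral_eq_zero_iff (𝒥.measurable_nextEvent hcls hF)]
    filter_upwards [ih] with a ha
    simp only [nextEvent, Pi.zero_apply]
    refine Finset.sum_eq_zero fun c _ => Finset.sum_eq_zero fun m _ => ?_
    rw [setLIntegral_congr_fun (g := 0) measurableSet_Ioi]
    · simp
    · intro s hs
      have : 0 ≤ a.2 + s := add_nonneg ha (Set.mem_Ioi.1 hs).le
      simp [this]

open Classical in
/-- The probability of being at time `t` in configuration `y` after exactly `r` events. -/
noncomputable def occupation (H : Measure (ι → ℕ)) (cls : ℝ → Option I) (r : ℕ) (t : ℝ)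
    (y : Config ι I) : ℝ≥0∞ :=
  ∫⁻ a, (if a.1 = y ∧ a.2 ≤ t then
    ENNReal.ofReal (Real.exp (-(𝒥.totalRate a.1.1 * (t - a.2)))) else 0) ∂𝒥.stageLaw H cls r

omit [Finite I] in
lemma measurable_survival : Measurable (fun p : (Config ι I × ℝ) × ℝ =>
    ENNReal.ofReal (Real.exp (-(𝒥.totalRate p.1.1.1 * (p.2 - p.1.2))))) := by
  have h : Measurable (fun p : (Config ι I × ℝ) × ℝ => (𝒥.totalRate p.1.1.1 : ℝ)) :=
    (measurable_of_countable (fun x : ι → ℕ => (𝒥.totalRate x : ℝ))).comp (by fun_prop)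
  fun_prop

open Classical in
lemma measurable_occupation_integrand (y : Config ι I) : Measurable
    (fun p : (Config ι I × ℝ) × ℝ => if p.1.1 = y ∧ p.1.2 ≤ p.2 then
      ENNReal.ofReal (Real.exp (-(𝒥.totalRate p.1.1.1 * (p.2 - p.1.2)))) else 0) := by
  refine Measurable.ite ?_ 𝒥.measurable_survival measurable_const
  exact ((measurableSet_singleton y).preimage (by fun_prop : Measurable
    (fun p : (Config ι I × ℝ) × ℝ => p.1.1))).inter
    (measurableSet_le (f := fun p : (Config ι I × ℝ) × ℝ => p.1.2) (g := fun p => p.2)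
      (by fun_prop) (by fun_prop))

lemma measurable_occupation (H : Measure (ι → ℕ)) [SFinite H] (r : ℕ) (y : Config ι I) :
    Measurable (fun t => 𝒥.occupation H cls r t y) := by
  classical
  exact Measurable.lintegral_prod_left' (𝒥.measurable_occupation_integrand y)

/-- At time `t`, the configuration is `y`, and there was no event since the last one recorded. -/
def occupied (𝒥 : OpenNetworkData ι) (t : ℝ) (y : Config ι I) :
    Set ((Config ι I × ℝ) × Sources ι) :=
  {z | z.1.1 = y ∧ z.1.2 ≤ t ∧ 𝒥.NoEvent z.1.1.1 (t - z.1.2) z.2}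

lemma measurableSet_occupied (t : ℝ) (y : Config ι I) : MeasurableSet (𝒥.occupied t y) := by
  have h1 : ∀ c, Measurable (fun z : (Config ι I × ℝ) × Sources ι =>
      (𝒥.rate c z.1.1.1 : ℝ)) := fun c =>
    (measurable_of_countable (fun x : ι → ℕ => (𝒥.rate c x : ℝ))).comp (by fun_prop)
  have : 𝒥.occupied t y = ((fun z => z.1.1) ⁻¹' {y}) ∩ ({z | z.1.2 ≤ t} ∩
        ⋂ c, {z | 𝒥.rate c z.1.1.1 * (t - z.1.2) < (z.2 c 0).1}) := by
    ext z; simp [NoEvent, occupied]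
  rw [this]
  refine ((measurableSet_singleton y).preimage (by fun_prop)).inter
    ((measurableSet_le (by fun_prop) measurable_const).inter
      (MeasurableSet.iInter fun c => measurableSet_lt ((h1 c).mul (by fun_prop)) (by fun_prop)))

lemma prod_occupied (H : Measure (ι → ℕ)) [SFinite H] (r : ℕ) (t : ℝ) (y : Config ι I) :
    (𝒥.stageLaw H cls r).prod 𝒥.sourceLaw (𝒥.occupied t y) = 𝒥.occupation H cls r t y := by
  rw [Measure.prod_apply (𝒥.measurableSet_occupied t y), occupation]
  refine lintegral_congr fun a => ?_
  by_cases h : a.1 = y ∧ a.2 ≤ t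
  · rw [if_pos h, ← 𝒥.sourceLaw_noEvent _ (sub_nonneg.2 h.2)]
    congr 1
    ext e
    simp [h.1, h.2, occupied]
  · rw [if_neg h]
    refine measure_mono_null ?_ measure_empty
    rintro e ⟨h1, h2, -⟩
    exact (h ⟨h1, h2⟩).elim

/-- This makes `occupation` a genuine probability: being silent from the last recorded event until
`t` has conditional probability `exp (-totalRate * (t - a.2))`, as the sources are fresh at that
event. -/
lemma measure_iterate_occupied (hcls : Measurable cls) (H : Measure (ι → ℕ)) [SFinite H] (r : ℕ)
    (t : ℝ) (y : Config ι I) :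
    (𝒥.stageLaw H cls 0).prod 𝒥.sourceLaw ((𝒥.step cls)^[r] ⁻¹' 𝒥.occupied t y) =
      𝒥.occupation H cls r t y := by
  rw [← Measure.map_apply ((𝒥.measurable_step hcls).iterate r) (𝒥.measurableSet_occupied t y),
    𝒥.map_iterate_step hcls, 𝒥.prod_occupied]

open Classical in
lemma occupation_zero (H : Measure (ι → ℕ)) {t : ℝ} (ht : 0 ≤ t) (y : Config ι I) :
    𝒥.occupation H cls 0 t y = if y.2 = 0 then
      H {y.1} * ENNReal.ofReal (Real.exp (-(𝒥.totalRate y.1 * t))) else 0 := by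
  classical
  have hm := (𝒥.measurable_occupation_integrand y).comp
    (by fun_prop : Measurable (fun a : Config ι I × ℝ => (a, t)))
  rw [Function.comp_def] at hm
  rw [occupation, 𝒥.lintegral_stageLaw_zero H hm]
  split_ifs with h
  · have : ∀ x : ι → ℕ, (if ((x, fun _ _ => 0) : Config ι I) = y ∧ (0 : ℝ) ≤ t then
        ENNReal.ofReal (Real.exp (-(𝒥.totalRate x * (t - 0)))) else 0) =
        ({y.1} : Set (ι → ℕ)).indicator
          (fun _ => ENNReal.ofReal (Real.exp (-(𝒥.totalRate y.1 * t)))) x := by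
      intro x
      by_cases hx : x = y.1
      · subst hx
        rw [if_pos ⟨Prod.ext rfl h.symm, ht⟩]
        simp
      · rw [if_neg (fun h' => hx (congrArg Prod.fst h'.1))]
        simp [hx]
    simp only [this]
    rw [lintegral_indicator_const (measurableSet_singleton _), mul_comm]
  · rw [lintegral_eq_zero_of_ae_eq_zero]
    refine Eventually.of_forall fun x => ?_
    exact if_neg fun h' => h (congrArg Prod.snd h'.1).symm

/-- There are countably many configurations, and the survival factor in the integrand is exactly the
one that defines `occupation`. -/
lemma lintegral_stageLaw_eq_tsum (H : Measure (ι → ℕ)) (r : ℕ) (s : ℝ) (g : Config ι I → ℝ≥0∞) :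
    ∫⁻ a, (if a.2 ≤ s then
      g a.1 * ENNReal.ofReal (Real.exp (-(𝒥.totalRate a.1.1 * (s - a.2)))) else 0)
        ∂𝒥.stageLaw H cls r = ∑' y, g y * 𝒥.occupation H cls r s y := by
  classical
  have hm : ∀ y : Config ι I, Measurable (fun a : Config ι I × ℝ => if a.1 = y ∧ a.2 ≤ s then
      ENNReal.ofReal (Real.exp (-(𝒥.totalRate a.1.1 * (s - a.2)))) else 0) := fun y =>
    (𝒥.measurable_occupation_integrand y).comp
      (by fun_prop : Measurable (fun a : Config ι I × ℝ => (a, s)))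
  simp only [occupation, ← lintegral_const_mul _ (hm _)]
  rw [← lintegral_tsum fun y => ((hm y).const_mul _).aemeasurable]
  refine lintegral_congr fun a => ?_
  rw [tsum_eq_single a.1]
  · by_cases h : a.2 ≤ s <;> simp [h]
  · intro y hy
    simp [hy.symm]

open Classical in
/-- The rate at which mass `v` flows into configuration `y` by events at time `s`. -/
noncomputable def inflow (cls : ℝ → Option I) (s : ℝ) (v : Config ι I → ℝ≥0∞) (y : Config ι I) :
    ℝ≥0∞ :=
  ∑ c, ∑ m, ∑' y', (𝒥.rate c y'.1 : ℝ≥0∞) * 𝒥.weight c m *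
    (if jump c m (cls s) y' = y then 1 else 0) * v y'

omit [Finite I] in
lemma inflow_mono (s : ℝ) {v w : Config ι I → ℝ≥0∞} (h : v ≤ w) (y : Config ι I) :
    𝒥.inflow cls s v y ≤ 𝒥.inflow cls s w y := by
  refine Finset.sum_le_sum fun c _ => Finset.sum_le_sum fun m _ => ENNReal.tsum_le_tsum fun y' => ?_
  gcongr
  exact h y'

omit [Finite I] in
lemma inflow_sum {κ : Type*} (S : Finset κ) (s : ℝ) (v : κ → Config ι I → ℝ≥0∞)
    (y : Config ι I) :
    𝒥.inflow cls s (fun y => ∑ r ∈ S, v r y) y = ∑ r ∈ S, 𝒥.inflow cls s (v r) y := by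
  simp only [inflow, Finset.mul_sum]
  symm
  rw [Finset.sum_comm]
  refine Finset.sum_congr rfl fun c _ => ?_
  rw [Finset.sum_comm]
  refine Finset.sum_congr rfl fun m _ => ?_
  exact (Summable.tsum_finsetSum fun _ _ => ENNReal.summable).symm

lemma measurable_inflow (hcls : Measurable cls) {v : ℝ → Config ι I → ℝ≥0∞}
    (hv : ∀ y, Measurable (fun s => v s y)) (y : Config ι I) :
    Measurable (fun s => 𝒥.inflow cls s (v s) y) := by
  classical
  refine Finset.measurable_sum _ fun c _ => Finset.measurable_sum _ fun m _ =>
    Measurable.tsum fun y' => Measurable.mul (Measurable.const_mul ?_ _) (hv y')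
  exact (measurable_of_countable
    (fun o => if jump c m o y' = y then (1 : ℝ≥0∞) else 0)).comp hcls

omit [Finite I] in
-- The change from waiting times to absolute times lets the event time `s` be integrated
-- independently of the stage, as the interchange in `occupation_succ` requires.
lemma nextEvent_eq_lintegral (F : Config ι I × ℝ → ℝ≥0∞) (a : Config ι I × ℝ) :
    𝒥.nextEvent cls F a = ∑ c, ∑ m, ∫⁻ s, (if a.2 ≤ s then
      (𝒥.rate c a.1.1 : ℝ≥0∞) * 𝒥.weight c m *
        ENNReal.ofReal (Real.exp (-(𝒥.totalRate a.1.1 * (s - a.2)))) *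
          F (jump c m (cls s) a.1, s) else 0) := by
  refine Finset.sum_congr rfl fun c _ => Finset.sum_congr rfl fun m _ => ?_
  rw [setLIntegral_congr Ioi_ae_eq_Ici, ← lintegral_indicator measurableSet_Ici]
  conv_rhs => rw [← lintegral_add_left_eq_self _ a.2]
  refine lintegral_congr fun s => ?_
  simp only [Set.indicator_apply, Set.mem_Ici, le_add_iff_nonneg_right, add_sub_cancel_left]

/-- The forward equation, by conditioning on the last event before time `t`. -/
lemma occupation_succ (hcls : Measurable cls) (H : Measure (ι → ℕ)) [SFinite H] (r : ℕ) (t : ℝ)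
    (y : Config ι I) :
    𝒥.occupation H cls (r + 1) t y =
      ∫⁻ s in Set.Icc 0 t, 𝒥.inflow cls s (𝒥.occupation H cls r s) y *
        ENNReal.ofReal (Real.exp (-(𝒥.totalRate y.1 * (t - s)))) := by
  classical
  have hm := (𝒥.measurable_occupation_integrand y).comp
    (by fun_prop : Measurable (fun a : Config ι I × ℝ => (a, t)))
  rw [Function.comp_def] at hm
  rw [occupation, 𝒥.lintegral_stageLaw_succ hcls H r hm]
  simp only [nextEvent_eq_lintegral]
  -- The density of leaving stage `a` at time `s` through `(c, m)`, arriving in `y`, and staying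
  -- there until `t`.
  let K : (ι ⊕ ι) → Option ι → (Config ι I × ℝ) → ℝ → ℝ≥0∞ := fun c m a s =>
    if a.2 ≤ s then (𝒥.rate c a.1.1 : ℝ≥0∞) * 𝒥.weight c m *
      ENNReal.ofReal (Real.exp (-(𝒥.totalRate a.1.1 * (s - a.2)))) *
      (if jump c m (cls s) a.1 = y ∧ s ≤ t then
        ENNReal.ofReal (Real.exp (-(𝒥.totalRate (jump c m (cls s) a.1).1 * (t - s)))) else 0)
      else 0
  have hK : ∀ c m, Measurable (Function.uncurry (K c m)) := by
    intro c m
    have hj : Measurable (fun p : (Config ι I × ℝ) × ℝ => jump c m (cls p.2) p.1.1) :=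
      (measurable_jump hcls c).comp (by fun_prop : Measurable
        (fun p : (Config ι I × ℝ) × ℝ => ((m, p.2), p.1.1)))
    refine Measurable.ite (measurableSet_le (f := fun p : (Config ι I × ℝ) × ℝ => p.1.2)
      (g := fun p => p.2) (by fun_prop) (by fun_prop)) ?_ measurable_const
    refine Measurable.mul (Measurable.mul (Measurable.mul ?_ measurable_const)
      𝒥.measurable_survival) (Measurable.ite ?_ ?_ measurable_const)
    · exact (measurable_of_countable (fun x : ι → ℕ => (𝒥.rate c x : ℝ≥0∞))).comp (by fun_prop)
    · exact ((measurableSet_singleton y).preimage hj).inter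
        (measurableSet_le (f := fun p : (Config ι I × ℝ) × ℝ => p.2) (by fun_prop)
          measurable_const)
    · have h : Measurable (fun p : (Config ι I × ℝ) × ℝ =>
          (𝒥.totalRate (jump c m (cls p.2) p.1.1).1 : ℝ)) :=
        (measurable_of_countable (fun x : ι → ℕ => (𝒥.totalRate x : ℝ))).comp
          (measurable_fst.comp hj)
      fun_prop
  have hKl : ∀ c m, Measurable (fun a => ∫⁻ s, K c m a s) := fun c m =>
    (hK c m).lintegral_prod_right
  change ∫⁻ a, (∑ c, ∑ m, ∫⁻ s, K c m a s) ∂𝒥.stageLaw H cls r = _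
  have hKr : ∀ c m, Measurable (fun s => ∫⁻ a, K c m a s ∂𝒥.stageLaw H cls r) := fun c m =>
    (hK c m).lintegral_prod_left
  rw [lintegral_finsetSum _ fun c _ => Finset.measurable_sum _ fun m _ => hKl c m]
  simp only [lintegral_finsetSum _ fun m (_ : m ∈ Finset.univ) => hKl _ m]
  -- After the interchange, the inner integral over the stages is an occupation probability at time
  -- `s`, times the probability of no event between `s` and `t`.
  have hswap : ∀ c m, ∫⁻ a, (∫⁻ s, K c m a s) ∂𝒥.stageLaw H cls r =
      ∫⁻ s, (∫⁻ a, K c m a s ∂𝒥.stageLaw H cls r) := fun c m =>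
    lintegral_lintegral_swap (hK c m).aemeasurable
  simp only [hswap]
  simp only [← lintegral_finsetSum _ fun m (_ : m ∈ Finset.univ) => hKr _ m]
  rw [← lintegral_finsetSum _ fun c _ => Finset.measurable_sum _ fun m _ => hKr c m,
    ← lintegral_indicator measurableSet_Icc]
  refine lintegral_congr fun s => ?_
  have hin : ∀ c m, ∫⁻ a, K c m a s ∂𝒥.stageLaw H cls r =
      (Set.Icc 0 t).indicator (fun s => (∑' y', (𝒥.rate c y'.1 : ℝ≥0∞) * 𝒥.weight c m *
        (if jump c m (cls s) y' = y then 1 else 0) * 𝒥.occupation H cls r s y') *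
        ENNReal.ofReal (Real.exp (-(𝒥.totalRate y.1 * (t - s))))) s := by
    intro c m
    by_cases hs : s ∈ Set.Icc 0 t
    · rw [Set.indicator_of_mem hs, ← 𝒥.lintegral_stageLaw_eq_tsum H r s,
        ← lintegral_mul_const' _ _ ENNReal.ofReal_ne_top]
      refine lintegral_congr fun a => ?_
      simp only [K]
      by_cases h1 : a.2 ≤ s
      · by_cases h2 : jump c m (cls s) a.1 = y
        · simp only [h1, h2, hs.2, and_self, if_true]
          ring
        · simp [h2]
      · simp [h1]
    · rw [Set.indicator_of_notMem hs]
      -- Times `s > t` are cut off by the kernel; times `s < 0` do not occur because stages have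
      -- nonnegative times.
      refine lintegral_eq_zero_of_ae_eq_zero ?_
      filter_upwards [𝒥.ae_stageLaw_nonneg hcls H r] with a ha
      simp only [K, Pi.zero_apply]
      split_ifs with h1 h2
      · exact (hs ⟨ha.trans h1, h2.2⟩).elim
      · simp
      · rfl
  simp only [hin]
  by_cases hs : s ∈ Set.Icc 0 t
  · simp only [Set.indicator_of_mem hs, ← Finset.sum_mul]
    rfl
  · simp only [Set.indicator_of_notMem hs, Finset.sum_const_zero]

end OpenNetworkData

/-! ### Moves of customers and partial balance -/

section Moves

variable {ι : Type*}

open Classical in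
lemma moveCustomer_arrival (j : ι) (x : ι → ℕ) :
    moveCustomer (.inl j) none x = x + Pi.single j 1 := by
  funext i
  simp [moveCustomer, Pi.single_apply, eq_comm]

open Classical in
lemma moveCustomer_exit (j : ι) (x : ι → ℕ) :
    moveCustomer (.inr j) none (x + Pi.single j 1) = x := by
  funext i
  by_cases h : i = j
  · subst h; simp [moveCustomer]
  · simp [moveCustomer, h, Ne.symm h]

open Classical in
lemma moveCustomer_transfer (j k : ι) (x : ι → ℕ) :
    moveCustomer (.inr j) (some k) (x + Pi.single j 1) = x + Pi.single k 1 := by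
  funext i
  have h1 : (∃ l : ι, (Sum.inr j : ι ⊕ ι) = .inr l) := ⟨j, rfl⟩
  have h2 : ((Sum.inr j : ι ⊕ ι) = .inr i) ↔ i = j := by rw [Sum.inr.injEq, eq_comm]
  have h3 : (some k = some i) ↔ i = k := by rw [Option.some.injEq, eq_comm]
  simp only [moveCustomer, Pi.add_apply, Pi.single_apply, reduceCtorEq, false_or, h1, true_and,
    h2, h3]
  split_ifs <;> omega

open Classical in
lemma exists_eq_add_single {x : ι → ℕ} {j : ι} (h : x j ≠ 0) :
    ∃ z : ι → ℕ, x = z + Pi.single j 1 := by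
  refine ⟨x - Pi.single j 1, ?_⟩
  funext i
  by_cases hi : i = j
  · subst hi; simp; omega
  · simp [hi]

end Moves

open Classical in
/-- The sum of `w` over the configurations of the counters from which a departure from node `j` in
the time window `o` leads to `d`. -/
noncomputable def exitTerm {ι I β : Type*} [Zero β] (o : Option I) (w : (ι → I → ℕ) → β) (j : ι)
    (d : ι → I → ℕ) : β :=
  match o with
  | none => w d
  | some i => if d j i = 0 then 0 else w (fun k i' => d k i' - if k = j ∧ i' = i then 1 else 0)

namespace OpenNetworkData

variable {ι : Type*} [Fintype ι] (𝒥 : OpenNetworkData ι) {I : Type*}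

lemma exitProb_add (k : ι) : 𝒥.exitProb k + ∑ j, 𝒥.p k j = 1 :=
  tsub_add_cancel_of_le (𝒥.p_sum_le k)

variable {𝒥} in
-- When the traffic equations are summed over all nodes, the flows between nodes cancel. The arrival
-- part of `totalRate` can thus be read as the total exit rate.
lemma TrafficEquations.sum_exit {α : ι → ℝ≥0} (hα : 𝒥.TrafficEquations α) :
    ∑ k, α k * 𝒥.exitProb k = ∑ k, 𝒥.ν k := by
  have h1 : ∑ k, α k = ∑ k, α k * 𝒥.exitProb k + ∑ k, ∑ j, α k * 𝒥.p k j := by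
    rw [← Finset.sum_add_distrib]
    refine Finset.sum_congr rfl fun k _ => ?_
    rw [← Finset.mul_sum, ← mul_add, 𝒥.exitProb_add, mul_one]
  have h2 : ∑ k, α k = ∑ k, 𝒥.ν k + ∑ k, ∑ j, α k * 𝒥.p k j := by
    rw [Finset.sum_comm, ← Finset.sum_add_distrib]
    exact Finset.sum_congr rfl fun k _ => hα k
  exact add_right_cancel (h1.symm.trans h2)

open Classical in
/-- `h` satisfies the relations between neighbouring states that characterise the product form. -/
def IsProductForm (𝒥 : OpenNetworkData ι) (α : ι → ℝ≥0) (h : (ι → ℕ) → ℝ≥0) : Prop :=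
  ∀ x k, h (x + Pi.single k 1) * 𝒥.μ k (x k + 1) = α k * h x

variable {𝒥} {α : ι → ℝ≥0} {h : (ι → ℕ) → ℝ≥0}

open Classical in
lemma tsum_inflow_arrival (o : Option I) (w : (ι → I → ℕ) → ℝ≥0∞) (j : ι) (y : Config ι I) :
    ∑' y' : Config ι I, (𝒥.rate (.inl j) y'.1 : ℝ≥0∞) * 𝒥.weight (.inl j) none *
      (if jump (.inl j) none o y' = y then 1 else 0) * (h y'.1 * w y'.2) =
      if y.1 j = 0 then 0 else 𝒥.ν j * (h (y.1 - Pi.single j 1) * w y.2) := by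
  have hj : ∀ y' : Config ι I, jump (.inl j) none o y' = (y'.1 + Pi.single j 1, y'.2) := by
    intro y'
    simp [jump, moveCustomer_arrival]
  split_ifs with h0
  · refine ENNReal.tsum_eq_zero.2 fun y' => ?_
    rw [if_neg, mul_zero, zero_mul]
    rintro rfl
    simp [hj] at h0
  · obtain ⟨z, hz⟩ := exists_eq_add_single h0
    rw [tsum_eq_single (z, y.2)]
    · rw [hj, if_pos (by rw [← hz])]
      simp [hz, rate, weight]
    · intro y' hy'
      rw [if_neg, mul_zero, zero_mul]
      rintro rfl
      rw [hj] at hz hy'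
      exact hy' (Prod.ext (add_right_cancel hz) rfl)

open Classical in
-- The only contributing predecessor has the customer at `j` instead of `k`; there the product form
-- cancels the service rate and leaves `α j`. States with `j` empty, where the truncated subtraction
-- could create spurious predecessors, drop out because `μ j 0 = 0`.
lemma tsum_inflow_transfer (hh : 𝒥.IsProductForm α h) (o : Option I) (w : (ι → I → ℕ) → ℝ≥0∞)
    (j k : ι) (y : Config ι I) :
    ∑' y' : Config ι I, (𝒥.rate (.inr j) y'.1 : ℝ≥0∞) * 𝒥.weight (.inr j) (some k) *
      (if jump (.inr j) (some k) o y' = y then 1 else 0) * (h y'.1 * w y'.2) =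
      if y.1 k = 0 then 0 else α j * 𝒥.p j k * (h (y.1 - Pi.single k 1) * w y.2) := by
  have hj : ∀ (z : ι → ℕ) (d : ι → I → ℕ), jump (.inr j) (some k) o
      ((z + Pi.single j 1, d) : Config ι I) =
      (z + Pi.single k 1, d) := by
    intro z d
    simp [jump, moveCustomer_transfer]
  have hrate : ∀ y' : Config ι I, y'.1 j = 0 → 𝒥.rate (.inr j) y'.1 = 0 := by
    intro y' hy'
    simp [rate, hy', 𝒥.μ_zero]
  split_ifs with h0
  · refine ENNReal.tsum_eq_zero.2 fun y' => ?_
    by_cases hy' : y'.1 j = 0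
    · simp [hrate y' hy']
    · obtain ⟨z, hz⟩ := exists_eq_add_single hy'
      rw [if_neg, mul_zero, zero_mul]
      have : y' = (z + Pi.single j 1, y'.2) := Prod.ext hz rfl
      rw [this, hj]
      rintro rfl
      simp at h0
  · obtain ⟨z, hz⟩ := exists_eq_add_single h0
    rw [tsum_eq_single (z + Pi.single j 1, y.2)]
    · rw [hj, if_pos (by rw [← hz])]
      have := hh z j
      simp only [rate, weight, hz, Pi.add_apply, Pi.single_eq_same, mul_one, add_tsub_cancel_right]
      calc _ = ((h (z + Pi.single j 1) * 𝒥.μ j (z j + 1) : ℝ≥0) : ℝ≥0∞) * 𝒥.p j k * w y.2 := by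
            push_cast; ring
        _ = _ := by rw [this]; push_cast; ring
    · intro y' hy'
      by_cases hy0 : y'.1 j = 0
      · simp [hrate y' hy0]
      · obtain ⟨z', hz'⟩ := exists_eq_add_single hy0
        rw [if_neg, mul_zero, zero_mul]
        have : y' = (z' + Pi.single j 1, y'.2) := Prod.ext hz' rfl
        rw [this, hj]
        rintro rfl
        simp only [add_left_inj] at hz
        subst hz
        exact hy' this

open Classical in
-- The predecessor has one more customer at `j`, and the product form turns its service rate into `α
-- j`. What remains depends on the queues only through the factor `h y.1`: this is why departures
-- are Poisson and independent of the present state.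
lemma tsum_inflow_exit (hh : 𝒥.IsProductForm α h) (o : Option I) (w : (ι → I → ℕ) → ℝ≥0∞)
    (j : ι) (y : Config ι I) :
    ∑' y' : Config ι I, (𝒥.rate (.inr j) y'.1 : ℝ≥0∞) * 𝒥.weight (.inr j) none *
      (if jump (.inr j) none o y' = y then 1 else 0) * (h y'.1 * w y'.2) =
      α j * 𝒥.exitProb j * (h y.1 * exitTerm o w j y.2) := by
  have hj : ∀ (z : ι → ℕ) (d : ι → I → ℕ), jump (.inr j) none o
      ((z + Pi.single j 1, d) : Config ι I) =
      (z, fun k i => d k i + if k = j ∧ o = some i then 1 else 0) := by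
    intro z d
    simp [jump, moveCustomer_exit, eq_comm]
  have hrate : ∀ y' : Config ι I, y'.1 j = 0 → 𝒥.rate (.inr j) y'.1 = 0 := by
    intro y' hy'
    simp [rate, hy', 𝒥.μ_zero]
  have key : ∀ d : ι → I → ℕ,
      (∀ k i, d k i + (if k = j ∧ o = some i then 1 else 0) = y.2 k i) →
      ∑' y' : Config ι I, (𝒥.rate (.inr j) y'.1 : ℝ≥0∞) * 𝒥.weight (.inr j) none *
      (if jump (.inr j) none o y' = y then 1 else 0) * (h y'.1 * w y'.2) =
      α j * 𝒥.exitProb j * (h y.1 * w d) := by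
    intro d hd
    rw [tsum_eq_single (y.1 + Pi.single j 1, d)]
    · have hy : ((y.1, fun k i => d k i + if k = j ∧ o = some i then 1 else 0) : Config ι I) = y :=
        Prod.ext rfl (funext fun k => funext fun i => hd k i)
      rw [hj, if_pos hy]
      have := hh y.1 j
      simp only [rate, weight, Pi.add_apply, Pi.single_eq_same, mul_one]
      calc _ = ((h (y.1 + Pi.single j 1) * 𝒥.μ j (y.1 j + 1) : ℝ≥0) : ℝ≥0∞) *
              𝒥.exitProb j * w d := by push_cast; ring
        _ = _ := by rw [this]; push_cast; ring
    · intro y' hy'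
      by_cases hy0 : y'.1 j = 0
      · simp [hrate y' hy0]
      · obtain ⟨z', hz'⟩ := exists_eq_add_single hy0
        rw [if_neg, mul_zero, zero_mul]
        have : y' = (z' + Pi.single j 1, y'.2) := Prod.ext hz' rfl
        rw [this, hj]
        rintro rfl
        refine hy' (Prod.ext hz' (funext fun k => funext fun i => ?_))
        exact (add_right_cancel (hd k i)).symm
  cases o with
  | none => exact key y.2 (by simp)
  | some i =>
    simp only [exitTerm]
    split_ifs with h0
    · rw [mul_zero, mul_zero]
      refine ENNReal.tsum_eq_zero.2 fun y' => ?_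
      by_cases hy0 : y'.1 j = 0
      · simp [hrate y' hy0]
      · obtain ⟨z', hz'⟩ := exists_eq_add_single hy0
        rw [if_neg, mul_zero, zero_mul]
        have : y' = (z' + Pi.single j 1, y'.2) := Prod.ext hz' rfl
        rw [this, hj]
        rintro rfl
        simp at h0
    · refine key _ fun k i' => ?_
      by_cases hk : k = j ∧ i' = i
      · obtain ⟨rfl, rfl⟩ := hk
        simp; omega
      · have hk' : ¬ (k = j ∧ some i = some i') := fun h => hk ⟨h.1, (Option.some.inj h.2).symm⟩
        rw [if_neg hk, if_neg hk']
        rfl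

/-- Partial balance. -/
lemma inflow_productForm (hα : 𝒥.TrafficEquations α) (hh : 𝒥.IsProductForm α h)
    (cls : ℝ → Option I) (s : ℝ) (w : (ι → I → ℕ) → ℝ≥0∞) (y : Config ι I) :
    𝒥.inflow cls s (fun y' => h y'.1 * w y'.2) y =
      h y.1 * ((∑ k, (𝒥.μ k (y.1 k) : ℝ≥0∞)) * w y.2 +
        ∑ k, (α k * 𝒥.exitProb k : ℝ≥0∞) * exitTerm (cls s) w k y.2) := by
  classical
  -- Arrivals and transfers into node `k` carry the total flow `α k * h (y.1 - e_k)` by the traffic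
  -- equation; the product form equates it with the flow of services at `k` out of `y.1`.
  have hrel : ∀ k, (if y.1 k = 0 then 0 else α k * (h (y.1 - Pi.single k 1) * w y.2)) =
      h y.1 * (𝒥.μ k (y.1 k) * w y.2) := by
    intro k
    split_ifs with h0
    · simp [h0, 𝒥.μ_zero]
    · obtain ⟨z, hz⟩ := exists_eq_add_single h0
      have := hh z k
      rw [hz]
      simp only [Pi.add_apply, Pi.single_eq_same, add_tsub_cancel_right]
      rw [← mul_assoc, ← mul_assoc]
      congr 1
      exact_mod_cast this.symm
  unfold inflow
  simp only [Fintype.sum_sum_type, Fintype.sum_option, tsum_inflow_arrival,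
    tsum_inflow_transfer hh, tsum_inflow_exit hh]
  have hz : ∀ j k, ∑' y' : Config ι I, (𝒥.rate (.inl j) y'.1 : ℝ≥0∞) *
      𝒥.weight (.inl j) (some k) * (if jump (.inl j) (some k) (cls s) y' = y then 1 else 0) *
        (h y'.1 * w y'.2) = 0 := by
    intro j k
    simp [weight]
  simp only [hz, Finset.sum_const_zero, add_zero]
  rw [Finset.sum_add_distrib, add_left_comm, add_comm, mul_add]
  congr 1
  · rw [Finset.sum_comm, ← Finset.sum_add_distrib, Finset.sum_mul, Finset.mul_sum]
    refine Finset.sum_congr rfl fun k _ => ?_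
    rw [← hrel k]
    split_ifs with h0
    · simp
    · rw [← Finset.sum_mul, ← add_mul]
      congr 1
      rw [hα k]
      push_cast
      rfl
  · rw [Finset.mul_sum]
    exact Finset.sum_congr rfl fun k _ => by ring

end OpenNetworkData

/-! ### Poisson counters solve the forward equation together with the product form -/

/-- The Poisson probabilities. -/
noncomputable def poissonWeight (r : ℝ) (n : ℕ) : ℝ := Real.exp (-r) * r ^ n / n.factorial

lemma poissonWeight_nonneg {r : ℝ} (hr : 0 ≤ r) (n : ℕ) : 0 ≤ poissonWeight r n := by
  unfold poissonWeight; positivity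

lemma poissonWeight_zero (n : ℕ) : poissonWeight 0 n = if n = 0 then 1 else 0 := by
  unfold poissonWeight
  split_ifs with h
  · simp [h]
  · simp [h]

lemma continuous_poissonWeight (n : ℕ) : Continuous (fun r => poissonWeight r n) := by
  unfold poissonWeight; fun_prop

lemma hasDerivAt_poissonWeight (r : ℝ) (n : ℕ) :
    HasDerivAt (fun r => poissonWeight r n)
      ((if n = 0 then 0 else poissonWeight r (n - 1)) - poissonWeight r n) r := by
  have h1 : HasDerivAt (fun r : ℝ => Real.exp (-r)) (-Real.exp (-r)) r := by
    simpa using (hasDerivAt_neg r).exp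
  have h2 := (h1.mul (hasDerivAt_pow n r)).div_const (n.factorial : ℝ)
  refine h2.congr_deriv ?_
  unfold poissonWeight
  cases n with
  | zero => simp
  | succ n =>
    have hf : (n.factorial : ℝ) ≠ 0 := by positivity
    simp only [Nat.factorial_succ, Nat.cast_mul, Nat.succ_ne_zero, if_false, Nat.add_sub_cancel]
    field_simp
    push_cast
    ring

open Classical in
/-- `Λ i t` is the time spent in the window `i` up to time `t`, where `cls s` is the window to which
the time `s` belongs. -/
structure IsWindowClock {I : Type*} (cls : ℝ → Option I) (Λ : I → ℝ → ℝ) : Prop where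
  measurable_cls : Measurable cls
  continuous : ∀ i, Continuous (Λ i)
  zero : ∀ i, Λ i 0 = 0
  nonneg : ∀ i t, 0 ≤ Λ i t
  hasDerivAt : ∃ S : Set ℝ, S.Countable ∧ ∀ s, s ∉ S → 0 < s → ∀ i,
    HasDerivAt (Λ i) (if cls s = some i then 1 else 0) s

section PoissonCounters

variable {ι I : Type*} [Fintype ι] [Fintype I]

/-- The probabilities of independent Poisson counters, for each node and each time window. -/
noncomputable def counterLaw (l : ι → ℝ≥0) (Λ : I → ℝ → ℝ) (t : ℝ) (d : ι → I → ℕ) : ℝ :=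
  ∏ k, ∏ i, poissonWeight (l k * Λ i t) (d k i)

variable {l : ι → ℝ≥0} {cls : ℝ → Option I} {Λ : I → ℝ → ℝ}

lemma counterLaw_nonneg (hΛ : IsWindowClock cls Λ) (t : ℝ) (d : ι → I → ℕ) :
    0 ≤ counterLaw l Λ t d :=
  Finset.prod_nonneg fun k _ => Finset.prod_nonneg fun i _ =>
    poissonWeight_nonneg (mul_nonneg (l k).2 (hΛ.nonneg i t)) _

open Classical in
lemma counterLaw_zero (hΛ : IsWindowClock cls Λ) (d : ι → I → ℕ) :
    counterLaw l Λ 0 d = if d = 0 then 1 else 0 := by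
  simp only [counterLaw, hΛ.zero, mul_zero, poissonWeight_zero]
  split_ifs with h
  · simp [h]
  · have : ∃ k i, d k i ≠ 0 := by
      by_contra hc
      push Not at hc
      exact h (funext fun k => funext fun i => hc k i)
    obtain ⟨k, i, hki⟩ := this
    exact Finset.prod_eq_zero (Finset.mem_univ k) (Finset.prod_eq_zero (Finset.mem_univ i)
      (if_neg hki))

lemma continuous_counterLaw (hΛ : IsWindowClock cls Λ) (d : ι → I → ℕ) :
    Continuous (fun t => counterLaw l Λ t d) :=
  continuous_finsetProd _ fun _ _ => continuous_finsetProd _ fun i _ =>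
    (continuous_poissonWeight _).comp ((hΛ.continuous i).const_mul _)

open Classical in
-- In the product rule only the factors of the window now open have a derivative. Lowering one of
-- these counters by one yields `exitTerm`, so this is the forward equation of independent Poisson
-- counters.
lemma hasDerivAt_counterLaw {s : ℝ}
    (hd : ∀ i, HasDerivAt (Λ i) (if cls s = some i then 1 else 0) s) (d : ι → I → ℕ) :
    HasDerivAt (fun t => counterLaw l Λ t d)
      (∑ k, l k * (exitTerm (cls s) (counterLaw l Λ s) k d - counterLaw l Λ s d)) s := by
  have hpair : ∀ t d, counterLaw l Λ t d =
      ∏ a : ι × I, poissonWeight (l a.1 * Λ a.2 t) (d a.1 a.2) := fun t d => by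
    rw [counterLaw, Fintype.prod_prod_type]
  have hf : ∀ a ∈ (Finset.univ : Finset (ι × I)), HasDerivAt
      (fun t => poissonWeight (l a.1 * Λ a.2 t) (d a.1 a.2))
      (((if d a.1 a.2 = 0 then 0 else poissonWeight (l a.1 * Λ a.2 s) (d a.1 a.2 - 1)) -
        poissonWeight (l a.1 * Λ a.2 s) (d a.1 a.2)) *
          (l a.1 * if cls s = some a.2 then 1 else 0)) s := fun a _ =>
    (hasDerivAt_poissonWeight _ _).comp s ((hd a.2).const_mul (l a.1 : ℝ))
  have h := HasDerivAt.fun_finsetProd hf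
  simp only [← hpair] at h
  refine h.congr_deriv ?_
  rw [Fintype.sum_prod_type]
  refine Finset.sum_congr rfl fun k _ => ?_
  cases hc : cls s with
  | none => simp [exitTerm]
  | some i =>
    rw [Finset.sum_eq_single i]
    · have e1 := Finset.prod_erase_mul Finset.univ
        (fun a : ι × I => poissonWeight (l a.1 * Λ a.2 s) (d a.1 a.2)) (Finset.mem_univ (k, i))
      rw [← hpair] at e1
      -- Only the factor of `(k, i)` sees the lowered counter; a counter equal to `0` has no
      -- predecessor.
      have e2 : (∏ a ∈ Finset.univ.erase (k, i), poissonWeight (l a.1 * Λ a.2 s) (d a.1 a.2)) *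
          (if d k i = 0 then 0 else poissonWeight (l k * Λ i s) (d k i - 1)) =
          if d k i = 0 then 0 else counterLaw l Λ s
            (fun k' i' => d k' i' - if k' = k ∧ i' = i then 1 else 0) := by
        split_ifs with h0
        · simp
        · rw [hpair, ← Finset.prod_erase_mul Finset.univ _ (Finset.mem_univ (k, i))]
          congr 1
          · refine Finset.prod_congr rfl fun a ha => ?_
            have : ¬ (a.1 = k ∧ a.2 = i) := fun h => Finset.ne_of_mem_erase ha (Prod.ext h.1 h.2)
            simp [this]
          · simp
      simp only [if_true, mul_one, smul_eq_mul, exitTerm]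
      rw [← e1, ← e2]
      ring
    · intro i' _ hi'
      simp [hi'.symm]
    · simp

end PoissonCounters

namespace OpenNetworkData

variable {ι : Type*} [Fintype ι] {𝒥 : OpenNetworkData ι} {I : Type*} [Fintype I]
  {α : ι → ℝ≥0} {h : (ι → ℕ) → ℝ≥0} {cls : ℝ → Option I} {Λ : I → ℝ → ℝ}

/-- The rates of the departures from the network. -/
noncomputable def exitRate (𝒥 : OpenNetworkData ι) (α : ι → ℝ≥0) (k : ι) : ℝ≥0 :=
  α k * 𝒥.exitProb k

/-- The inflow into configuration `y` of the product of a product form and the Poisson counters. -/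
noncomputable def productInflow (𝒥 : OpenNetworkData ι) (α : ι → ℝ≥0) (h : (ι → ℕ) → ℝ≥0)
    (Λ : I → ℝ → ℝ) (o : Option I) (s : ℝ) (y : Config ι I) : ℝ :=
  h y.1 * ((∑ k, (𝒥.μ k (y.1 k) : ℝ)) * counterLaw (𝒥.exitRate α) Λ s y.2 +
    ∑ k, 𝒥.exitRate α k * exitTerm o (counterLaw (𝒥.exitRate α) Λ s) k y.2)

omit [Fintype ι] [Fintype I] in
lemma exitTerm_nonneg {w : (ι → I → ℕ) → ℝ} (hw : ∀ d, 0 ≤ w d) (o : Option I) (k : ι)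
    (d : ι → I → ℕ) : 0 ≤ exitTerm o w k d := by
  cases o with
  | none => exact hw d
  | some i => simp only [exitTerm]; split_ifs; exacts [le_rfl, hw _]

lemma productInflow_nonneg (hΛ : IsWindowClock cls Λ) (o : Option I) (s : ℝ) (y : Config ι I) :
    0 ≤ 𝒥.productInflow α h Λ o s y := by
  have hc : ∀ d, 0 ≤ counterLaw (𝒥.exitRate α) Λ s d := counterLaw_nonneg hΛ s
  refine mul_nonneg (h y.1).2 (add_nonneg (mul_nonneg ?_ (hc _)) ?_)
  · exact Finset.sum_nonneg fun k _ => NNReal.coe_nonneg _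
  · exact Finset.sum_nonneg fun k _ => mul_nonneg (NNReal.coe_nonneg _) (exitTerm_nonneg hc o k _)

/-- With the open window `o` held fixed, the only source of discontinuity in time, the switching of
windows, is removed. -/
lemma continuous_productInflow (hΛ : IsWindowClock cls Λ) (o : Option I) (y : Config ι I) :
    Continuous (fun s => 𝒥.productInflow α h Λ o s y) := by
  have hc : ∀ d, Continuous (fun s => counterLaw (𝒥.exitRate α) Λ s d) := continuous_counterLaw hΛ
  have he : ∀ k, Continuous (fun s => exitTerm o (counterLaw (𝒥.exitRate α) Λ s) k y.2) := by
    intro k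
    cases o with
    | none => exact hc _
    | some i =>
      simp only [exitTerm]
      split_ifs
      exacts [continuous_const, hc _]
  unfold productInflow
  exact continuous_const.mul ((continuous_const.mul (hc _)).add
    (continuous_finsetSum _ fun k _ => continuous_const.mul (he k)))

lemma inflow_ofReal_product (hα : 𝒥.TrafficEquations α) (hh : 𝒥.IsProductForm α h)
    (hΛ : IsWindowClock cls Λ) (s : ℝ) (y : Config ι I) :
    𝒥.inflow cls s (fun y => h y.1 * ENNReal.ofReal (counterLaw (𝒥.exitRate α) Λ s y.2)) y =
      ENNReal.ofReal (𝒥.productInflow α h Λ (cls s) s y) := by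
  have hc : ∀ d, 0 ≤ counterLaw (𝒥.exitRate α) Λ s d := counterLaw_nonneg hΛ s
  have hex : ∀ k, exitTerm (cls s) (fun d => ENNReal.ofReal (counterLaw (𝒥.exitRate α) Λ s d)) k
      y.2 = ENNReal.ofReal (exitTerm (cls s) (counterLaw (𝒥.exitRate α) Λ s) k y.2) := by
    intro k
    cases cls s with
    | none => rfl
    | some i => simp only [exitTerm]; split_ifs <;> simp
  have h1 : ∀ k, 0 ≤ exitTerm (cls s) (counterLaw (𝒥.exitRate α) Λ s) k y.2 :=
    fun k => exitTerm_nonneg hc _ k _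
  rw [inflow_productForm hα hh cls s
    (fun d => ENNReal.ofReal (counterLaw (𝒥.exitRate α) Λ s d)), productInflow,
    ENNReal.ofReal_mul (NNReal.coe_nonneg _),
    ENNReal.ofReal_coe_nnreal, ENNReal.ofReal_add
      (mul_nonneg (Finset.sum_nonneg fun k _ => NNReal.coe_nonneg _) (hc _))
      (Finset.sum_nonneg fun k _ => mul_nonneg (NNReal.coe_nonneg _) (h1 k)),
    ENNReal.ofReal_mul (Finset.sum_nonneg fun k _ => NNReal.coe_nonneg _),
    ENNReal.ofReal_sum_of_nonneg (fun k _ => NNReal.coe_nonneg _),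
    ENNReal.ofReal_sum_of_nonneg (fun k _ => mul_nonneg (NNReal.coe_nonneg _) (h1 k))]
  simp only [ENNReal.ofReal_coe_nnreal, hex, ENNReal.ofReal_mul (NNReal.coe_nonneg _), exitRate,
    ENNReal.coe_mul]

/-- The integrand is the derivative of `h y.1 * counterLaw s * exp (-q (t - s))`: the loss term of
the counters, the total exit rate, and the services together cancel against the `q` that comes from
the exponential. Window endpoints form a countable exceptional set. -/
lemma integral_productInflow (hα : 𝒥.TrafficEquations α) (hΛ : IsWindowClock cls Λ)
    {t : ℝ} (ht : 0 ≤ t) (y : Config ι I) :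
    IntervalIntegrable (fun s => 𝒥.productInflow α h Λ (cls s) s y *
      Real.exp (-(𝒥.totalRate y.1 * (t - s)))) volume 0 t ∧
    ∫ s in (0 : ℝ)..t, 𝒥.productInflow α h Λ (cls s) s y *
      Real.exp (-(𝒥.totalRate y.1 * (t - s))) =
      h y.1 * counterLaw (𝒥.exitRate α) Λ t y.2 -
        h y.1 * counterLaw (𝒥.exitRate α) Λ 0 y.2 * Real.exp (-(𝒥.totalRate y.1 * t)) := by
  classical
  set q : ℝ := (𝒥.totalRate y.1 : ℝ) with hq
  -- The exogenous arrivals in the total rate are exchanged for the exits.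
  have hq' : q = (∑ k, (𝒥.exitRate α k : ℝ)) + ∑ k, (𝒥.μ k (y.1 k) : ℝ) := by
    have h1 : ∑ k, 𝒥.exitRate α k = ∑ k, 𝒥.ν k := hα.sum_exit
    have h2 : 𝒥.totalRate y.1 = ∑ k, 𝒥.exitRate α k + ∑ k, 𝒥.μ k (y.1 k) := by
      rw [h1, totalRate, Fintype.sum_sum_type]; rfl
    rw [hq, h2]; push_cast; rfl
  have hint : IntervalIntegrable (fun s => 𝒥.productInflow α h Λ (cls s) s y *
      Real.exp (-(q * (t - s)))) volume 0 t := by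
    -- Decomposed by the open window, the integrand is a finite sum of continuous functions
    -- restricted to measurable sets.
    have hsum : (fun s => 𝒥.productInflow α h Λ (cls s) s y * Real.exp (-(q * (t - s)))) =
        fun s => ∑ o : Option I, (cls ⁻¹' {o}).indicator
          (fun s => 𝒥.productInflow α h Λ o s y * Real.exp (-(q * (t - s)))) s := by
      funext s
      rw [Finset.sum_eq_single (cls s)]
      · rw [Set.indicator_of_mem (by simp)]
      · intro o _ ho
        exact Set.indicator_of_notMem (by simpa using ho.symm) _
      · simp
    rw [hsum, intervalIntegrable_iff]
    refine integrable_finsetSum _ fun o _ => ?_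
    refine Integrable.indicator ?_ (hΛ.measurable_cls trivial)
    rw [← IntegrableOn, ← intervalIntegrable_iff]
    refine Continuous.intervalIntegrable ?_ _ _
    exact (continuous_productInflow hΛ o y).mul (by fun_prop)
  refine ⟨hint, ?_⟩
  obtain ⟨S, hS, hderiv⟩ := hΛ.hasDerivAt
  have hcont := continuous_counterLaw (l := 𝒥.exitRate α) hΛ y.2
  rw [integral_eq_of_hasDerivAt_off_countable_of_le
    (fun s => h y.1 * counterLaw (𝒥.exitRate α) Λ s y.2 * Real.exp (-(q * (t - s)))) _ ht hS
    (by fun_prop) ?_ hint]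
  · simp
  · rintro s ⟨⟨hs0, _⟩, hsS⟩
    have h1 := hasDerivAt_counterLaw (l := 𝒥.exitRate α) (hderiv s hsS hs0) y.2
    have h2 : HasDerivAt (fun s => Real.exp (-(q * (t - s))))
        (Real.exp (-(q * (t - s))) * q) s := by
      have h3 : HasDerivAt (fun s => -(q * (t - s))) q s := by
        exact (((hasDerivAt_id' s).const_sub t).const_mul q).fun_neg.congr_deriv (by simp)
      exact h3.exp
    refine ((h1.const_mul (h y.1 : ℝ)).mul h2).congr_deriv ?_
    simp only [productInflow, mul_sub, Finset.sum_sub_distrib, ← Finset.sum_mul]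
    rw [hq']
    ring

/-- A product form with independent Poisson counters solves the forward equation. -/
lemma forward_equation_product (hα : 𝒥.TrafficEquations α) (hh : 𝒥.IsProductForm α h)
    (hΛ : IsWindowClock cls Λ) {t : ℝ} (ht : 0 ≤ t) (y : Config ι I) :
    h y.1 * ENNReal.ofReal (counterLaw (𝒥.exitRate α) Λ 0 y.2) *
        ENNReal.ofReal (Real.exp (-(𝒥.totalRate y.1 * t))) +
      ∫⁻ s in Set.Icc 0 t, 𝒥.inflow cls s
        (fun y => h y.1 * ENNReal.ofReal (counterLaw (𝒥.exitRate α) Λ s y.2)) y *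
        ENNReal.ofReal (Real.exp (-(𝒥.totalRate y.1 * (t - s)))) =
      h y.1 * ENNReal.ofReal (counterLaw (𝒥.exitRate α) Λ t y.2) := by
  obtain ⟨hint, heq⟩ := integral_productInflow (h := h) hα hΛ ht y
  have hnn : ∀ s, 0 ≤ 𝒥.productInflow α h Λ (cls s) s y *
      Real.exp (-(𝒥.totalRate y.1 * (t - s))) := fun s =>
    mul_nonneg (productInflow_nonneg hΛ _ _ _) (Real.exp_pos _).le
  have h0 := counterLaw_nonneg (l := 𝒥.exitRate α) hΛ 0 y.2
  have ht' := counterLaw_nonneg (l := 𝒥.exitRate α) hΛ t y.2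
  simp only [inflow_ofReal_product hα hh hΛ, ← ENNReal.ofReal_mul (productInflow_nonneg hΛ _ _ _)]
  rw [← ofReal_integral_eq_lintegral_ofReal, integral_Icc_eq_integral_Ioc,
    ← intervalIntegral.integral_of_le ht, heq, ← ENNReal.ofReal_coe_nnreal,
    ← ENNReal.ofReal_mul (NNReal.coe_nonneg _), ← ENNReal.ofReal_mul (NNReal.coe_nonneg _),
    ← ENNReal.ofReal_mul (mul_nonneg (NNReal.coe_nonneg _) h0), ← ENNReal.ofReal_add]
  · congr 1; ring
  · exact mul_nonneg (mul_nonneg (NNReal.coe_nonneg _) h0) (Real.exp_pos _).le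
  · rw [← heq]
    exact intervalIntegral.integral_nonneg ht fun s _ => hnn s
  · exact (integrableOn_Icc_iff_integrableOn_Ioc enorm_ne_top).2
      ((intervalIntegrable_iff_integrableOn_Ioc_of_le ht).1 hint)
  · exact Eventually.of_forall hnn

/-- The probabilities of the network are bounded by any solution of the forward equation. -/
lemma sum_occupation_le (hα : 𝒥.TrafficEquations α) (hh : 𝒥.IsProductForm α h)
    (hΛ : IsWindowClock cls Λ) {H : Measure (ι → ℕ)} [SFinite H] (hH : ∀ x, H {x} ≤ h x)
    (R : ℕ) {t : ℝ} (ht : 0 ≤ t) (y : Config ι I) :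
    ∑ r ∈ Finset.range R, 𝒥.occupation H cls r t y ≤
      h y.1 * ENNReal.ofReal (counterLaw (𝒥.exitRate α) Λ t y.2) := by
  classical
  induction R generalizing t y with
  | zero => simp
  | succ R ih =>
    have hm : ∀ r, Measurable (fun s => 𝒥.inflow cls s (𝒥.occupation H cls r s) y *
        ENNReal.ofReal (Real.exp (-(𝒥.totalRate y.1 * (t - s))))) := fun r =>
      (𝒥.measurable_inflow hΛ.measurable_cls (fun y => 𝒥.measurable_occupation H r y) y).mul
        (by fun_prop)
    -- The term without events is compared with the initial term of the product solution. Each other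
    -- term is an integrated inflow, to which the induction hypothesis applies at all earlier times
    -- and in all configurations.
    rw [Finset.sum_range_succ']
    simp only [𝒥.occupation_succ hΛ.measurable_cls]
    rw [← lintegral_finsetSum _ fun r _ => hm r, 𝒥.occupation_zero H ht, add_comm,
      ← forward_equation_product hα hh hΛ ht y]
    gcongr ?_ + ?_
    · split_ifs with h0
      · rw [counterLaw_zero hΛ, if_pos h0, ENNReal.ofReal_one, mul_one]
        gcongr
        exact hH _
      · exact zero_le
    · refine setLIntegral_mono' measurableSet_Icc fun s hs => ?_
      rw [← Finset.sum_mul, ← inflow_sum]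
      gcongr
      exact 𝒥.inflow_mono s (fun y' => ih hs.1 y') y

lemma tsum_occupation_le (hα : 𝒥.TrafficEquations α) (hh : 𝒥.IsProductForm α h)
    (hΛ : IsWindowClock cls Λ) {H : Measure (ι → ℕ)} [SFinite H] (hH : ∀ x, H {x} ≤ h x)
    {t : ℝ} (ht : 0 ≤ t) (y : Config ι I) :
    ∑' r, 𝒥.occupation H cls r t y ≤
      h y.1 * ENNReal.ofReal (counterLaw (𝒥.exitRate α) Λ t y.2) := by
  rw [ENNReal.tsum_eq_iSup_nat]
  exact iSup_le fun R => sum_occupation_le hα hh hΛ hH R ht y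

end OpenNetworkData

/-! ### Disjointness, positivity and uniqueness of the stationary law -/

namespace OpenNetworkData

variable {ι : Type*} [Fintype ι] {𝒥 : OpenNetworkData ι} {I : Type*} [Finite I]
  {cls : ℝ → Option I}

section Disjoint

/-- Past time `t`, or without further events. -/
def Expired (t : ℝ) (z : (Config ι I × ℝ) × Sources ι) : Prop :=
  t < z.1.2 ∨ z.2 = fun _ _ => (0, none)

omit [Finite I] in
lemma Expired.step {t : ℝ} {z : (Config ι I × ℝ) × Sources ι} (hz : Expired t z) :
    Expired t (𝒥.step cls z) := by
  by_cases h : ∃ c, 𝒥.Wins z.1.1.1 z.2 c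
  · obtain ⟨c, hc⟩ := h
    rw [step_of_wins hc]
    rcases hz with hz | hz
    · have := hc.waiting_pos
      left
      simp only [eventState]
      linarith
    · have := hc.2.1
      simp [hz] at this
  · rw [step_of_not_wins h]
    exact Or.inr rfl

omit [Finite I] in
lemma Expired.not_occupied {t : ℝ} {z : (Config ι I × ℝ) × Sources ι} (hz : Expired t z)
    (y : Config ι I) : z ∉ 𝒥.occupied t y := by
  rintro ⟨-, h1, h2⟩
  rcases hz with hz | hz
  · exact absurd hz (not_lt.2 h1)
  · obtain ⟨j, -⟩ := 𝒥.exists_ν_pos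
    have h3 := h2 (.inl j)
    rw [hz] at h3
    exact absurd h3 (not_lt.2 (mul_nonneg (NNReal.coe_nonneg _) (sub_nonneg.2 h1)))

omit [Finite I] in
lemma expired_step_of_occupied {t : ℝ} {y : Config ι I} {z : (Config ι I × ℝ) × Sources ι}
    (hz : z ∈ 𝒥.occupied t y) : Expired t (𝒥.step cls z) := by
  by_cases h : ∃ c, 𝒥.Wins z.1.1.1 z.2 c
  · obtain ⟨c, hc⟩ := h
    rw [step_of_wins hc]
    left
    have h1 : (0 : ℝ) < 𝒥.rate c z.1.1.1 := hc.1
    have h2 := hz.2.2 c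
    have h3 : t - z.1.2 < 𝒥.waiting z.1.1.1 z.2 c := by
      rw [waiting, lt_div_iff₀ h1, mul_comm]; exact h2
    simp only [eventState]
    linarith
  · rw [step_of_not_wins h]
    exact Or.inr rfl

omit [Finite I] in
-- A stage that is silent until `t` is followed by one that is past `t` or dead, and both conditions
-- persist. Hence at most one stage is occupied at time `t`.
lemma eq_of_iterate_occupied {t : ℝ} {y y' : Config ι I} {z : (Config ι I × ℝ) × Sources ι}
    {r r' : ℕ} (h : (𝒥.step cls)^[r] z ∈ 𝒥.occupied t y)
    (h' : (𝒥.step cls)^[r'] z ∈ 𝒥.occupied t y') : r = r' ∧ y = y' := by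
  have key : ∀ r k, ∀ y y' : Config ι I, (𝒥.step cls)^[r] z ∈ 𝒥.occupied t y →
      (𝒥.step cls)^[k + 1 + r] z ∉ 𝒥.occupied t y' := by
    intro r k y y' h
    refine Expired.not_occupied ?_ y'
    induction k with
    | zero =>
      rw [zero_add, Function.iterate_add_apply]
      exact expired_step_of_occupied h
    | succ k ih =>
      rw [show k + 1 + 1 + r = (k + 1 + r) + 1 by ring, Function.iterate_succ_apply']
      exact ih.step
  rcases lt_trichotomy r r' with hlt | heq | hlt
  · obtain ⟨k, rfl⟩ := Nat.exists_eq_add_of_lt hlt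
    exact (key r k y y' h (by rwa [show k + 1 + r = r + k + 1 by ring])).elim
  · subst heq
    exact ⟨rfl, h.1.symm.trans h'.1⟩
  · obtain ⟨k, rfl⟩ := Nat.exists_eq_add_of_lt hlt
    exact (key r' k y' y h' (by rwa [show k + 1 + r' = r' + k + 1 by ring])).elim

/-- The occupied events are disjoint. An inequality is enough for the comparison below, and it
leaves open whether mass could escape by infinitely many events in finite time. -/
lemma tsum_occupation_le_mass (hcls : Measurable cls) (H : Measure (ι → ℕ)) [SFinite H] (t : ℝ) :
    ∑' y, ∑' r, 𝒥.occupation H cls r t y ≤ H Set.univ := by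
  have hm : ∀ p : Config ι I × ℕ, MeasurableSet ((𝒥.step cls)^[p.2] ⁻¹' 𝒥.occupied t p.1) :=
    fun p => ((𝒥.measurable_step hcls).iterate p.2) (𝒥.measurableSet_occupied t p.1)
  have hd : Pairwise (Function.onFun Disjoint
      fun p : Config ι I × ℕ => (𝒥.step cls)^[p.2] ⁻¹' 𝒥.occupied t p.1) := by
    intro p p' hne
    refine Set.disjoint_left.2 fun z hz hz' => hne ?_
    obtain ⟨h1, h2⟩ := eq_of_iterate_occupied hz hz'
    exact Prod.ext h2 h1
  calc ∑' y, ∑' r, 𝒥.occupation H cls r t y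
      = ∑' p : Config ι I × ℕ, 𝒥.occupation H cls p.2 t p.1 := (ENNReal.tsum_prod).symm
    _ = ((𝒥.stageLaw H cls 0).prod 𝒥.sourceLaw)
          (⋃ p : Config ι I × ℕ, (𝒥.step cls)^[p.2] ⁻¹' 𝒥.occupied t p.1) := by
        rw [measure_iUnion hd hm]
        exact tsum_congr fun p => (𝒥.measure_iterate_occupied hcls H p.2 t p.1).symm
    _ ≤ ((𝒥.stageLaw H cls 0).prod 𝒥.sourceLaw) Set.univ := measure_mono (Set.subset_univ _)
    _ = H Set.univ := by
        rw [← Set.univ_prod_univ, Measure.prod_prod, measure_univ (μ := 𝒥.sourceLaw), mul_one,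
          stageLaw,
          Measure.map_apply (by fun_prop) MeasurableSet.univ, Set.preimage_univ]

end Disjoint

lemma occupation_add (hcls : Measurable cls) (H H' : Measure (ι → ℕ)) [SFinite H] [SFinite H']
    (r : ℕ) (t : ℝ) (y : Config ι I) :
    𝒥.occupation (H + H') cls r t y = 𝒥.occupation H cls r t y + 𝒥.occupation H' cls r t y := by
  simp only [← 𝒥.measure_iterate_occupied hcls]
  have : 𝒥.stageLaw (H + H') cls 0 = 𝒥.stageLaw H cls 0 + 𝒥.stageLaw H' cls 0 := by
    simp only [stageLaw]
    rw [Measure.map_add _ _ (by fun_prop)]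
  rw [this, Measure.add_prod, Measure.add_apply]

section Positivity

/-- One term of the inflow is positive at every time in `(0, t)`, and so is the survival factor; the
integral in the forward equation cannot vanish. -/
lemma occupation_succ_pos (hcls : Measurable cls) (H : Measure (ι → ℕ)) [SFinite H] {r : ℕ}
    {y y' : Config ι I} {c : ι ⊕ ι} {m : Option ι} (hr : 0 < 𝒥.rate c y.1)
    (hw : 0 < 𝒥.weight c m) (hj : ∀ s, jump c m (cls s) y = y')
    (hy : ∀ t, 0 < t → 0 < 𝒥.occupation H cls r t y) {t : ℝ} (ht : 0 < t) :
    0 < 𝒥.occupation H cls (r + 1) t y' := by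
  classical
  have hm : Measurable (fun s => 𝒥.inflow cls s (𝒥.occupation H cls r s) y' *
      ENNReal.ofReal (Real.exp (-(𝒥.totalRate y'.1 * (t - s))))) :=
    (𝒥.measurable_inflow hcls (fun y => 𝒥.measurable_occupation H r y) y').mul (by fun_prop)
  rw [𝒥.occupation_succ hcls, pos_iff_ne_zero]
  intro h0
  rw [lintegral_eq_zero_iff hm] at h0
  have h1 : ∀ᵐ s ∂volume.restrict (Set.Ioo 0 t), 𝒥.inflow cls s (𝒥.occupation H cls r s) y' *
      ENNReal.ofReal (Real.exp (-(𝒥.totalRate y'.1 * (t - s)))) = 0 :=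
    ae_restrict_of_ae_restrict_of_subset Set.Ioo_subset_Icc_self h0
  have hne : NeBot (ae (volume.restrict (Set.Ioo 0 t))) := by
    rw [ae_neBot, Ne, Measure.restrict_eq_zero]
    simp [ht]
  obtain ⟨s, hs, hs0⟩ := (h1.and (ae_restrict_mem measurableSet_Ioo)).exists
  have h2 : 0 < (𝒥.rate c y.1 : ℝ≥0∞) * 𝒥.weight c m *
      (if jump c m (cls s) y = y' then 1 else 0) * 𝒥.occupation H cls r s y := by
    rw [if_pos (hj s), mul_one]
    have := hy s hs0.1
    exact ENNReal.mul_pos (ENNReal.mul_pos (by simpa using hr.ne') (by simpa using hw.ne')).ne'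
      this.ne'
  have h3 : 0 < 𝒥.inflow cls s (𝒥.occupation H cls r s) y' := by
    refine h2.trans_le ?_
    refine le_trans ?_ (Finset.single_le_sum (f := fun c => ∑ m, ∑' y₁, (𝒥.rate c y₁.1 : ℝ≥0∞) *
      𝒥.weight c m * (if jump c m (cls s) y₁ = y' then 1 else 0) * 𝒥.occupation H cls r s y₁)
      (fun _ _ => zero_le) (Finset.mem_univ c))
    refine le_trans ?_ (Finset.single_le_sum (f := fun m => ∑' y₁, (𝒥.rate c y₁.1 : ℝ≥0∞) *
      𝒥.weight c m * (if jump c m (cls s) y₁ = y' then 1 else 0) * 𝒥.occupation H cls r s y₁)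
      (fun _ _ => zero_le) (Finset.mem_univ m))
    exact ENNReal.le_tsum (f := fun y₁ => (𝒥.rate c y₁.1 : ℝ≥0∞) *
      𝒥.weight c m * (if jump c m (cls s) y₁ = y' then 1 else 0) * 𝒥.occupation H cls r s y₁) y
  exact (ENNReal.mul_pos h3.ne' (ENNReal.ofReal_pos.2 (Real.exp_pos _)).ne').ne' hs

/-- One event may lead from `x` to `x'`. -/
def CanMove (𝒥 : OpenNetworkData ι) (x x' : ι → ℕ) : Prop :=
  ∃ c m, 0 < 𝒥.rate c x ∧ 0 < 𝒥.weight c m ∧ moveCustomer c m x = x'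

/-- Induction on the number of customers: one of them is led, service by service, to a node from
which exit has positive probability, while all others stay where they are. -/
lemma reflTransGen_canMove_zero (x : ι → ℕ) : Relation.ReflTransGen 𝒥.CanMove x 0 := by
  classical
  induction hn : ∑ j, x j generalizing x with
  | zero =>
    have : x = 0 := by
      funext j
      exact (Finset.sum_eq_zero_iff.1 hn) j (Finset.mem_univ j)
    rw [this]
  | succ n ih =>
    have : ∃ j, x j ≠ 0 := by
      by_contra hc
      push Not at hc
      simp [hc] at hn
    obtain ⟨j, hj⟩ := this
    obtain ⟨z, rfl⟩ := exists_eq_add_single hj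
    obtain ⟨k, hjk, hk⟩ := 𝒥.can_leave j
    have h1 : Relation.ReflTransGen 𝒥.CanMove (z + Pi.single j 1) (z + Pi.single k 1) := by
      refine Relation.ReflTransGen.lift (fun a => z + Pi.single a 1) (fun a b hab => ?_) _ _ hjk
      refine ⟨.inr a, some b, 𝒥.μ_pos _ _ (by simp), hab, ?_⟩
      exact moveCustomer_transfer a b z
    have h2 : 𝒥.CanMove (z + Pi.single k 1) z := by
      refine ⟨.inr k, none, 𝒥.μ_pos _ _ (by simp), tsub_pos_of_lt hk, ?_⟩
      exact moveCustomer_exit k z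
    refine (h1.tail h2).trans (ih z ?_)
    simp only [Pi.add_apply, Finset.sum_add_distrib] at hn
    simpa using hn

/-- The absence of time windows. -/
def noWindow : ℝ → Option Empty := fun _ => none

lemma isWindowClock_noWindow : IsWindowClock noWindow (fun i _ => i.elim) where
  measurable_cls := measurable_const
  continuous i := i.elim
  zero i := i.elim
  nonneg i := i.elim
  hasDerivAt := ⟨∅, Set.countable_empty, fun _ _ _ i => i.elim⟩

lemma exists_occupation_pos (H : Measure (ι → ℕ)) [SFinite H] {x x' : ι → ℕ} (hx : H {x} ≠ 0)
    (h : Relation.ReflTransGen 𝒥.CanMove x x') :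
    ∃ r, ∀ t, 0 < t → 0 < 𝒥.occupation H noWindow r t (x', 0) := by
  induction h with
  | refl =>
    refine ⟨0, fun t ht => ?_⟩
    rw [𝒥.occupation_zero H ht.le, if_pos rfl]
    exact ENNReal.mul_pos hx (ENNReal.ofReal_pos.2 (Real.exp_pos _)).ne'
  | @tail z z' _ hm ih =>
    obtain ⟨r, hr⟩ := ih
    obtain ⟨c, m, hrate, hw, hmove⟩ := hm
    exact ⟨r + 1, fun t ht => occupation_succ_pos (y := (z, 0)) (y' := (z', 0))
      isWindowClock_noWindow.measurable_cls H hrate hw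
      (fun s => Prod.ext hmove (Subsingleton.elim _ _)) hr ht⟩

end Positivity

section Uniqueness

/-- The measure with point masses `f`. -/
noncomputable def weightMeasure (f : (ι → ℕ) → ℝ≥0∞) : Measure (ι → ℕ) :=
  Measure.count.withDensity f

instance (f : (ι → ℕ) → ℝ≥0∞) : SFinite (weightMeasure f) := by
  unfold weightMeasure; infer_instance

lemma weightMeasure_singleton (f : (ι → ℕ) → ℝ≥0∞) (x : ι → ℕ) : weightMeasure f {x} = f x := by
  rw [weightMeasure, withDensity_apply _ (measurableSet_singleton x), lintegral_singleton,
    Measure.count_singleton, mul_one]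

lemma weightMeasure_univ (f : (ι → ℕ) → ℝ≥0∞) : weightMeasure f Set.univ = ∑' x, f x := by
  rw [weightMeasure, withDensity_apply _ MeasurableSet.univ, Measure.restrict_univ,
    lintegral_count]

variable {α : ι → ℝ≥0} {h : (ι → ℕ) → ℝ≥0}

lemma tsum_occupation_noWindow_le (hα : 𝒥.TrafficEquations α) (hh : 𝒥.IsProductForm α h)
    {H : Measure (ι → ℕ)} [SFinite H] (hH : ∀ x, H {x} ≤ h x) {t : ℝ} (ht : 0 ≤ t) (x : ι → ℕ) :
    ∑' r, 𝒥.occupation H noWindow r t (x, 0) ≤ h x := by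
  have := tsum_occupation_le hα hh isWindowClock_noWindow hH ht (x, 0)
  simpa [counterLaw] using this

/-- A stationary distribution of the network is a multiple of any product form. -/
lemma stationary_eq_productForm (hα : 𝒥.TrafficEquations α) (hh : 𝒥.IsProductForm α h)
    (h0 : h 0 = 1) (π : Measure (ι → ℕ)) [IsProbabilityMeasure π] {t : ℝ} (ht : 0 < t)
    (hπ : ∀ x, ∑' r, 𝒥.occupation π noWindow r t (x, 0) = π {x}) (x : ι → ℕ) :
    π {x} = π {0} * h x := by
  have hcls : Measurable noWindow := isWindowClock_noWindow.measurable_cls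
  -- With this factor, `c * h` and `π` agree at the empty state, since `h 0 = 1`.
  set c : ℝ≥0 := (π {0}).toNNReal with hc
  have hc' : (c : ℝ≥0∞) = π {0} := ENNReal.coe_toNNReal (measure_ne_top _ _)
  have hch : 𝒥.IsProductForm α (fun x => c * h x) := by
    intro x k
    rw [mul_assoc, hh x k, mul_left_comm]
  have htop : ∀ x, π {x} ≠ ∞ := fun x => measure_ne_top _ _
  -- `U` evolves point masses over the time `t`. It is additive, fixes `π`, keeps functions below `c
  -- * h` there, and does not increase total mass.
  let U : ((ι → ℕ) → ℝ≥0∞) → (ι → ℕ) → ℝ≥0∞ := fun f x =>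
    ∑' r, 𝒥.occupation (weightMeasure f) noWindow r t (x, 0)
  have hadd : ∀ f g : (ι → ℕ) → ℝ≥0∞, (∀ x, f x + g x = π {x}) → ∀ x, U f x + U g x = π {x} := by
    intro f g hfg x
    have hm : weightMeasure f + weightMeasure g = π := by
      refine Measure.ext_of_singleton fun x => ?_
      rw [Measure.add_apply, weightMeasure_singleton, weightMeasure_singleton, hfg]
    simp only [U]
    rw [← ENNReal.tsum_add, ← hπ x, ← hm]
    exact tsum_congr fun r => (occupation_add hcls _ _ r t _).symm
  have hle : ∀ f : (ι → ℕ) → ℝ≥0∞, (∀ x, f x ≤ c * h x) → ∀ x, U f x ≤ c * h x := by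
    intro f hf x
    have := tsum_occupation_noWindow_le hα hch (H := weightMeasure f)
      (fun x => by rw [weightMeasure_singleton]; push_cast; exact hf x) ht.le x
    simpa using this
  have hpos : ∀ f : (ι → ℕ) → ℝ≥0∞, U f 0 = 0 → ∀ x, f x = 0 := by
    intro f hf x
    by_contra hx
    obtain ⟨r, hr⟩ := exists_occupation_pos (𝒥 := 𝒥) (weightMeasure f) (x := x)
      (by rwa [weightMeasure_singleton]) (reflTransGen_canMove_zero x)
    exact (hr t ht).ne' (ENNReal.tsum_eq_zero.1 hf r)
  -- The common part of `π` and `c * h`. Both bounds are preserved, so `U w ≤ w`; consequently the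
  -- excess `g = π - w` satisfies `g ≤ U g`.
  let w : (ι → ℕ) → ℝ≥0∞ := fun x => min (π {x}) (c * h x)
  let g : (ι → ℕ) → ℝ≥0∞ := fun x => π {x} - w x
  have hwg : ∀ x, w x + g x = π {x} := fun x => add_tsub_cancel_of_le (min_le_left _ _)
  have hU := hadd w g hwg
  have hUw : ∀ x, U w x ≤ w x := fun x =>
    le_min ((hU x) ▸ le_self_add) (hle w (fun x => min_le_right _ _) x)
  have hwtop : ∀ x, w x ≠ ∞ := fun x => ne_top_of_le_ne_top (htop x) (min_le_left _ _)
  have hgU : ∀ x, g x ≤ U g x := by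
    intro x
    have : w x + g x ≤ w x + U g x := by
      rw [hwg, ← hU x]
      gcongr
      exact hUw x
    exact (ENNReal.add_le_add_iff_left (hwtop x)).1 this
  have hmass : ∑' x, U g x ≤ ∑' x, g x := by
    have h1 := tsum_occupation_le_mass (𝒥 := 𝒥) hcls (weightMeasure g) t
    rw [weightMeasure_univ] at h1
    refine le_trans (le_of_eq ?_) h1
    let e : (ι → ℕ) ≃ Config ι Empty :=
      { toFun := fun x => (x, 0)
        invFun := fun y => y.1
        left_inv := fun _ => rfl
        right_inv := fun y => Prod.ext rfl (Subsingleton.elim _ _) }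
    exact e.tsum_eq (fun y => ∑' r, 𝒥.occupation (weightMeasure g) noWindow r t y)
  have hπsum : ∑' x, π {x} = 1 := by
    have := Measure.tsum_indicator_apply_singleton π Set.univ MeasurableSet.univ
    simpa using this
  have hgtop : ∑' x, g x ≠ ∞ := by
    refine ne_top_of_le_ne_top ENNReal.one_ne_top (le_trans ?_ hπsum.le)
    exact ENNReal.tsum_le_tsum fun x => tsub_le_self
  -- Since `g 0 = 0`, a positive value here would make the finite total mass of `g` grow strictly.
  -- As the empty state is accessible from everywhere, `U g 0 = 0` then forces `g = 0`, that is `π ≤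
  -- c * h`.
  have hUg0 : U g 0 = 0 := by
    have hg0 : g 0 = 0 := by
      simp [g, w, hc', h0]
    by_contra hne
    have hlt : g 0 < U g 0 := by rw [hg0]; exact pos_iff_ne_zero.2 hne
    exact absurd hmass (not_le.2 (ENNReal.tsum_lt_tsum hgtop hgU hlt))
  have hg := hpos g hUg0
  have hπle : ∀ x, π {x} ≤ c * h x := fun x =>
    (tsub_eq_zero_iff_le.1 (hg x)).trans (min_le_right _ _)
  -- The same reasoning for the deficit, now without any summability of `h`: at the empty state `U
  -- (c * h)` is at most `c * h 0 = π {0}`, and `π` alone already contributes that much.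
  let f : (ι → ℕ) → ℝ≥0∞ := fun x => c * h x - π {x}
  have hf : ∀ x, π {x} + f x = c * h x := fun x => add_tsub_cancel_of_le (hπle x)
  have hUf : U f 0 = 0 := by
    have hm : π + weightMeasure f = weightMeasure (fun x => c * h x) := by
      refine Measure.ext_of_singleton fun x => ?_
      rw [Measure.add_apply, weightMeasure_singleton, weightMeasure_singleton, hf]
    have h1 := hle (fun x => c * h x) (fun x => le_rfl) 0
    have h2 : U (fun x => c * h x) 0 = π {0} + U f 0 := by
      simp only [U]
      rw [← hm, ← hπ 0, ← ENNReal.tsum_add]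
      exact tsum_congr fun r => occupation_add hcls _ _ r t _
    rw [h2, h0, ENNReal.coe_one, mul_one, hc'] at h1
    have h3 : π {0} + U f 0 ≤ π {0} + 0 := by rwa [add_zero]
    exact nonpos_iff_eq_zero.1 ((ENNReal.add_le_add_iff_left (htop 0)).1 h3)
  have := hf x
  rw [hpos f hUf x, add_zero, hc'] at this
  exact this

end Uniqueness

end OpenNetworkData

/-! ### Counting events and marks along a stream -/

section Streams

variable {ι : Type*}

/-- The number of events that a stream of requirements and marks completes by level `x`. -/
noncomputable def eventCount (f : ℕ → ℝ × Option ι) (x : ℝ) : ℕ :=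
  renewalCount (fun m => (f m).1) x

/-- The number of those events that carry the mark `a`. -/
noncomputable def markCount (f : ℕ → ℝ × Option ι) (a : Option ι) (x : ℝ) : ℕ :=
  {m : ℕ | m < eventCount f x ∧ (f m).2 = a}.ncard

/-- The requirements are positive and their partial sums are unbounded. -/
structure RegularStream (f : ℕ → ℝ × Option ι) : Prop where
  pos : ∀ m, 0 < (f m).1
  finite : ∀ x, {m : ℕ | ∑ i ∈ Finset.range (m + 1), (f i).1 ≤ x}.Finite

lemma finite_markCount (f : ℕ → ℝ × Option ι) (a : Option ι) (x : ℝ) :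
    {m : ℕ | m < eventCount f x ∧ (f m).2 = a}.Finite :=
  (Set.finite_Iio (eventCount f x)).subset fun _ h => h.1

lemma markCount_eq_zero {f : ℕ → ℝ × Option ι} {x : ℝ} (h : eventCount f x = 0) (a : Option ι) :
    markCount f a x = 0 := by
  simp [markCount, h]

namespace RegularStream

variable {f : ℕ → ℝ × Option ι} (hf : RegularStream f)

include hf

/-- Positive requirements make the set of completed events an initial segment. Its finiteness
matters, because `ncard` would be `0` on an infinite set. -/
lemma lt_eventCount (x : ℝ) (m : ℕ) :
    m < eventCount f x ↔ ∑ i ∈ Finset.range (m + 1), (f i).1 ≤ x := by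
  classical
  have hex : ∃ m, ¬ ∑ i ∈ Finset.range (m + 1), (f i).1 ≤ x := by
    obtain ⟨m, hm⟩ := (hf.finite x).exists_notMem
    exact ⟨m, hm⟩
  have hmono : Monotone fun m => ∑ i ∈ Finset.range (m + 1), (f i).1 :=
    monotone_nat_of_le_succ fun m => by
      rw [Finset.sum_range_succ _ (m + 1)]
      exact le_add_of_nonneg_right (hf.pos _).le
  have hA : {m : ℕ | ∑ i ∈ Finset.range (m + 1), (f i).1 ≤ x} = Set.Iio (Nat.find hex) := by
    ext m
    refine ⟨fun hm => ?_, fun hm => not_not.1 (Nat.find_min hex hm)⟩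
    by_contra hc
    exact Nat.find_spec hex ((hmono (not_lt.1 hc)).trans hm)
  have hc : eventCount f x = Nat.find hex := by
    unfold eventCount renewalCount
    rw [hA, Set.ncard_eq_toFinset_card']
    simp
  rw [hc]
  exact (Set.ext_iff.1 hA m).symm

lemma eventCount_mono : Monotone (eventCount f) := by
  intro x y hxy
  by_contra hc
  have h1 := (hf.lt_eventCount x _).1 (not_le.1 hc)
  exact lt_irrefl _ ((hf.lt_eventCount y _).2 (h1.trans hxy))

lemma markCount_mono (a : Option ι) : Monotone (markCount f a) := fun _ y hxy =>
  Set.ncard_le_ncard (fun _ h => ⟨h.1.trans_le (hf.eventCount_mono hxy), h.2⟩)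
    (finite_markCount f a y)

lemma eventCount_eq_zero {x : ℝ} (h : x < (f 0).1) : eventCount f x = 0 := by
  by_contra hc
  have := (hf.lt_eventCount x 0).1 (Nat.pos_of_ne_zero hc)
  simp only [zero_add, Finset.range_one, Finset.sum_singleton] at this
  exact absurd h (not_lt.2 this)

lemma tail : RegularStream fun m => f (m + 1) where
  pos m := hf.pos _
  finite x := by
    refine Set.Finite.of_finite_image ((hf.finite ((f 0).1 + x)).subset ?_)
      (Nat.succ_injective.injOn (s := _))
    rintro _ ⟨m, hm, rfl⟩
    simp only [Set.mem_ofPred_eq] at hm ⊢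
    rw [Finset.sum_range_succ', add_comm]
    gcongr

/-- The head is completed at level `(f 0).1`, which is reached because `0 ≤ y`; the remaining
partial sums are those of the tail, shifted by it. -/
lemma eventCount_tail {y : ℝ} (hy : 0 ≤ y) :
    eventCount f ((f 0).1 + y) = eventCount (fun m => f (m + 1)) y + 1 := by
  have h1 : ∀ m, m < eventCount f ((f 0).1 + y) ↔
      m < eventCount (fun m => f (m + 1)) y + 1 := by
    intro m
    rw [hf.lt_eventCount]
    cases m with
    | zero => simp [hy]
    | succ m =>
      rw [Nat.add_lt_add_iff_right, hf.tail.lt_eventCount, Finset.sum_range_succ', add_comm]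
      exact add_le_add_iff_left _
  exact le_antisymm (not_lt.1 fun h => absurd ((h1 _).1 h) (lt_irrefl _))
    (not_lt.1 fun h => absurd ((h1 _).2 h) (lt_irrefl _))

open Classical in
lemma markCount_tail (a : Option ι) {y : ℝ} (hy : 0 ≤ y) :
    markCount f a ((f 0).1 + y) =
      (if (f 0).2 = a then 1 else 0) + markCount (fun m => f (m + 1)) a y := by
  have h1 : {m : ℕ | m < eventCount f ((f 0).1 + y) ∧ (f m).2 = a} =
      (if (f 0).2 = a then {0} else ∅) ∪
        Nat.succ '' {m : ℕ | m < eventCount (fun m => f (m + 1)) y ∧ (f (m + 1)).2 = a} := by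
    ext m
    rw [hf.eventCount_tail hy]
    cases m with
    | zero => by_cases h : (f 0).2 = a <;> simp [h]
    | succ m => by_cases h : (f 0).2 = a <;> simp [h]
  unfold markCount
  rw [h1, Set.ncard_union_eq ?_ (by split_ifs <;> simp)
    ((finite_markCount (fun m => f (m + 1)) a y).image _),
    Set.ncard_image_of_injective _ Nat.succ_injective]
  · split_ifs <;> simp
  · rw [Set.disjoint_right]
    rintro _ ⟨m, -, rfl⟩
    split_ifs <;> simp

end RegularStream

lemma sum_reduceHead (a : ℝ) (f : ℕ → ℝ × Option ι) (m : ℕ) :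
    ∑ i ∈ Finset.range (m + 1), (reduceHead a f i).1 =
      ∑ i ∈ Finset.range (m + 1), (f i).1 - a := by
  simp [reduceHead, Finset.sum_sub_distrib]

lemma eventCount_reduceHead (a y : ℝ) (f : ℕ → ℝ × Option ι) :
    eventCount (reduceHead a f) y = eventCount f (a + y) := by
  unfold eventCount renewalCount
  simp only [sum_reduceHead, sub_le_iff_le_add']

lemma markCount_reduceHead (a y : ℝ) (f : ℕ → ℝ × Option ι) (b : Option ι) :
    markCount (reduceHead a f) b y = markCount f b (a + y) := by
  unfold markCount
  simp only [eventCount_reduceHead]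
  rfl

lemma RegularStream.reduced {f : ℕ → ℝ × Option ι} (hf : RegularStream f) {a : ℝ}
    (ha : a < (f 0).1) : RegularStream (reduceHead a f) where
  pos m := by
    simp only [reduceHead]
    split_ifs with h
    · subst h; exact sub_pos.2 ha
    · simpa using hf.pos m
  finite x := by
    simp only [sum_reduceHead, sub_le_iff_le_add]
    exact hf.finite _

end Streams

/-! ### Paths driven by sources follow the construction event by event -/

namespace OpenNetworkData

variable {ι : Type*} [Fintype ι] {𝒥 : OpenNetworkData ι}

/-- A path of queue lengths `N` that is driven by the sources `e`; `L c t` is the amount of work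
that channel `c` has done by time `t`. -/
structure IsPath (𝒥 : OpenNetworkData ι) (N : ℝ≥0 → ι → ℕ) (L : ι ⊕ ι → ℝ≥0 → ℝ)
    (e : Sources ι) : Prop where
  regular : ∀ c, RegularStream (e c)
  right : ∀ t, ∀ᶠ s in 𝓝[>] t, N s = N t
  level_zero : ∀ c, L c 0 = 0
  level_mono : ∀ c, Monotone (L c)
  level_const : ∀ c a b x, a ≤ b → (∀ s, a ≤ s → s < b → N s = x) →
    L c b = L c a + 𝒥.rate c x * (b - a)
  balance : ∀ t j, N t j + eventCount (e (.inr j)) (L (.inr j) t) =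
    N 0 j + eventCount (e (.inl j)) (L (.inl j) t) +
      ∑ k, markCount (e (.inr k)) (some j) (L (.inr k) t)

namespace IsPath

variable {N : ℝ≥0 → ι → ℕ} {L : ι ⊕ ι → ℝ≥0 → ℝ} {e : Sources ι}

lemma level_eq (h : 𝒥.IsPath N L e) {t : ℝ≥0} (ht : ∀ s < t, N s = N 0) (c : ι ⊕ ι) :
    L c t = 𝒥.rate c (N 0) * t := by
  rw [h.level_const c 0 t (N 0) zero_le (fun s _ hs => ht s hs), h.level_zero]
  simp

/-- As long as the state is constant, the work done is too small for any event, so balance leaves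
the state unchanged. A first deviation is excluded at the infimum of the deviating times by this,
and just after it by right continuity. -/
lemma eq_of_noEvent (h : 𝒥.IsPath N L e) {a : ℝ≥0} (ha : 𝒥.NoEvent (N 0) a e) {t : ℝ≥0}
    (ht : t ≤ a) : N t = N 0 := by
  have key : ∀ s ≤ a, (∀ u < s, N u = N 0) → N s = N 0 := by
    intro s hs hu
    have h0 : ∀ c, eventCount (e c) (L c s) = 0 := fun c => by
      refine (h.regular c).eventCount_eq_zero ?_
      rw [h.level_eq hu]
      refine lt_of_le_of_lt ?_ (ha c)
      gcongr
    funext j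
    have := h.balance s j
    simpa [h0, markCount_eq_zero (h0 _)] using this
  by_contra hne
  set S := {u : ℝ≥0 | N u ≠ N 0} with hS
  have hSne : S.Nonempty := ⟨t, hne⟩
  have hlt : ∀ u < sInf S, N u = N 0 := fun u hu => by
    by_contra hc
    exact absurd (csInf_le (OrderBot.bddBelow S) hc) (not_le.2 hu)
  have hσ : N (sInf S) = N 0 :=
    key _ ((csInf_le (OrderBot.bddBelow S) hne).trans ht) hlt
  obtain ⟨b, hb, hb'⟩ := mem_nhdsGT_iff_exists_Ioo_subset.1 (h.right (sInf S))
  obtain ⟨u, hu, hub⟩ := exists_lt_of_csInf_lt hSne hb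
  rcases (csInf_le (OrderBot.bddBelow S) hu).eq_or_lt with h1 | h1
  · exact hu (h1 ▸ hσ)
  · exact hu ((hb' ⟨h1, hub⟩ : N u = N (sInf S)).trans hσ)

lemma eventCount_of_noEvent (h : 𝒥.IsPath N L e) {a : ℝ≥0} (ha : 𝒥.NoEvent (N 0) a e) {t : ℝ≥0}
    (ht : t ≤ a) (c : ι ⊕ ι) : eventCount (e c) (L c t) = 0 := by
  refine (h.regular c).eventCount_eq_zero ?_
  rw [h.level_eq fun s hs => h.eq_of_noEvent ha (hs.le.trans ht)]
  refine lt_of_le_of_lt ?_ (ha c)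
  gcongr

end IsPath

lemma Wins.noEvent {x : ι → ℕ} {e : Sources ι} {c : ι ⊕ ι} (h : 𝒥.Wins x e c) {a : ℝ}
    (ha : a < 𝒥.waiting x e c) : 𝒥.NoEvent x a e := by
  intro c'
  by_cases hc : c' = c
  · subst hc
    have h1 : (0 : ℝ) < 𝒥.rate c' x := h.1
    rwa [waiting, lt_div_iff₀ h1, mul_comm] at ha
  · refine lt_of_le_of_lt ?_ (h.2.2 c' hc)
    gcongr

namespace IsPath

variable {N : ℝ≥0 → ι → ℕ} {L : ι ⊕ ι → ℝ≥0 → ℝ} {e : Sources ι} {c : ι ⊕ ι}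

lemma level_waiting (h : 𝒥.IsPath N L e) (hw : 𝒥.Wins (N 0) e c) (c' : ι ⊕ ι) :
    L c' (𝒥.waiting (N 0) e c).toNNReal = 𝒥.rate c' (N 0) * 𝒥.waiting (N 0) e c := by
  have hpos := hw.waiting_pos
  rw [h.level_eq fun s hs => ?_, Real.coe_toNNReal _ hpos.le]
  exact h.eq_of_noEvent (hw.noEvent (by rwa [Real.lt_toNNReal_iff_coe_lt] at hs)) le_rfl

lemma level_waiting_self (h : 𝒥.IsPath N L e) (hw : 𝒥.Wins (N 0) e c) :
    L c (𝒥.waiting (N 0) e c).toNNReal = (e c 0).1 := by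
  have h1 : (0 : ℝ) < 𝒥.rate c (N 0) := hw.1
  rw [h.level_waiting hw, waiting, mul_div_cancel₀ _ h1.ne']

/-- The amount of work that is done after the first event. -/
noncomputable def laterLevel (L : ι ⊕ ι → ℝ≥0 → ℝ) (τ : ℝ≥0) : ι ⊕ ι → ℝ≥0 → ℝ :=
  fun c s => L c (τ + s) - L c τ

open Classical in
-- At the waiting time the winner has worked off exactly its head, which is dropped; every other
-- channel has used up part of its head, which is reduced.
lemma eventCount_after (h : 𝒥.IsPath N L e) (hw : 𝒥.Wins (N 0) e c) (c' : ι ⊕ ι) (s : ℝ≥0) :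
    eventCount (e c') (L c' ((𝒥.waiting (N 0) e c).toNNReal + s)) = (if c = c' then 1 else 0) +
      eventCount (𝒥.shiftSources (N 0) c (𝒥.waiting (N 0) e c) e c')
        (laterLevel L (𝒥.waiting (N 0) e c).toNNReal c' s) := by
  set τ := (𝒥.waiting (N 0) e c).toNNReal with hτ
  have h1 : L c' (τ + s) = L c' τ + laterLevel L τ c' s := by simp [laterLevel]
  have h0 : 0 ≤ laterLevel L τ c' s := sub_nonneg.2 (h.level_mono c' le_self_add)
  by_cases hc : c = c'
  · subst hc
    rw [h1, h.level_waiting_self hw, (h.regular c).eventCount_tail h0]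
    simp [shiftSources, add_comm]
  · rw [h1, h.level_waiting hw]
    simp only [shiftSources, if_neg hc, if_neg (Ne.symm hc), eventCount_reduceHead, zero_add]

open Classical in
lemma markCount_after (h : 𝒥.IsPath N L e) (hw : 𝒥.Wins (N 0) e c) (c' : ι ⊕ ι) (a : Option ι)
    (s : ℝ≥0) :
    markCount (e c') a (L c' ((𝒥.waiting (N 0) e c).toNNReal + s)) =
      (if c = c' ∧ (e c 0).2 = a then 1 else 0) +
      markCount (𝒥.shiftSources (N 0) c (𝒥.waiting (N 0) e c) e c') a
        (laterLevel L (𝒥.waiting (N 0) e c).toNNReal c' s) := by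
  set τ := (𝒥.waiting (N 0) e c).toNNReal with hτ
  have h1 : L c' (τ + s) = L c' τ + laterLevel L τ c' s := by simp [laterLevel]
  have h0 : 0 ≤ laterLevel L τ c' s := sub_nonneg.2 (h.level_mono c' le_self_add)
  by_cases hc : c = c'
  · subst hc
    rw [h1, h.level_waiting_self hw, (h.regular c).markCount_tail a h0]
    simp [shiftSources]
  · rw [h1, h.level_waiting hw]
    simp [shiftSources, hc, Ne.symm hc, markCount_reduceHead]

lemma regular_after (h : 𝒥.IsPath N L e) (hw : 𝒥.Wins (N 0) e c) (c' : ι ⊕ ι) :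
    RegularStream (𝒥.shiftSources (N 0) c (𝒥.waiting (N 0) e c) e c') := by
  by_cases hc : c' = c
  · subst hc
    simpa [shiftSources] using (h.regular c').tail
  · simpa [shiftSources, hc] using (h.regular c').reduced (hw.2.2 c' hc)

lemma eventCount_zero_after (h : 𝒥.IsPath N L e) (hw : 𝒥.Wins (N 0) e c) (c' : ι ⊕ ι) :
    eventCount (𝒥.shiftSources (N 0) c (𝒥.waiting (N 0) e c) e c')
        (laterLevel L (𝒥.waiting (N 0) e c).toNNReal c' 0) = 0 := by
  refine (h.regular_after hw c').eventCount_eq_zero ?_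
  simp only [laterLevel, add_zero, sub_self]
  exact (h.regular_after hw c').pos 0

open Classical in
-- At the first event time the shifted sources have completed nothing, since their heads are
-- positive. Balance then sees the event of the winner alone.
lemma balance_waiting (h : 𝒥.IsPath N L e) (hw : 𝒥.Wins (N 0) e c) (j : ι) :
    N (𝒥.waiting (N 0) e c).toNNReal j + (if c = .inr j then 1 else 0) =
      N 0 j + (if c = .inl j then 1 else 0) +
        ∑ k : ι, if c = .inr k ∧ (e c 0).2 = some j then 1 else 0 := by
  have h1 := h.balance ((𝒥.waiting (N 0) e c).toNNReal + 0) j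
  simp only [h.eventCount_after hw, h.markCount_after hw] at h1
  simp only [h.eventCount_zero_after hw, markCount_eq_zero (h.eventCount_zero_after hw _),
    add_zero] at h1
  exact h1

lemma state_waiting (h : 𝒥.IsPath N L e) (hw : 𝒥.Wins (N 0) e c) :
    N (𝒥.waiting (N 0) e c).toNNReal = moveCustomer c (e c 0).2 (N 0) := by
  classical
  funext j
  have h1 := h.balance_waiting hw j
  simp only [moveCustomer]
  rcases c with i | i
  · simp at h1 ⊢
    exact h1
  · have h2 : ∑ k : ι, (if (Sum.inr i : ι ⊕ ι) = .inr k ∧ (e (.inr i) 0).2 = some j then 1 else 0) =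
        if (e (.inr i) 0).2 = some j then 1 else 0 := by
      simp [ite_and]
    rw [h2] at h1
    simp at h1 ⊢
    omega

/-- Regeneration of a single path: it permits induction over the events. -/
lemma after (h : 𝒥.IsPath N L e) (hw : 𝒥.Wins (N 0) e c) :
    𝒥.IsPath (fun s => N ((𝒥.waiting (N 0) e c).toNNReal + s))
      (laterLevel L (𝒥.waiting (N 0) e c).toNNReal)
      (𝒥.shiftSources (N 0) c (𝒥.waiting (N 0) e c) e) where
  regular := h.regular_after hw
  right t := by
    have h1 : Tendsto (fun s => (𝒥.waiting (N 0) e c).toNNReal + s) (𝓝[>] t)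
        (𝓝[>] ((𝒥.waiting (N 0) e c).toNNReal + t)) := by
      refine tendsto_nhdsWithin_of_tendsto_nhds_of_eventually_within _ ?_ ?_
      · exact ((continuous_const.add continuous_id).tendsto t).mono_left nhdsWithin_le_nhds
      · filter_upwards [self_mem_nhdsWithin] with s hs
        exact add_lt_add_right (Set.mem_Ioi.1 hs) _
    exact h1.eventually (h.right _)
  level_zero c' := by simp [laterLevel]
  level_mono c' s s' hs := by
    simp only [laterLevel]
    exact sub_le_sub_right (h.level_mono c' (by gcongr)) _
  level_const c' a b x hab hx := by
    simp only [laterLevel]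
    rw [h.level_const c' ((𝒥.waiting (N 0) e c).toNNReal + a)
      ((𝒥.waiting (N 0) e c).toNNReal + b) x (by gcongr)]
    · push_cast; ring
    · intro s hs hs'
      have h1 : (𝒥.waiting (N 0) e c).toNNReal ≤ s := le_self_add.trans hs
      have := hx (s - (𝒥.waiting (N 0) e c).toNNReal) (le_tsub_of_add_le_left hs)
        ((tsub_lt_iff_left h1).2 hs')
      rwa [add_tsub_cancel_of_le h1] at this
  balance t j := by
    classical
    -- The balance after the first event is the difference of the balances at `τ + t` and at `τ`.
    have h1 := h.balance ((𝒥.waiting (N 0) e c).toNNReal + t) j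
    have h2 := h.balance_waiting hw j
    simp only [h.eventCount_after hw, h.markCount_after hw, Finset.sum_add_distrib] at h1
    simp only [add_zero]
    omega

variable {I : Type*} {cls : ℝ → Option I} {b b' : I → ℝ}

open Classical in
-- For times `s` before the first event the argument `s - τ` is truncated to `0`, where the later
-- counts vanish, and so does the left side.
lemma exits_after (h : 𝒥.IsPath N L e) (hw : 𝒥.Wins (N 0) e c) (k : ι) (s : ℝ) :
    markCount (e (.inr k)) none (L (.inr k) s.toNNReal) =
      (if 𝒥.waiting (N 0) e c ≤ s ∧ c = .inr k ∧ (e c 0).2 = none then 1 else 0) +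
      markCount (𝒥.shiftSources (N 0) c (𝒥.waiting (N 0) e c) e (.inr k)) none
        (laterLevel L (𝒥.waiting (N 0) e c).toNNReal (.inr k)
          (s - 𝒥.waiting (N 0) e c).toNNReal) := by
  have hpos := hw.waiting_pos
  by_cases hc : 𝒥.waiting (N 0) e c ≤ s
  · have h1 : s.toNNReal =
        (𝒥.waiting (N 0) e c).toNNReal + (s - 𝒥.waiting (N 0) e c).toNNReal := by
      rw [← Real.toNNReal_add hpos.le (sub_nonneg.2 hc)]
      congr 1
      ring
    rw [h1, h.markCount_after hw]
    simp [hc]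
  · push Not at hc
    rw [Real.toNNReal_of_nonpos (sub_nonpos.2 hc.le),
      markCount_eq_zero (h.eventCount_zero_after hw _), if_neg (fun h => absurd hc (not_lt.2 h.1))]
    refine markCount_eq_zero (h.eventCount_of_noEvent (a := s.toNNReal) (hw.noEvent ?_) le_rfl _) _
    rw [Real.coe_toNNReal']
    exact max_lt hc hpos

/-- Induction on a bound for the number of events of all channels up to `t`. The path and the
starting stage are both arbitrary, because after one event the shifted path starts from the next
stage; window endpoints remain in absolute time. -/
lemma exists_iterate_occupied_of_lt (hcls : ∀ s i, cls s = some i ↔ b i < s ∧ s ≤ b' i)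
    (hb : ∀ i, b i ≤ b' i) (n : ℕ) :
    ∀ (N : ℝ≥0 → ι → ℕ) (L : ι ⊕ ι → ℝ≥0 → ℝ) (z : (Config ι I × ℝ) × Sources ι) (t : ℝ≥0),
      𝒥.IsPath N L z.2 → z.1.1.1 = N 0 → ∑ c, eventCount (z.2 c) (L c t) < n →
      (∀ r, ∃ c, 𝒥.Wins ((𝒥.step cls)^[r] z).1.1.1 ((𝒥.step cls)^[r] z).2 c) →
      (∀ i, b' i ≤ z.1.2 + t) →
      ∃ r, (𝒥.step cls)^[r] z ∈ 𝒥.occupied (z.1.2 + t) (N t, fun k i => z.1.1.2 k i +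
        (markCount (z.2 (.inr k)) none (L (.inr k) (b' i - z.1.2).toNNReal) -
          markCount (z.2 (.inr k)) none (L (.inr k) (b i - z.1.2).toNNReal))) := by
  classical
  induction n with
  | zero => intro N L z t _ _ hn; exact absurd hn (Nat.not_lt_zero _)
  | succ n ih =>
    intro N L z t h hz hn hwin hT
    obtain ⟨c, hc⟩ := hwin 0
    rw [Function.iterate_zero, id_eq, hz] at hc
    have hpos := hc.waiting_pos
    rcases lt_or_ge (t : ℝ) (𝒥.waiting (N 0) z.2 c) with hlt | hge
    · have hno := hc.noEvent hlt
      -- No event happens by time `t`, and all windows end by then.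
      have h0 : ∀ k i, markCount (z.2 (.inr k)) none (L (.inr k) (b' i - z.1.2).toNNReal) = 0 :=
        fun k i => markCount_eq_zero (h.eventCount_of_noEvent hno
          (Real.toNNReal_le_iff_le_coe.2 (by linarith [hT i])) _) _
      refine ⟨0, ?_, by simp, ?_⟩
      · simp only [Function.iterate_zero, id_eq, h0, Nat.zero_sub, add_zero,
          h.eq_of_noEvent hno le_rfl, ← hz]
      · simpa [hz] using hno
    · set τ := 𝒥.waiting (N 0) z.2 c with hτ
      have hτt : τ.toNNReal ≤ t := Real.toNNReal_le_iff_le_coe.2 hge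
      have hstep : 𝒥.step cls z = 𝒥.eventState cls c z := step_of_wins (by rwa [hz])
      have hT' : (𝒥.step cls z).1.2 = z.1.2 + τ := by rw [hstep, eventState, hz]
      have hsrc : (𝒥.step cls z).2 = 𝒥.shiftSources (N 0) c τ z.2 := by
        rw [hstep, eventState, hz]
      have htime : (𝒥.step cls z).1.2 + ((t - τ.toNNReal : ℝ≥0) : ℝ) = z.1.2 + t := by
        rw [hT', NNReal.coe_sub hτt, Real.coe_toNNReal _ hpos.le]
        ring
      have hcount := fun c' => h.eventCount_after hc c' (t - τ.toNNReal)
      rw [← hτ, add_tsub_cancel_of_le hτt, ← hsrc] at hcount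
      obtain ⟨r, hr⟩ := ih (fun s => N (τ.toNNReal + s)) (laterLevel L τ.toNNReal)
        (𝒥.step cls z) (t - τ.toNNReal) (by rw [hsrc]; exact h.after hc)
        (by rw [hstep, eventState]
            simp only [jump, hz, add_zero]
            exact (h.state_waiting hc).symm)
        (by
          simp only [hcount, Finset.sum_add_distrib, Finset.sum_ite_eq, Finset.mem_univ,
            if_true] at hn
          omega)
        (fun r => hwin (r + 1)) (fun i => by rw [htime]; exact hT i)
      refine ⟨r + 1, ?_⟩
      rw [Function.iterate_succ_apply]
      rw [htime] at hr
      convert hr using 2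
      refine Prod.ext ?_ ?_
      · simp [add_tsub_cancel_of_le hτt]
      · funext k i
        simp only [h.exits_after hc k, ← hτ]
        rw [hT', hsrc, hstep, eventState]
        simp only [jump, hz, ← hτ, hcls, sub_sub]
        -- Monotonicity makes the natural subtraction of the two later counts exact.
        have hmono := ((h.after hc).regular (.inr k)).markCount_mono none
          ((h.after hc).level_mono (.inr k) (Real.toNNReal_le_toNNReal
            (sub_le_sub_right (hb i) (z.1.2 + τ))))
        simp only [← hτ] at hmono
        have hbi := hb i
        have e1 : τ ≤ b' i - z.1.2 ↔ z.1.2 + τ ≤ b' i := le_sub_iff_add_le'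
        have e2 : τ ≤ b i - z.1.2 ↔ z.1.2 + τ ≤ b i := le_sub_iff_add_le'
        simp only [e1, e2]
        revert hmono
        generalize markCount (𝒥.shiftSources (N 0) c τ z.2 (.inr k)) none
          (laterLevel L τ.toNNReal (.inr k) (b i - (z.1.2 + τ)).toNNReal) = u
        generalize markCount (𝒥.shiftSources (N 0) c τ z.2 (.inr k)) none
          (laterLevel L τ.toNNReal (.inr k) (b' i - (z.1.2 + τ)).toNNReal) = u'
        intro hmono
        -- If the first event is an exit from `k`, it enters both counts when it precedes the
        -- window, neither when it follows the window, and only the one at the right endpoint when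
        -- it lies in `(b i, b' i]`, which is when `jump` records it.
        by_cases hA : c = .inr k ∧ (z.2 c 0).2 = none
        · have h3 : ∀ q : Prop, (q ∧ c = .inr k ∧ (z.2 c 0).2 = none) ↔ q :=
            fun q => and_iff_left hA
          have h4 : ∀ q : Prop, (c = .inr k ∧ (z.2 c 0).2 = none ∧ q) ↔ q :=
            fun q => ⟨fun hq => hq.2.2, fun hq => ⟨hA.1, hA.2, hq⟩⟩
          simp only [h3, h4]
          by_cases h1 : z.1.2 + τ ≤ b i
          · simp only [h1, h1.trans hbi, not_lt.2 h1, if_true, false_and, if_false]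
            omega
          · by_cases h2 : z.1.2 + τ ≤ b' i
            · simp only [h1, h2, not_le.1 h1, if_true, true_and, if_false]
              omega
            · simp only [h1, h2, and_false, if_false]
              omega
        · have h3 : ∀ q : Prop, ¬ (q ∧ c = .inr k ∧ (z.2 c 0).2 = none) := fun q hq => hA hq.2
          have h4 : ∀ q : Prop, ¬ (c = .inr k ∧ (z.2 c 0).2 = none ∧ q) :=
            fun q hq => hA ⟨hq.1, hq.2.1⟩
          simp only [h3, h4, if_false]
          omega

/-- The construction event by event arrives at the state of the path at time `t`, having counted its
exits in the windows. -/
lemma exists_iterate_occupied (h : 𝒥.IsPath N L e)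
    (hcls : ∀ s i, cls s = some i ↔ b i < s ∧ s ≤ b' i) (hb : ∀ i, b i ≤ b' i) {t : ℝ≥0}
    (hT : ∀ i, b' i ≤ t)
    (hwin : ∀ r, ∃ c, 𝒥.Wins ((𝒥.step cls)^[r] (((N 0, fun _ _ => 0), 0), e)).1.1.1
      ((𝒥.step cls)^[r] (((N 0, fun _ _ => 0), 0), e)).2 c) :
    ∃ r, (𝒥.step cls)^[r] (((N 0, fun _ _ => 0), 0), e) ∈ 𝒥.occupied t (N t, fun k i =>
      markCount (e (.inr k)) none (L (.inr k) (b' i).toNNReal) -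
        markCount (e (.inr k)) none (L (.inr k) (b i).toNNReal)) := by
  obtain ⟨r, hr⟩ := exists_iterate_occupied_of_lt hcls hb _ N L (((N 0, fun _ _ => 0), 0), e) t h
    rfl (Nat.lt_succ_self _) hwin (by simpa using hT)
  refine ⟨r, ?_⟩
  simpa only [zero_add, sub_zero] using hr

end IsPath

end OpenNetworkData

/-! ### The joint law of the initial state and the sources -/

/-- Families of members of an independent family, indexed by disjoint sets, are independent. -/
lemma iIndepFun_curry {Ω S : Type*} {κ : S → Type*} {β : (i : S) → κ i → Type*}
    [∀ i j, MeasurableSpace (β i j)] [MeasurableSpace Ω] {P : Measure Ω}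
    {Y : (i : S) → (j : κ i) → Ω → β i j} (hY : ∀ i j, Measurable (Y i j))
    (h : iIndepFun (fun (p : (i : S) × κ i) => Y p.1 p.2) P) :
    iIndepFun (fun i ω (j : κ i) => Y i j ω) P := by
  have := h.isProbabilityMeasure
  have : ∀ i j, IsProbabilityMeasure (P.map (Y i j)) :=
    fun i j ↦ Measure.isProbabilityMeasure_map (hY i j).aemeasurable
  have h1 : (MeasurableEquiv.piCurry β) ∘ (fun ω (p : (i : S) × κ i) ↦ Y p.1 p.2 ω) =
      fun ω i j ↦ Y i j ω := by
    ext; simp [Sigma.curry]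
  have h2 : ∀ i, iIndepFun (fun j => Y i j) P := fun i =>
    h.precomp (g := fun j => (⟨i, j⟩ : (i : S) × κ i)) (sigma_mk_injective)
  rw [iIndepFun_iff_map_fun_eq_infinitePi_map (by fun_prop), ← h1,
    ← Measure.map_map (by fun_prop) (by fun_prop), h.map_fun_eq_infinitePi_map (by fun_prop),
    Measure.infinitePi_map_piCurry (fun i j => P.map (Y i j))]
  congr 1
  funext i
  exact ((h2 i).map_fun_eq_infinitePi_map (hY i)).symm

/-- Groups of members of an independent family are independent. -/
lemma iIndepFun_fiber {Ω S T G : Type*} [MeasurableSpace T] [MeasurableSpace Ω] {P : Measure Ω}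
    {Y : S → Ω → T} (hY : ∀ s, Measurable (Y s)) (h : iIndepFun Y P) (grp : S → G) :
    iIndepFun (fun g ω (s : {s // grp s = g}) => Y s ω) P :=
  iIndepFun_curry (Y := fun g (s : {s // grp s = g}) => Y s) (fun _ s => hY s)
    (h.precomp (Equiv.sigmaFiberEquiv grp).injective)

namespace OpenJacksonNetwork

variable {ι : Type*} [Fintype ι] {𝒥 : OpenNetworkData ι}
  {Ω : Type*} [MeasurableSpace Ω] {P : Measure Ω}

/-- The requirements and marks of the events of each channel. -/
def sources (X : OpenJacksonNetwork 𝒥 P) (ω : Ω) : Sources ι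
  | .inl j, m => (X.arrivalGap j m ω, none)
  | .inr j, m => (X.requirement j m ω, X.route j m ω)

/-- All the random sources, with values in a common space. -/
def primitive (X : OpenJacksonNetwork 𝒥 P) : RandomSource ι → Ω → (ι → ℕ) × ℝ × Option ι
  | .init => fun ω => (X.N 0 ω, 0, none)
  | .arrival j m => fun ω => (0, X.arrivalGap j m ω, none)
  | .service j m => fun ω => (0, X.requirement j m ω, none)
  | .routing j m => fun ω => (0, 0, X.route j m ω)

lemma measurable_route' (X : OpenJacksonNetwork 𝒥 P) (j : ι) (m : ℕ) : Measurable (X.route j m) :=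
  measurable_to_countable' fun x => X.measurable_route j m x

lemma measurable_primitive (X : OpenJacksonNetwork 𝒥 P) (s : RandomSource ι) :
    Measurable (X.primitive s) := by
  have h1 := X.measurable_N
  have h2 := X.measurable_arrivalGap
  have h3 := X.measurable_requirement
  have h4 := X.measurable_route'
  cases s <;> simp only [primitive] <;> fun_prop

/-- Padding with constants adds no information, so independence of the generated σ-algebras carries
over to variables with values in one common space. -/
lemma iIndepFun_primitive (X : OpenJacksonNetwork 𝒥 P) : iIndepFun X.primitive P := by
  rw [iIndepFun_iff_iIndep]
  refine iIndep_of_iIndep_of_le X.indep fun s => ?_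
  cases s with
  | init =>
    exact Measurable.comap_le (m₁ := MeasurableSpace.comap (X.N 0) inferInstance)
      (Measurable.prodMk (comap_measurable _) measurable_const)
  | arrival j m =>
    exact Measurable.comap_le (m₁ := MeasurableSpace.comap (X.arrivalGap j m) inferInstance)
      (Measurable.prodMk measurable_const
        (Measurable.prodMk (comap_measurable _) measurable_const))
  | service j m =>
    exact Measurable.comap_le (m₁ := MeasurableSpace.comap (X.requirement j m) inferInstance)
      (Measurable.prodMk measurable_const
        (Measurable.prodMk (comap_measurable _) measurable_const))
  | routing j m =>
    exact Measurable.comap_le (m₁ := MeasurableSpace.comap (X.route j m) ⊤)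
      (Measurable.prodMk measurable_const
        (Measurable.prodMk measurable_const (comap_measurable _)))

/-- The initial state, or the requirement and the mark of an event of some channel. -/
def combined (X : OpenJacksonNetwork 𝒥 P) :
    Option ((ι ⊕ ι) × ℕ) → Ω → (ι → ℕ) × ℝ × Option ι
  | none => fun ω => (X.N 0 ω, 0, none)
  | some (c, m) => fun ω => (0, X.sources ω c m)

/-- The event to which a random source belongs, if any. -/
def eventOf : RandomSource ι → Option ((ι ⊕ ι) × ℕ)
  | .init => none
  | .arrival j m => some (.inl j, m)
  | .service j m => some (.inr j, m)
  | .routing j m => some (.inr j, m)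

lemma measurable_combined (X : OpenJacksonNetwork 𝒥 P) (g : Option ((ι ⊕ ι) × ℕ)) :
    Measurable (X.combined g) := by
  have h1 := X.measurable_N
  have h2 := X.measurable_arrivalGap
  have h3 := X.measurable_requirement
  have h4 := X.measurable_route'
  match g with
  | none => simp only [combined]; fun_prop
  | some (.inl j, m) => simp only [combined, sources]; fun_prop
  | some (.inr j, m) => simp only [combined, sources]; fun_prop

/-- Each requirement is grouped with the routing decision of the same event; groups over disjoint
sets of sources remain independent. -/
lemma iIndepFun_combined (X : OpenJacksonNetwork 𝒥 P) : iIndepFun X.combined P := by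
  let φ : (g : Option ((ι ⊕ ι) × ℕ)) → ({s : RandomSource ι // eventOf s = g} →
      (ι → ℕ) × ℝ × Option ι) → (ι → ℕ) × ℝ × Option ι := fun g =>
    match g with
    | none => fun v => v ⟨.init, rfl⟩
    | some (.inl j, m) => fun v => v ⟨.arrival j m, rfl⟩
    | some (.inr j, m) => fun v => (0, (v ⟨.service j m, rfl⟩).2.1, (v ⟨.routing j m, rfl⟩).2.2)
  have hφ : ∀ g, Measurable (φ g) := fun g =>
    match g with
    | none => measurable_pi_apply _
    | some (.inl j, m) => measurable_pi_apply _
    | some (.inr j, m) => by simp only [φ]; fun_prop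
  have := (iIndepFun_fiber X.measurable_primitive X.iIndepFun_primitive eventOf).comp φ hφ
  convert this using 2 with g
  match g with
  | none => rfl
  | some (.inl j, m) => rfl
  | some (.inr j, m) => rfl

lemma indepFun_initial_sources (X : OpenJacksonNetwork 𝒥 P) :
    IndepFun (X.N 0) (fun ω (p : (ι ⊕ ι) × ℕ) => X.sources ω p.1 p.2) P := by
  have h := (iIndepFun_fiber X.measurable_combined X.iIndepFun_combined Option.isSome).indepFun
    (i := false) (j := true) (by simp)
  refine h.comp (φ := fun v => (v ⟨none, rfl⟩).1) (ψ := fun v p => (v ⟨some p, rfl⟩).2)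
    ?_ ?_
  · fun_prop
  · fun_prop

lemma measurable_sources (X : OpenJacksonNetwork 𝒥 P) : Measurable X.sources := by
  refine measurable_pi_lambda _ fun c => measurable_pi_lambda _ fun m => ?_
  exact measurable_snd.comp (X.measurable_combined (some (c, m)))

lemma map_route [IsProbabilityMeasure P] (X : OpenJacksonNetwork 𝒥 P) (j : ι) (m : ℕ) :
    P.map (X.route j m) = 𝒥.markLaw (.inr j) := by
  classical
  refine Measure.ext_of_singleton fun x => ?_
  rw [Measure.map_apply (X.measurable_route' j m) (measurableSet_singleton x),
    ← lintegral_indicator_one (measurableSet_singleton x), OpenNetworkData.lintegral_markLaw,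
    Finset.sum_eq_single x]
  · cases x with
    | none =>
      refine (X.law_route_none j m).trans ?_
      simp [OpenNetworkData.weight]
    | some k =>
      refine (X.law_route_some j m k).trans ?_
      simp [OpenNetworkData.weight]
  · intro b _ hb
    simp [hb]
  · simp

lemma map_sources_apply [IsProbabilityMeasure P] (X : OpenJacksonNetwork 𝒥 P) (c : ι ⊕ ι) (m : ℕ) :
    P.map (fun ω => X.sources ω c m) = 𝒥.unitLaw c := by
  classical
  rcases c with j | j
  · have h1 : 𝒥.markLaw (.inl j) = Measure.dirac none := by
      simp [OpenNetworkData.markLaw, OpenNetworkData.weight, Fintype.sum_option]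
    have h2 : P.map (fun ω => X.sources ω (.inl j) m) =
        (P.map (X.arrivalGap j m)).map (fun x => (x, (none : Option ι))) := by
      rw [Measure.map_map (by fun_prop) (X.measurable_arrivalGap j m)]
      rfl
    rw [h2, (X.law_arrivalGap j m).map_eq, OpenNetworkData.unitLaw, h1, Measure.prod_dirac]
  · have h0 := X.iIndepFun_primitive.indepFun (i := .service j m) (j := .routing j m) (by simp)
    have h1 : IndepFun (X.requirement j m) (X.route j m) P := h0.comp
      (measurable_fst.comp measurable_snd : Measurable fun v : (ι → ℕ) × ℝ × Option ι => v.2.1)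
      (measurable_snd.comp measurable_snd : Measurable fun v : (ι → ℕ) × ℝ × Option ι => v.2.2)
    have h2 := h1.map_prod_eq_prod_map_map (X.measurable_requirement j m).aemeasurable
      (X.measurable_route' j m).aemeasurable
    rw [(X.law_requirement j m).map_eq, X.map_route] at h2
    exact h2

lemma map_sources [IsProbabilityMeasure P] (X : OpenJacksonNetwork 𝒥 P) :
    P.map X.sources = 𝒥.sourceLaw := by
  have h1 : iIndepFun (fun (p : (ι ⊕ ι) × ℕ) ω => X.sources ω p.1 p.2) P :=
    (X.iIndepFun_combined.precomp (Option.some_injective _)).comp (fun _ v => v.2)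
      (fun _ => measurable_snd)
  have hm : ∀ p : (ι ⊕ ι) × ℕ, Measurable (fun ω => X.sources ω p.1 p.2) := fun p => by
    have := X.measurable_sources
    fun_prop
  have h2 := h1.map_fun_eq_infinitePi_map hm
  simp only [X.map_sources_apply] at h2
  rw [OpenNetworkData.sourceLaw, ← Measure.infinitePi_eq_pi]
  unfold OpenNetworkData.streamLaw
  rw [← Measure.infinitePi_map_curry (fun c (_ : ℕ) => 𝒥.unitLaw c), ← h2,
    Measure.map_map (by fun_prop) (measurable_pi_lambda _ hm)]
  rfl

lemma map_initial_sources [IsProbabilityMeasure P] (X : OpenJacksonNetwork 𝒥 P) :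
    P.map (fun ω => (X.N 0 ω, X.sources ω)) = (P.map (X.N 0)).prod 𝒥.sourceLaw := by
  have h : IndepFun (X.N 0) X.sources P := X.indepFun_initial_sources.comp measurable_id
    (by fun_prop : Measurable fun (v : (ι ⊕ ι) × ℕ → ℝ × Option ι) c m => v (c, m))
  rw [h.map_prod_eq_prod_map_map (X.measurable_N 0).aemeasurable
    X.measurable_sources.aemeasurable, X.map_sources]

end OpenJacksonNetwork

/-! ### Almost sure regularity of the sources and of the paths -/

lemma regularStream_of_frequently {ι : Type*} {f : ℕ → ℝ × Option ι} (hpos : ∀ m, 0 < (f m).1)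
    (h : {m | 1 < (f m).1}.Infinite) : RegularStream f where
  pos := hpos
  finite x := by
    obtain ⟨n, hn⟩ := exists_nat_gt x
    obtain ⟨B, hB, hcard⟩ := h.exists_subset_card_eq n
    obtain ⟨M, hM⟩ := B.exists_nat_subset_range
    refine (Set.finite_Iio M).subset fun m hm => ?_
    by_contra hc
    rw [Set.mem_Iio, not_lt] at hc
    have h1 : (n : ℝ) ≤ ∑ i ∈ B, (f i).1 := by
      have := Finset.card_nsmul_le_sum B (fun i => (f i).1) 1 fun i hi => (hB hi).le
      simpa [hcard] using this
    have h2 : ∑ i ∈ B, (f i).1 ≤ ∑ i ∈ Finset.range (m + 1), (f i).1 :=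
      Finset.sum_le_sum_of_subset_of_nonneg
        (hM.trans (Finset.range_subset_range.2 (by omega))) fun i _ _ => (hpos i).le
    rw [Set.mem_ofPred_eq] at hm
    linarith

namespace OpenNetworkData

variable {ι : Type*} [Fintype ι] {𝒥 : OpenNetworkData ι}

/-- The requirements exceed `1` independently with the same positive probability, so by the second
Borel–Cantelli lemma infinitely many do, and the partial sums are unbounded. -/
lemma ae_regularStream (c : ι ⊕ ι) : ∀ᵐ f ∂𝒥.streamLaw c, RegularStream f := by
  have hmap : ∀ m, (𝒥.streamLaw c).map (fun f => f m) = 𝒥.unitLaw c := fun m =>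
    Measure.infinitePi_map_eval _ m
  have hfst : (𝒥.unitLaw c).map Prod.fst = expMeasure 1 := by
    rw [unitLaw, Measure.map_fst_prod, measure_univ, one_smul]
  have hpos : ∀ᵐ f ∂𝒥.streamLaw c, ∀ m, 0 < (f m).1 := by
    rw [ae_all_iff]
    intro m
    have h1 := ae_pos_expMeasure_one
    rw [← hfst] at h1
    have h2 := ae_of_ae_map measurable_fst.aemeasurable h1
    rw [← hmap m] at h2
    exact ae_of_ae_map (measurable_pi_apply m).aemeasurable h2
  have hind : iIndepFun (fun m (f : ℕ → ℝ × Option ι) => (f m).1) (𝒥.streamLaw c) :=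
    iIndepFun_infinitePi (P := fun _ : ℕ => 𝒥.unitLaw c) (X := fun _ => Prod.fst)
      (fun _ => measurable_fst)
  have hA : ∀ m : ℕ, MeasurableSet {f : ℕ → ℝ × Option ι | 1 < (f m).1} := fun m =>
    measurableSet_lt measurable_const (by fun_prop)
  have hset : iIndepSet (fun m => {f : ℕ → ℝ × Option ι | 1 < (f m).1}) (𝒥.streamLaw c) := by
    rw [iIndepSet_iff_meas_biInter hA]
    intro s
    exact hind.measure_inter_preimage_eq_mul s (sets := fun _ => Set.Ioi 1)
      (fun _ _ => measurableSet_Ioi)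
  have hmeas : ∀ m : ℕ, 𝒥.streamLaw c {f | 1 < (f m).1} = 𝒥.streamLaw c {f | 1 < (f 0).1} := by
    intro m
    have h1 : ∀ m : ℕ, 𝒥.streamLaw c {f | 1 < (f m).1} = 𝒥.unitLaw c {a | 1 < a.1} := by
      intro m
      rw [← hmap m, Measure.map_apply (measurable_pi_apply m)
        (measurableSet_lt measurable_const measurable_fst)]
      rfl
    rw [h1, h1]
  have hsum : ∑' m : ℕ, 𝒥.streamLaw c {f | 1 < (f m).1} = ∞ := by
    simp only [hmeas, 𝒥.streamLaw_head_gt c zero_le_one]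
    exact ENNReal.tsum_const_eq_top_of_ne_zero (ENNReal.ofReal_pos.2 (Real.exp_pos _)).ne'
  have hlim := measure_limsup_eq_one hA hset hsum
  rw [← mem_ae_iff_prob_eq_one (MeasurableSet.measurableSet_limsup hA)] at hlim
  filter_upwards [hpos, hlim] with f h1 h2
  refine regularStream_of_frequently h1 ?_
  rw [mem_limsup_iff_frequently_mem] at h2
  exact Nat.frequently_atTop_iff_infinite.1 h2

lemma ae_regularStream_sourceLaw : ∀ᵐ e ∂𝒥.sourceLaw, ∀ c, RegularStream (e c) := by
  rw [ae_all_iff]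
  intro c
  have h1 : 𝒥.sourceLaw.map (fun e => e c) = 𝒥.streamLaw c := by
    rw [sourceLaw, ← Measure.infinitePi_eq_pi]
    exact Measure.infinitePi_map_eval _ c
  have h2 := ae_regularStream (𝒥 := 𝒥) c
  rw [← h1] at h2
  exact ae_of_ae_map (measurable_pi_apply c).aemeasurable h2

variable {I : Type*} [Finite I] {cls : ℝ → Option I}

/-- Every stage faces fresh sources, so the almost sure existence of a winner at the first event
holds at all later ones. -/
lemma ae_iterate_wins (hcls : Measurable cls) (H : Measure (ι → ℕ)) [SFinite H] :
    ∀ᵐ z ∂(𝒥.stageLaw H cls 0).prod 𝒥.sourceLaw, ∀ r, ∃ c,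
      𝒥.Wins ((𝒥.step cls)^[r] z).1.1.1 ((𝒥.step cls)^[r] z).2 c := by
  rw [ae_all_iff]
  intro r
  have hm := (𝒥.measurable_step hcls).iterate r
  have h1 : ∀ᵐ z ∂(𝒥.stageLaw H cls r).prod 𝒥.sourceLaw, ∃ c, 𝒥.Wins z.1.1.1 z.2 c := by
    have hS : MeasurableSet {z : (Config ι I × ℝ) × Sources ι | ∃ c, 𝒥.Wins z.1.1.1 z.2 c} := by
      have : {z : (Config ι I × ℝ) × Sources ι | ∃ c, 𝒥.Wins z.1.1.1 z.2 c} =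
          ⋃ c, {z | 𝒥.Wins z.1.1.1 z.2 c} := by ext; simp
      rw [this]
      exact MeasurableSet.iUnion fun c => (𝒥.measurableSet_wins c).preimage
        (by fun_prop : Measurable (fun z : (Config ι I × ℝ) × Sources ι => (z.1.1.1, z.2)))
    rw [Measure.ae_prod_iff_ae_ae hS]
    exact ae_of_all _ fun z => 𝒥.ae_exists_wins z.1.1
  rw [← 𝒥.map_iterate_step hcls] at h1
  exact ae_of_ae_map hm.aemeasurable h1

end OpenNetworkData

section StepPaths

lemma locallyIntegrable_of_eventually_eq {f : ℝ → ℝ} (hr : ∀ x, ∃ a, ∀ᶠ s in 𝓝[>] x, f s = a)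
    (hl : ∀ x, ∃ a, ∀ᶠ s in 𝓝[<] x, f s = a) : LocallyIntegrable f := by
  intro x
  obtain ⟨a, ha⟩ := hr x
  obtain ⟨b, hb⟩ := hl x
  obtain ⟨u, hu, hxu⟩ := mem_nhdsGT_iff_exists_Ioo_subset.1 ha
  obtain ⟨l, hlx, hlx'⟩ := mem_nhdsLT_iff_exists_Ioo_subset.1 hb
  rw [Set.mem_Ioi] at hu
  rw [Set.mem_Iio] at hlx
  refine ⟨Set.Ioo l u, Ioo_mem_nhds hlx hu, ?_⟩
  have h1 : IntegrableOn f (Set.Ioo l x) := by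
    refine (integrableOn_congr_fun (fun s hs => hlx' hs) measurableSet_Ioo).2 ?_
    exact integrableOn_const (by simp)
  have h2 : IntegrableOn f (Set.Ioo x u) := by
    refine (integrableOn_congr_fun (fun s hs => hxu hs) measurableSet_Ioo).2 ?_
    exact integrableOn_const (by simp)
  have h3 : Set.Ioo l u = Set.Ioo l x ∪ {x} ∪ Set.Ioo x u := by
    rw [Set.Ioo_union_right hlx, Set.Ioc_union_Ioo_eq_Ioo hlx.le hu]
  rw [h3]
  exact (h1.union (integrableOn_singleton (hx := by rw [Real.volume_singleton]; simp))).union h2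

lemma locallyIntegrable_comp_path {E : Type*} {n : ℝ≥0 → E}
    (h : ∀ t, (∀ᶠ s in 𝓝[>] t, n s = n t) ∧ ∃ a, ∀ᶠ s in 𝓝[<] t, n s = a) (g : E → ℝ) :
    LocallyIntegrable (fun s : ℝ => g (n s.toNNReal)) := by
  refine locallyIntegrable_of_eventually_eq (fun x => ?_) (fun x => ?_)
  · rcases lt_or_ge x 0 with hx | hx
    · refine ⟨g (n 0), ?_⟩
      filter_upwards [mem_nhdsWithin_of_mem_nhds (Iio_mem_nhds hx)] with s hs
      rw [Real.toNNReal_of_nonpos (Set.mem_Iio.1 hs).le]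
    · have ht : Tendsto Real.toNNReal (𝓝[>] x) (𝓝[>] x.toNNReal) := by
        refine tendsto_nhdsWithin_of_tendsto_nhds_of_eventually_within _
          ((continuous_real_toNNReal.tendsto x).mono_left nhdsWithin_le_nhds) ?_
        filter_upwards [self_mem_nhdsWithin] with s hs
        rw [Set.mem_Ioi] at hs ⊢
        exact (Real.toNNReal_lt_toNNReal_iff (hx.trans_lt hs)).2 hs
      refine ⟨g (n x.toNNReal), ?_⟩
      filter_upwards [ht.eventually (h _).1] with s hs
      rw [hs]
  · rcases le_or_gt x 0 with hx | hx
    · refine ⟨g (n 0), ?_⟩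
      filter_upwards [self_mem_nhdsWithin] with s hs
      rw [Real.toNNReal_of_nonpos ((Set.mem_Iio.1 hs).le.trans hx)]
    · have ht : Tendsto Real.toNNReal (𝓝[<] x) (𝓝[<] x.toNNReal) := by
        refine tendsto_nhdsWithin_of_tendsto_nhds_of_eventually_within _
          ((continuous_real_toNNReal.tendsto x).mono_left nhdsWithin_le_nhds) ?_
        filter_upwards [self_mem_nhdsWithin] with s hs
        rw [Set.mem_Iio] at hs ⊢
        exact (Real.toNNReal_lt_toNNReal_iff hx).2 hs
      obtain ⟨a, ha⟩ := (h x.toNNReal).2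
      refine ⟨g a, ?_⟩
      filter_upwards [ht.eventually ha] with s hs
      rw [hs]

end StepPaths

namespace OpenJacksonNetwork

variable {ι : Type*} [Fintype ι] {𝒥 : OpenNetworkData ι}
  {Ω : Type*} [MeasurableSpace Ω] {P : Measure Ω}

/-- The work done by channel `c` during `[0, t]`. -/
noncomputable def level (X : OpenJacksonNetwork 𝒥 P) (ω : Ω) : ι ⊕ ι → ℝ≥0 → ℝ
  | .inl j, t => 𝒥.ν j * t
  | .inr j, t => ∫ s in (0 : ℝ)..t, (𝒥.μ j (X.N s.toNNReal ω j) : ℝ)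

/-- Almost every path is driven by the sources. -/
lemma ae_isPath [IsProbabilityMeasure P] (X : OpenJacksonNetwork 𝒥 P) :
    ∀ᵐ ω ∂P, 𝒥.IsPath (fun t => X.N t ω) (X.level ω) (X.sources ω) := by
  have h1 : ∀ᵐ ω ∂P, ∀ c, RegularStream (X.sources ω c) := by
    have := OpenNetworkData.ae_regularStream_sourceLaw (𝒥 := 𝒥)
    rw [← X.map_sources] at this
    exact ae_of_ae_map X.measurable_sources.aemeasurable this
  filter_upwards [h1, X.path_regular, X.balance] with ω hreg hpath hbal
  -- Integrability ensures that integrals over adjacent intervals add up, instead of taking the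
  -- default value `0`.
  have hint : ∀ j (a b : ℝ), IntervalIntegrable
      (fun s : ℝ => (𝒥.μ j (X.N s.toNNReal ω j) : ℝ)) volume a b := fun j a b =>
    ((locallyIntegrable_comp_path hpath (fun x => (𝒥.μ j (x j) : ℝ))).integrableOn_isCompact
      isCompact_uIcc).intervalIntegrable
  have hadd : ∀ j (a b : ℝ≥0), X.level ω (.inr j) b = X.level ω (.inr j) a +
      ∫ s in (a : ℝ)..b, (𝒥.μ j (X.N s.toNNReal ω j) : ℝ) := fun j a b =>
    (intervalIntegral.integral_add_adjacent_intervals (hint j 0 a) (hint j a b)).symm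
  refine ⟨hreg, fun t => (hpath t).1, ?_, ?_, ?_, hbal⟩
  · rintro (j | j) <;> simp [level]
  · rintro (j | j) a b hab
    · simp only [level]
      gcongr
    · rw [hadd j a b]
      refine le_add_of_nonneg_right (intervalIntegral.integral_nonneg (by exact_mod_cast hab) ?_)
      exact fun s _ => NNReal.coe_nonneg _
  · rintro (j | j) a b x hab hx
    · simp only [level, OpenNetworkData.rate]
      ring
    · rw [hadd j a b]
      congr 1
      rw [intervalIntegral.integral_congr_Ioo_of_le (g := fun _ => (𝒥.μ j (x j) : ℝ))
        (by exact_mod_cast hab)]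
      · simp [OpenNetworkData.rate, mul_comm]
      · intro s hs
        have h0 : 0 ≤ s := a.coe_nonneg.trans hs.1.le
        have h2 := hx s.toNNReal (by rw [Real.le_toNNReal_iff_coe_le h0]; exact hs.1.le)
          ((Real.toNNReal_lt_iff_lt_coe h0).2 hs.2)
        simp only [h2]

end OpenJacksonNetwork

/-! ### The law of the state and of the departures in windows -/

namespace OpenJacksonNetwork

variable {ι : Type*} [Fintype ι] {𝒥 : OpenNetworkData ι}
  {Ω : Type*} [MeasurableSpace Ω] {P : Measure Ω} {I : Type*} {cls : ℝ → Option I}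
  {b b' : I → ℝ}

/-- The state at time `t` and the numbers of departures in the windows `(b i, b' i]`. -/
noncomputable def config (X : OpenJacksonNetwork 𝒥 P) (b b' : I → ℝ) (t : ℝ≥0) (ω : Ω) :
    Config ι I :=
  (X.N t ω, fun k i => X.departures k (b' i).toNNReal ω - X.departures k (b i).toNNReal ω)

variable (I) in
/-- The starting point of the construction event by event. -/
def start (X : OpenJacksonNetwork 𝒥 P) (ω : Ω) : (Config ι I × ℝ) × Sources ι :=
  (((X.N 0 ω, fun _ _ => 0), 0), X.sources ω)

variable [Finite I] [IsProbabilityMeasure P] (X : OpenJacksonNetwork 𝒥 P)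

omit [Finite I] [IsProbabilityMeasure P] in
lemma measurable_start : Measurable (X.start I) := by
  have h1 := X.measurable_N 0
  have h2 := X.measurable_sources
  unfold start
  fun_prop

omit [Finite I] in
lemma map_start (cls : ℝ → Option I) :
    P.map (X.start I) = (𝒥.stageLaw (P.map (X.N 0)) cls 0).prod 𝒥.sourceLaw := by
  have h1 : (𝒥.stageLaw (P.map (X.N 0)) cls 0).prod 𝒥.sourceLaw =
      ((P.map (X.N 0)).map (fun x => ((x, fun _ _ => 0), 0))).prod (𝒥.sourceLaw.map id) := by
    rw [Measure.map_id]
    rfl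
  rw [h1, Measure.map_prod_map _ _ (by fun_prop) measurable_id, ← X.map_initial_sources,
    Measure.map_map (by fun_prop) ((X.measurable_N 0).prodMk X.measurable_sources)]
  rfl

/-- The construction event by event reaches the configuration of the path, and
`eq_of_iterate_occupied` shows that it reaches no other at time `t`. -/
lemma ae_config_eq_iff (hm : Measurable cls) (hcls : ∀ s i, cls s = some i ↔ b i < s ∧ s ≤ b' i)
    (hb : ∀ i, b i ≤ b' i) {t : ℝ≥0} (hT : ∀ i, b' i ≤ t) :
    ∀ᵐ ω ∂P, ∀ y, X.config b b' t ω = y ↔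
      ω ∈ ⋃ r, X.start I ⁻¹' ((𝒥.step cls)^[r] ⁻¹' 𝒥.occupied t y) := by
  have h1 := OpenNetworkData.ae_iterate_wins (𝒥 := 𝒥) hm (P.map (X.N 0))
  rw [← X.map_start cls] at h1
  filter_upwards [X.ae_isPath, ae_of_ae_map X.measurable_start.aemeasurable h1] with ω hpath hwin y
  obtain ⟨r, hr⟩ := hpath.exists_iterate_occupied hcls hb hT hwin
  have hr' : (𝒥.step cls)^[r] (X.start I ω) ∈ 𝒥.occupied t (X.config b b' t ω) := hr
  simp only [Set.mem_iUnion, Set.mem_preimage]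
  constructor
  · rintro rfl
    exact ⟨r, hr'⟩
  · rintro ⟨r', hy⟩
    exact (OpenNetworkData.eq_of_iterate_occupied hr' hy).2

omit [IsProbabilityMeasure P] in
lemma measurableSet_reached (hm : Measurable cls) (t : ℝ) (y : Config ι I) (r : ℕ) :
    MeasurableSet (X.start I ⁻¹' ((𝒥.step cls)^[r] ⁻¹' 𝒥.occupied t y)) :=
  X.measurable_start ((𝒥.measurable_step hm).iterate r (𝒥.measurableSet_occupied t y))

/-- Measurability of the departures is derived: up to a null set, each of the countably many values
is taken on a measurable event of the construction. -/
lemma aemeasurable_config (hm : Measurable cls)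
    (hcls : ∀ s i, cls s = some i ↔ b i < s ∧ s ≤ b' i) (hb : ∀ i, b i ≤ b' i) {t : ℝ≥0}
    (hT : ∀ i, b' i ≤ t) : AEMeasurable (X.config b b' t) P := by
  have h1 : ∀ y, NullMeasurableSet (X.config b b' t ⁻¹' {y}) P := by
    intro y
    refine NullMeasurableSet.congr (MeasurableSet.iUnion fun r =>
      X.measurableSet_reached hm t y r).nullMeasurableSet (eventuallyEq_set.2 ?_)
    filter_upwards [X.ae_config_eq_iff hm hcls hb hT] with ω hω
    exact (hω y).symm
  refine NullMeasurable.aemeasurable fun s _ => ?_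
  rw [← Set.biUnion_of_singleton s, Set.preimage_iUnion₂]
  exact NullMeasurableSet.biUnion s.to_countable fun y _ => h1 y

lemma map_config_singleton (hm : Measurable cls)
    (hcls : ∀ s i, cls s = some i ↔ b i < s ∧ s ≤ b' i) (hb : ∀ i, b i ≤ b' i) {t : ℝ≥0}
    (hT : ∀ i, b' i ≤ t) (y : Config ι I) :
    P.map (X.config b b' t) {y} = ∑' r, 𝒥.occupation (P.map (X.N 0)) cls r t y := by
  rw [Measure.map_apply_of_aemeasurable (X.aemeasurable_config hm hcls hb hT)
    (measurableSet_singleton y)]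
  have h1 : P (X.config b b' t ⁻¹' {y}) =
      P (⋃ r, X.start I ⁻¹' ((𝒥.step cls)^[r] ⁻¹' 𝒥.occupied t y)) := by
    refine measure_congr (eventuallyEq_set.2 ?_)
    filter_upwards [X.ae_config_eq_iff hm hcls hb hT] with ω hω
    exact hω y
  rw [h1, measure_iUnion _ (X.measurableSet_reached hm t y)]
  · refine tsum_congr fun r => ?_
    rw [← 𝒥.measure_iterate_occupied hm, ← X.map_start cls,
      Measure.map_apply X.measurable_start
        ((𝒥.measurable_step hm).iterate r (𝒥.measurableSet_occupied t y))]
  · intro r r' hne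
    refine Set.disjoint_left.2 fun ω h h' => hne ?_
    exact (OpenNetworkData.eq_of_iterate_occupied h h').1

end OpenJacksonNetwork

namespace OpenNetworkData

variable {ι : Type*} [Fintype ι] {𝒥 : OpenNetworkData ι}

/-- The product form of the stationary distribution, not normalized. -/
noncomputable def productForm (𝒥 : OpenNetworkData ι) (α : ι → ℝ≥0) (x : ι → ℕ) : ℝ≥0 :=
  ∏ j, ∏ n ∈ Finset.range (x j), α j / 𝒥.μ j (n + 1)

lemma productForm_zero (α : ι → ℝ≥0) : 𝒥.productForm α 0 = 1 := by
  simp [productForm]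

lemma isProductForm_productForm (α : ι → ℝ≥0) : 𝒥.IsProductForm α (𝒥.productForm α) := by
  classical
  intro x k
  have h1 : ∀ j, ∏ n ∈ Finset.range ((x + Pi.single k 1 : ι → ℕ) j), α j / 𝒥.μ j (n + 1) =
      (∏ n ∈ Finset.range (x j), α j / 𝒥.μ j (n + 1)) *
        if j = k then α k / 𝒥.μ k (x k + 1) else 1 := by
    intro j
    by_cases hj : j = k
    · subst hj
      rw [Pi.add_apply, Pi.single_eq_same, Finset.prod_range_succ, if_pos rfl]
    · simp [hj]
  have hμ : 𝒥.μ k (x k + 1) ≠ 0 := (𝒥.μ_pos k _ (Nat.succ_pos _)).ne'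
  simp only [productForm, h1, Finset.prod_mul_distrib, Finset.prod_ite_eq', Finset.mem_univ,
    if_true]
  rw [mul_assoc, div_mul_cancel₀ _ hμ, mul_comm]

end OpenNetworkData

namespace OpenJacksonNetwork

variable {ι : Type*} [Fintype ι] {𝒥 : OpenNetworkData ι}
  {Ω : Type*} [MeasurableSpace Ω] {P : Measure Ω} [IsProbabilityMeasure P]
  {X : OpenJacksonNetwork 𝒥 P} {α : ι → ℝ≥0}

omit [IsProbabilityMeasure P] in
lemma IsStationary.map_eq (hX : X.IsStationary) (t : ℝ≥0) : P.map (X.N t) = P.map (X.N 0) := by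
  have h := ((hX t).comp (measurable_pi_apply 0)).map_eq
  simpa [Function.comp_def] using h

lemma IsStationary.map_singleton (hX : X.IsStationary) (hα : 𝒥.TrafficEquations α) (x : ι → ℕ) :
    P.map (X.N 0) {x} = P.map (X.N 0) {0} * 𝒥.productForm α x := by
  have := Measure.isProbabilityMeasure_map (μ := P) (X.measurable_N 0).aemeasurable
  refine OpenNetworkData.stationary_eq_productForm hα (OpenNetworkData.isProductForm_productForm α)
    (OpenNetworkData.productForm_zero α) _ one_pos (fun x => ?_) x
  -- With no windows, the configuration is just the state; any positive time would serve in place of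
  -- `1`.
  have h1 := X.map_config_singleton (cls := OpenNetworkData.noWindow) (b := fun i => i.elim)
    (b' := fun i => i.elim) OpenNetworkData.isWindowClock_noWindow.measurable_cls
    (fun _ i => i.elim) (fun i => i.elim) (t := 1) (fun i => i.elim) (x, 0)
  rw [NNReal.coe_one] at h1
  rw [← h1, ← hX.map_eq 1, Measure.map_apply_of_aemeasurable
    (X.aemeasurable_config (cls := OpenNetworkData.noWindow)
      OpenNetworkData.isWindowClock_noWindow.measurable_cls
    (fun _ i => i.elim) (fun i => i.elim) (fun i => i.elim)) (measurableSet_singleton _),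
    Measure.map_apply (X.measurable_N 1) (measurableSet_singleton _)]
  congr 1
  ext ω
  simp only [Set.mem_preimage, Set.mem_singleton_iff, config]
  exact ⟨fun h => congrArg Prod.fst h, fun h => Prod.ext h (Subsingleton.elim _ _)⟩

/-- Given a window clock, the state at time `t` and the numbers of departures in the windows are
independent, and the latter have Poisson laws. -/
lemma IsStationary.map_config (hX : X.IsStationary) (hα : 𝒥.TrafficEquations α) {I : Type*}
    [Fintype I] {cls : ℝ → Option I} {Λ : I → ℝ → ℝ} (hΛ : IsWindowClock cls Λ) {b b' : I → ℝ}
    (hcls : ∀ s i, cls s = some i ↔ b i < s ∧ s ≤ b' i) (hb : ∀ i, b i ≤ b' i) {t : ℝ≥0}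
    (hT : ∀ i, b' i ≤ t) :
    P.map (X.config b b' t) = (P.map (X.N 0)).prod (Measure.pi fun k => Measure.pi fun i =>
      poissonMeasure (α k * 𝒥.exitProb k * (Λ i t).toNNReal)) := by
  have hae := X.aemeasurable_config hΛ.measurable_cls hcls hb hT
  have := Measure.isProbabilityMeasure_map (μ := P) (X.measurable_N 0).aemeasurable
  have := Measure.isProbabilityMeasure_map hae
  set c : ℝ≥0 := (P.map (X.N 0) {0}).toNNReal with hc
  have hc' : (c : ℝ≥0∞) = P.map (X.N 0) {0} := ENNReal.coe_toNNReal (measure_ne_top _ _)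
  have hch : 𝒥.IsProductForm α (fun x => c * 𝒥.productForm α x) := by
    intro x k
    rw [mul_assoc, OpenNetworkData.isProductForm_productForm α x k, mul_left_comm]
  have hπ : ∀ x, P.map (X.N 0) {x} = ((c * 𝒥.productForm α x : ℝ≥0) : ℝ≥0∞) := by
    intro x
    rw [hX.map_singleton hα x, ENNReal.coe_mul, hc']
  -- Domination suffices, since both measures have mass one. No converse bound on the occupation
  -- probabilities is needed.
  refine Measure.eq_of_le_of_isProbabilityMeasure (Measure.le_iff.2 fun s _ => ?_)
  have key : ∀ y : Config ι I, P.map (X.config b b' t) {y} ≤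
      (P.map (X.N 0)).prod (Measure.pi fun k => Measure.pi fun i =>
        poissonMeasure (α k * 𝒥.exitProb k * (Λ i t).toNNReal)) {y} := by
    intro y
    rw [X.map_config_singleton hΛ.measurable_cls hcls hb hT]
    refine (OpenNetworkData.tsum_occupation_le hα hch hΛ (fun x => (hπ x).le)
      t.coe_nonneg y).trans (le_of_eq ?_)
    rw [← hπ, ← Prod.mk.eta (p := y), ← Set.singleton_prod_singleton, Measure.prod_prod,
      Measure.pi_singleton]
    congr 1
    simp only [Measure.pi_singleton, poissonMeasure_singleton]
    rw [counterLaw, ENNReal.ofReal_prod_of_nonneg]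
    · refine Finset.prod_congr rfl fun k _ => ?_
      rw [ENNReal.ofReal_prod_of_nonneg]
      · refine Finset.prod_congr rfl fun i _ => ?_
        simp [poissonWeight, OpenNetworkData.exitRate, Real.coe_toNNReal _ (hΛ.nonneg i t)]
      · exact fun i _ => poissonWeight_nonneg (mul_nonneg (NNReal.coe_nonneg _) (hΛ.nonneg i t)) _
    · exact fun k _ => Finset.prod_nonneg fun i _ =>
        poissonWeight_nonneg (mul_nonneg (NNReal.coe_nonneg _) (hΛ.nonneg i t)) _
  rw [← Measure.tsum_indicator_apply_singleton _ s (Set.to_countable s).measurableSet,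
    ← Measure.tsum_indicator_apply_singleton (Measure.prod _ _) s
      (Set.to_countable s).measurableSet]
  exact ENNReal.tsum_le_tsum fun y => Set.indicator_le_indicator (key y)

end OpenJacksonNetwork

/-! ### Time windows and grids -/

section Windows

variable {I : Type*} [Finite I]

lemma isWindowClock_of_windows {cls : ℝ → Option I} {b b' : I → ℝ}
    (hcls : ∀ s i, cls s = some i ↔ b i < s ∧ s ≤ b' i) (h0 : ∀ i, 0 ≤ b i)
    (hb : ∀ i, b i ≤ b' i) :
    IsWindowClock cls (fun i s => max 0 (min s (b' i) - b i)) where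
  measurable_cls := by
    have h1 : ∀ i, MeasurableSet (cls ⁻¹' {some i}) := fun i => by
      have : cls ⁻¹' {some i} = Set.Ioc (b i) (b' i) := by
        ext s
        exact hcls s i
      rw [this]
      exact measurableSet_Ioc
    refine measurable_to_countable' fun o => ?_
    cases o with
    | some i => exact h1 i
    | none =>
      have : cls ⁻¹' {none} = (⋃ i, cls ⁻¹' {some i})ᶜ := by
        ext s
        cases h : cls s <;> simp [h]
      rw [this]
      exact (MeasurableSet.iUnion h1).compl
  continuous i := by fun_prop
  zero i := max_eq_left (by linarith [min_le_left 0 (b' i), h0 i])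
  nonneg i t := le_max_left _ _
  hasDerivAt := by
    classical
    refine ⟨Set.range b ∪ Set.range b',
      ((Set.finite_range b).union (Set.finite_range b')).countable, fun s hs _ i => ?_⟩
    have h1 : s ≠ b i := fun h => hs (Or.inl ⟨i, h.symm⟩)
    have h2 : s ≠ b' i := fun h => hs (Or.inr ⟨i, h.symm⟩)
    rcases lt_or_gt_of_ne h1 with h | h
    · rw [if_neg fun hc => absurd ((hcls s i).1 hc).1 (not_lt.2 h.le)]
      refine (hasDerivAt_const s (0 : ℝ)).congr_of_eventuallyEq ?_
      filter_upwards [Iio_mem_nhds h] with u hu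
      rw [Set.mem_Iio] at hu
      exact max_eq_left (by linarith [min_le_left u (b' i)])
    · rcases lt_or_gt_of_ne h2 with h' | h'
      · rw [if_pos ((hcls s i).2 ⟨h, h'.le⟩)]
        refine ((hasDerivAt_id s).sub_const (b i)).congr_of_eventuallyEq ?_
        filter_upwards [Ioo_mem_nhds h h'] with u hu
        rw [min_eq_left hu.2.le, max_eq_right (by linarith [hu.1])]
        rfl
      · rw [if_neg fun hc => absurd ((hcls s i).1 hc).2 (not_le.2 h')]
        refine (hasDerivAt_const s (b' i - b i)).congr_of_eventuallyEq ?_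
        filter_upwards [Ioi_mem_nhds h'] with u hu
        rw [min_eq_right (Set.mem_Ioi.1 hu).le, max_eq_right (by linarith [hb i])]

omit [Finite I] in
open Classical in
lemma exists_windows {b b' : I → ℝ}
    (h : ∀ i j s, b i < s → s ≤ b' i → b j < s → s ≤ b' j → i = j) :
    ∃ cls : ℝ → Option I, ∀ s i, cls s = some i ↔ b i < s ∧ s ≤ b' i := by
  refine ⟨fun s => if hs : ∃ i, b i < s ∧ s ≤ b' i then some hs.choose else none, fun s i => ?_⟩
  by_cases hs : ∃ i, b i < s ∧ s ≤ b' i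
  · simp only [dif_pos hs, Option.some.injEq]
    constructor
    · rintro rfl
      exact hs.choose_spec
    · exact fun hi => h _ _ s hs.choose_spec.1 hs.choose_spec.2 hi.1 hi.2
  · simp only [dif_neg hs]
    exact ⟨fun hc => by simp at hc, fun hi => absurd ⟨i, hi⟩ hs⟩

lemma exists_grid (K : Finset ℝ≥0) {t : ℝ≥0} (hK : ∀ s ∈ K, s ≤ t) :
    ∃ (a : ℕ → ℝ≥0) (n : ℕ), Monotone a ∧ a 0 = 0 ∧ a n ≤ t ∧ ∀ s ∈ K, ∃ m ≤ n, a m = s := by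
  classical
  obtain ⟨n, hn⟩ : ∃ n, (insert 0 K).card = n + 1 :=
    ⟨_, (Nat.succ_pred_eq_of_pos (Finset.card_pos.2 ⟨0, Finset.mem_insert_self 0 K⟩)).symm⟩
  have hlt : ∀ m, min m n < n + 1 := fun m => Nat.lt_succ_of_le (min_le_right m n)
  -- The times of `K` and `0` in increasing order; indices beyond `n` repeat the last time, which
  -- makes the sequence monotone on all of `ℕ`.
  refine ⟨fun m => (insert 0 K).orderEmbOfFin hn ⟨min m n, hlt m⟩, n, ?_, ?_, ?_, ?_⟩
  · intro m m' h
    exact ((insert 0 K).orderEmbOfFin hn).monotone (Fin.mk_le_mk.2 (min_le_min_right n h))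
  · have h0 : (0 : ℝ≥0) ∈ Set.range ((insert 0 K).orderEmbOfFin hn) := by
      rw [Finset.range_orderEmbOfFin]
      simp
    obtain ⟨i, hi⟩ := h0
    refine le_antisymm (le_trans ?_ hi.le) zero_le
    refine ((insert 0 K).orderEmbOfFin hn).monotone (Fin.mk_le_of_le_val ?_)
    simp
  · have := (insert 0 K).orderEmbOfFin_mem hn ⟨min n n, hlt n⟩
    rcases Finset.mem_insert.1 this with h | h
    · exact h.le.trans zero_le
    · exact hK _ h
  · intro s hs
    have h0 : s ∈ Set.range ((insert 0 K).orderEmbOfFin hn) := by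
      rw [Finset.range_orderEmbOfFin]
      simp [hs]
    obtain ⟨i, hi⟩ := h0
    have hi' := Nat.le_of_lt_succ i.2
    exact ⟨i, hi', (congrArg ((insert 0 K).orderEmbOfFin hn)
      (Fin.ext (min_eq_left hi') : (⟨min i n, hlt i⟩ : Fin (n + 1)) = i)).trans hi⟩

end Windows

section ProductLaws

variable {Ω : Type*} [MeasurableSpace Ω] {P : Measure Ω} [IsProbabilityMeasure P]

omit [IsProbabilityMeasure P] in
lemma map_eval_of_map_eq_pi {S : Type*} [Fintype S] {β : S → Type*} [∀ i, MeasurableSpace (β i)]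
    {f : Ω → (i : S) → β i} (hf : AEMeasurable f P) {ν : (i : S) → Measure (β i)}
    [∀ i, IsProbabilityMeasure (ν i)] (h : P.map f = Measure.pi ν) (i : S) :
    P.map (fun ω => f ω i) = ν i := by
  have h1 : P.map (fun ω => f ω i) = (P.map f).map (Function.eval i) :=
    (AEMeasurable.map_map_of_aemeasurable (measurable_pi_apply i).aemeasurable hf).symm
  rw [h1, h, (measurePreserving_eval ν i).map_eq]

lemma iIndepFun_of_map_eq_pi {S : Type*} [Fintype S] {β : S → Type*} [∀ i, MeasurableSpace (β i)]
    {f : Ω → (i : S) → β i} (hf : AEMeasurable f P) {ν : (i : S) → Measure (β i)}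
    [∀ i, IsProbabilityMeasure (ν i)] (h : P.map f = Measure.pi ν) :
    iIndepFun (fun i ω => f ω i) P := by
  refine (iIndepFun_iff_map_fun_eq_pi_map (f := fun i ω => f ω i)
    fun i => (measurable_pi_apply i).comp_aemeasurable hf).2 ?_
  simp only [map_eval_of_map_eq_pi hf h]
  exact h

end ProductLaws

/-! ### Right continuity of the departure processes -/

section RightContinuity

lemma RegularStream.eventually_eventCount {ι : Type*} {f : ℕ → ℝ × Option ι} (hf : RegularStream f)
    (x : ℝ) : ∀ᶠ y in 𝓝[≥] x, eventCount f y = eventCount f x := by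
  have h1 : x < ∑ i ∈ Finset.range (eventCount f x + 1), (f i).1 := by
    by_contra hc
    exact lt_irrefl _ ((hf.lt_eventCount x _).2 (not_lt.1 hc))
  filter_upwards [self_mem_nhdsWithin, mem_nhdsWithin_of_mem_nhds (Iio_mem_nhds h1)] with y hy hy'
  refine le_antisymm (not_lt.1 fun hlt => ?_) (hf.eventCount_mono hy)
  exact absurd ((hf.lt_eventCount y _).1 hlt) (not_le.2 hy')

namespace OpenNetworkData.IsPath

variable {ι : Type*} [Fintype ι] {𝒥 : OpenNetworkData ι} {N : ℝ≥0 → ι → ℕ}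
  {L : ι ⊕ ι → ℝ≥0 → ℝ} {e : Sources ι}

lemma tendsto_level (h : 𝒥.IsPath N L e) (c : ι ⊕ ι) (t : ℝ≥0) :
    Tendsto (L c) (𝓝[>] t) (𝓝 (L c t)) := by
  obtain ⟨u, hu, hu'⟩ := mem_nhdsGT_iff_exists_Ioo_subset.1 (h.right t)
  have h1 : ∀ᶠ s : ℝ≥0 in 𝓝[>] t, L c t + 𝒥.rate c (N t) * ((s : ℝ) - t) = L c s := by
    filter_upwards [Ioo_mem_nhdsGT (Set.mem_Ioi.1 hu)] with s hs
    refine (h.level_const c t s (N t) hs.1.le fun r hr hrs => ?_).symm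
    rcases hr.eq_or_lt with rfl | hr
    · rfl
    · exact hu' ⟨hr, hrs.trans hs.2⟩
  refine Tendsto.congr' h1 ?_
  have h2 : Continuous fun s : ℝ≥0 => L c t + 𝒥.rate c (N t) * ((s : ℝ) - t) := by fun_prop
  have h3 := (h2.tendsto t).mono_left (nhdsWithin_le_nhds (s := Set.Ioi t))
  simpa using h3

lemma eventually_markCount (h : 𝒥.IsPath N L e) (c : ι ⊕ ι) (a : Option ι) (t : ℝ≥0) :
    ∀ᶠ s in 𝓝[>] t, markCount (e c) a (L c s) = markCount (e c) a (L c t) := by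
  have h1 : Tendsto (L c) (𝓝[>] t) (𝓝[≥] (L c t)) :=
    tendsto_nhdsWithin_of_tendsto_nhds_of_eventually_within _ (h.tendsto_level c t)
      (by filter_upwards [self_mem_nhdsWithin] with s hs using h.level_mono c (Set.mem_Ioi.1 hs).le)
  filter_upwards [h1.eventually ((h.regular c).eventually_eventCount (L c t))] with s hs
  simp only [markCount, hs]

lemma markCount_zero (h : 𝒥.IsPath N L e) (c : ι ⊕ ι) (a : Option ι) :
    markCount (e c) a (L c 0) = 0 := by
  refine markCount_eq_zero ((h.regular c).eventCount_eq_zero ?_) a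
  rw [h.level_zero]
  exact (h.regular c).pos 0

end OpenNetworkData.IsPath

end RightContinuity

/-! ### Increments over a grid, and the processes themselves -/

namespace OpenJacksonNetwork

variable {ι : Type*} [Fintype ι] {𝒥 : OpenNetworkData ι}
  {Ω : Type*} [MeasurableSpace Ω] {P : Measure Ω} [IsProbabilityMeasure P]
  {X : OpenJacksonNetwork 𝒥 P} {α : ι → ℝ≥0}

lemma ae_departures (X : OpenJacksonNetwork 𝒥 P) : ∀ᵐ ω ∂P, ∀ k,
    X.departures k 0 ω = 0 ∧ Monotone (fun t => X.departures k t ω) ∧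
      ∀ t, ∀ᶠ s in 𝓝[>] t, X.departures k s ω = X.departures k t ω := by
  filter_upwards [X.ae_isPath] with ω h k
  exact ⟨h.markCount_zero (.inr k) none, fun s t hst => (h.regular (.inr k)).markCount_mono none
    (h.level_mono (.inr k) hst), h.eventually_markCount (.inr k) none⟩

/-- The numbers of departures between successive times of a grid. -/
noncomputable def increments (X : OpenJacksonNetwork 𝒥 P) (a : ℕ → ℝ≥0) (n : ℕ) (ω : Ω) (k : ι)
    (i : Fin n) : ℕ :=
  X.departures k (a (i + 1)) ω - X.departures k (a i) ω

/-- The law of the numbers of departures between successive times of a grid. -/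
noncomputable def incrementsLaw (𝒥 : OpenNetworkData ι) (α : ι → ℝ≥0) (a : ℕ → ℝ≥0) (n : ℕ) :
    Measure (ι → Fin n → ℕ) :=
  Measure.pi fun k => Measure.pi fun i : Fin n =>
    poissonMeasure (α k * 𝒥.exitProb k * (a (i + 1) - a i))

lemma IsStationary.hasLaw_increments (hX : X.IsStationary) (hα : 𝒥.TrafficEquations α)
    {a : ℕ → ℝ≥0} (ha : Monotone a) {n : ℕ} {t : ℝ≥0} (ht : a n ≤ t) :
    HasLaw (fun ω => (X.N t ω, X.increments a n ω))
      ((P.map (X.N 0)).prod (incrementsLaw 𝒥 α a n)) P := by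
  -- The windows are the cells `(a i, a (i + 1)]`, disjoint by monotonicity; repeated grid times
  -- merely give empty cells.
  obtain ⟨cls, hcls⟩ := exists_windows (I := Fin n) (b := fun i => a i) (b' := fun i => a (i + 1))
    (by
      intro i j s hi hi' hj hj'
      by_contra hne
      rcases lt_or_gt_of_ne hne with h | h
      · have : a (i + 1) ≤ a j := ha (Nat.succ_le_of_lt h)
        exact absurd (hj.trans_le hi') (not_lt.2 (by exact_mod_cast this))
      · have : a (j + 1) ≤ a i := ha (Nat.succ_le_of_lt h)
        exact absurd (hi.trans_le hj') (not_lt.2 (by exact_mod_cast this)))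
  have hb : ∀ i : Fin n, (a i : ℝ) ≤ a (i + 1) := fun i => by exact_mod_cast ha (Nat.le_succ _)
  have hT : ∀ i : Fin n, (a (i + 1) : ℝ) ≤ t := fun i => by
    exact_mod_cast (ha (Nat.succ_le_of_lt i.2)).trans ht
  have hΛ := isWindowClock_of_windows hcls (fun i => (a i).coe_nonneg) hb
  have hconf : X.config (fun i : Fin n => (a i : ℝ)) (fun i => (a (i + 1) : ℝ)) t =
      fun ω => (X.N t ω, X.increments a n ω) := by
    funext ω
    simp only [config, Real.toNNReal_coe]
    rfl
  rw [← hconf]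
  refine ⟨X.aemeasurable_config hΛ.measurable_cls hcls hb hT, ?_⟩
  rw [hX.map_config hα hΛ hcls hb hT, incrementsLaw]
  congr 1
  refine congrArg _ (funext fun k => congrArg _ (funext fun i => ?_))
  rw [min_eq_right (hT i), max_eq_right (sub_nonneg.2 (hb i)),
    ← NNReal.coe_sub (by exact_mod_cast hb i), Real.toNNReal_coe]

lemma IsStationary.hasLaw_increments_snd (hX : X.IsStationary) (hα : 𝒥.TrafficEquations α)
    {a : ℕ → ℝ≥0} (ha : Monotone a) (n : ℕ) :
    HasLaw (X.increments a n) (incrementsLaw 𝒥 α a n) P := by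
  have := Measure.isProbabilityMeasure_map (μ := P) (X.measurable_N 0).aemeasurable
  have h := hX.hasLaw_increments hα ha (le_refl (a n))
  refine ⟨measurable_snd.comp_aemeasurable h.aemeasurable, ?_⟩
  have h1 : P.map (X.increments a n) =
      (P.map fun ω => (X.N (a n) ω, X.increments a n ω)).map Prod.snd :=
    (AEMeasurable.map_map_of_aemeasurable measurable_snd.aemeasurable h.aemeasurable).symm
  rw [h1, h.map_eq, Measure.map_snd_prod, measure_univ, one_smul]

lemma IsStationary.indepFun_increments (hX : X.IsStationary) (hα : 𝒥.TrafficEquations α)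
    {a : ℕ → ℝ≥0} (ha : Monotone a) {n : ℕ} {t : ℝ≥0} (ht : a n ≤ t) :
    IndepFun (X.increments a n) (X.N t) P := by
  have h := hX.hasLaw_increments hα ha ht
  have h2 := hX.hasLaw_increments_snd hα ha n
  refine ((indepFun_iff_map_prod_eq_prod_map_map (X.measurable_N t).aemeasurable
    h2.aemeasurable).2 ?_).symm
  rw [h.map_eq, h2.map_eq, hX.map_eq t]

lemma IsStationary.iIndepFun_increments (hX : X.IsStationary) (hα : 𝒥.TrafficEquations α)
    {a : ℕ → ℝ≥0} (ha : Monotone a) (n : ℕ) :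
    iIndepFun (fun k ω => X.increments a n ω k) P :=
  iIndepFun_of_map_eq_pi (hX.hasLaw_increments_snd hα ha n).aemeasurable
    (hX.hasLaw_increments_snd hα ha n).map_eq

lemma IsStationary.hasLaw_increments_node (hX : X.IsStationary) (hα : 𝒥.TrafficEquations α)
    {a : ℕ → ℝ≥0} (ha : Monotone a) (n : ℕ) (k : ι) :
    HasLaw (fun ω => X.increments a n ω k) (Measure.pi fun i : Fin n =>
      poissonMeasure (α k * 𝒥.exitProb k * (a (i + 1) - a i))) P :=
  ⟨(measurable_pi_apply k).comp_aemeasurable (hX.hasLaw_increments_snd hα ha n).aemeasurable,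
    map_eval_of_map_eq_pi (hX.hasLaw_increments_snd hα ha n).aemeasurable
      (hX.hasLaw_increments_snd hα ha n).map_eq k⟩

lemma IsStationary.hasIndepIncrements_departures (hX : X.IsStationary)
    (hα : 𝒥.TrafficEquations α) (k : ι) : HasIndepIncrements (X.departures k) P := by
  intro n t ht
  have ha : Monotone fun m => t ⟨min m n, Nat.lt_succ_of_le (min_le_right m n)⟩ :=
    fun m m' h => ht (Fin.mk_le_mk.2 (min_le_min_right n h))
  have h := hX.hasLaw_increments_node hα ha n k
  have h1 := iIndepFun_of_map_eq_pi h.aemeasurable h.map_eq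
  convert h1 using 4 with i ω
  simp only [increments]
  congr 3 <;> refine Fin.ext ?_
  · simp
  · simp

lemma IsStationary.hasLaw_departures_sub (hX : X.IsStationary) (hα : 𝒥.TrafficEquations α) (k : ι)
    {s t : ℝ≥0} (hst : s ≤ t) :
    HasLaw (fun ω => X.departures k t ω - X.departures k s ω)
      (poissonMeasure (α k * 𝒥.exitProb k * (t - s))) P := by
  -- A grid with the single cell `(s, t]`.
  have ha : Monotone fun m : ℕ => if m = 0 then s else t := by
    refine monotone_nat_of_le_succ fun m => ?_
    by_cases hm : m = 0 <;> simp [hm, hst]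
  have h := hX.hasLaw_increments_node hα ha 1 k
  refine ⟨(measurable_pi_apply (0 : Fin 1)).comp_aemeasurable h.aemeasurable, ?_⟩
  exact map_eval_of_map_eq_pi h.aemeasurable h.map_eq 0

lemma IsStationary.aemeasurable_departures (hX : X.IsStationary) (hα : 𝒥.TrafficEquations α)
    (k : ι) (t : ℝ≥0) : AEMeasurable (X.departures k t) P := by
  refine (hX.hasLaw_departures_sub hα k (zero_le (a := t))).aemeasurable.congr ?_
  filter_upwards [X.ae_departures] with ω h
  simp [(h k).1]

/-- The number of events in the first `m` of `n` windows. -/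
def partialSum {n : ℕ} (m : ℕ) (v : Fin n → ℕ) : ℕ :=
  ∑ i ∈ Finset.range m, if h : i < n then v ⟨i, h⟩ else 0

lemma ae_departures_eq_partialSum (X : OpenJacksonNetwork 𝒥 P) {a : ℕ → ℝ≥0} (ha : Monotone a)
    (h0 : a 0 = 0) {m n : ℕ} (hm : m ≤ n) (k : ι) :
    ∀ᵐ ω ∂P, partialSum m (X.increments a n ω k) = X.departures k (a m) ω := by
  filter_upwards [X.ae_departures] with ω h
  have h1 : Monotone fun m => X.departures k (a m) ω := (h k).2.1.comp ha
  have h2 : partialSum m (X.increments a n ω k) =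
      ∑ i ∈ Finset.range m, (X.departures k (a (i + 1)) ω - X.departures k (a i) ω) :=
    Finset.sum_congr rfl fun i hi => dif_pos ((Finset.mem_range.1 hi).trans_le hm)
  rw [h2, Finset.sum_range_tsub h1, h0, (h k).1, Nat.sub_zero]

lemma IsStationary.iIndepFun_departures (hX : X.IsStationary) (hα : 𝒥.TrafficEquations α) :
    iIndepFun (fun k ω (t : ℝ≥0) => X.departures k t ω) P := by
  classical
  refine iIndepFun.iIndepFun_process₀ (fun k t => hX.aemeasurable_departures hα k t)
    fun A J => ?_
  obtain ⟨a, n, ha, h0, -, hgrid⟩ := exists_grid (Finset.univ.biUnion J)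
    (t := (Finset.univ.biUnion J).sup id) fun s hs => Finset.le_sup (f := id) hs
  have hJ : ∀ (k : A) (s : J k), ∃ m ≤ n, a m = s := fun k s =>
    hgrid s (Finset.mem_biUnion.2 ⟨k, Finset.mem_univ k, s.2⟩)
  choose m hmn hm using hJ
  have h1 := ((hX.iIndepFun_increments hα ha n).precomp
    (Subtype.val_injective (p := (· ∈ A)))).comp
    (fun k v (s : J k) => partialSum (m k s) v) (fun k => measurable_of_countable _)
  refine (iIndepFun_congr fun k => ?_).1 h1
  have h2 : ∀ᵐ ω ∂P, ∀ s : J k, partialSum (m k s) (X.increments a n ω k) =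
      X.departures k (a (m k s)) ω := by
    rw [ae_all_iff]
    exact fun s => X.ae_departures_eq_partialSum ha h0 (hmn k s) k
  filter_upwards [h2] with ω hω
  funext s
  simp only [Function.comp_apply, hω, hm]

lemma IsStationary.indepFun_departures (hX : X.IsStationary) (hα : 𝒥.TrafficEquations α)
    (t : ℝ≥0) :
    IndepFun (fun ω (k : ι) (s : Set.Iic t) => X.departures k s ω) (X.N t) P := by
  classical
  -- Nodes and times are merged into one index, so that the family of all departure processes
  -- becomes a single process whose finite-dimensional marginals decide independence.
  have key : IndepFun (fun ω (q : ι × Set.Iic t) => X.departures q.1 q.2 ω) (X.N t) P := by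
    refine IndepFun.process_indepFun₀ (fun q => hX.aemeasurable_departures hα q.1 q.2)
      (X.measurable_N t).aemeasurable fun A => ?_
    obtain ⟨a, n, ha, h0, hat, hgrid⟩ := exists_grid (A.image fun q => (q.2 : ℝ≥0)) (t := t)
      (by
        intro s hs
        obtain ⟨q, -, rfl⟩ := Finset.mem_image.1 hs
        exact q.2.2)
    have hA : ∀ q : A, ∃ m ≤ n, a m = q.1.2 := fun q =>
      hgrid _ (Finset.mem_image_of_mem _ q.2)
    choose m hmn hm using hA
    have h1 := (hX.indepFun_increments hα ha hat).comp
      (measurable_of_countable fun (v : ι → Fin n → ℕ) (q : A) => partialSum (m q) (v q.1.1))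
      measurable_id
    refine h1.congr ?_ (EventuallyEq.refl _ _)
    have h2 : ∀ᵐ ω ∂P, ∀ q : A, partialSum (m q) (X.increments a n ω q.1.1) =
        X.departures q.1.1 (a (m q)) ω := by
      rw [ae_all_iff]
      exact fun q => X.ae_departures_eq_partialSum ha h0 (hmn q) q.1.1
    filter_upwards [h2] with ω hω
    funext q
    simp only [Function.comp_apply, hω, hm]
  exact key.comp (by fun_prop : Measurable fun (v : ι × Set.Iic t → ℕ) (k : ι) (s : Set.Iic t) =>
    v (k, s)) measurable_id

end OpenJacksonNetwork

theorem theorem2p3 {ι : Type*} [Fintype ι] {Ω : Type*} [MeasurableSpace Ω]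
    (P : Measure Ω) [IsProbabilityMeasure P] (𝒥 : OpenNetworkData ι)
    (X : OpenJacksonNetwork 𝒥 P) (hX : X.IsStationary)
    (α : ι → ℝ≥0) (hα : 𝒥.TrafficEquations α) :
    (∀ k, IsPoissonProcess (X.departures k) (α k * 𝒥.exitProb k) P) ∧
    iIndepFun (fun k ω (t : ℝ≥0) => X.departures k t ω) P ∧
    ∀ t₀ : ℝ≥0,
      IndepFun (fun ω (k : ι) (s : Set.Iic t₀) => X.departures k s ω) (X.N t₀) P := by
  refine ⟨fun k => ⟨?_, ?_, hX.hasIndepIncrements_departures hα k,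
    fun s t hst => hX.hasLaw_departures_sub hα k hst⟩, hX.iIndepFun_departures hα,
    hX.indepFun_departures hα⟩
  · filter_upwards [X.ae_departures] with ω h using (h k).1
  · filter_upwards [X.ae_departures] with ω h using (h k).2
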